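/- Let $A_\infty$ be the unital associative $\mathbb{Q}$-algebra generated by even variables $x_i$ ($i\ge 0$) and odd variables $\mu_i$ ($i\ge 0$) (so $x_ix_j=x_jx_i$, $x_i\mu_j=\mu_jx_i$, $\mu_i\mu_j=-\mu_j\mu_i$) subject to the vanishing of all coefficients of $$x(z)^2,\qquad x(z)\mu(z),\qquad \ddot x(z)\mu(z)-\dot x(z)\dot\mu(z),\qquad \mu(z)\dot\mu(z),$$ where $x(z)=\sum_i x_iz^i$, $\mu(z)=\sum_i\mu_iz^i$ and the dot is $d/dz$. For $n\ge 0$ let $A_n$ be the algebra with generators $x_0,\dots,x_{n-1}$, $\mu_0,\dots,\mu_{n-2}$ and the same relations, where now $x(z)=\sum_{i<n}x_iz^i$, $\mu(z)=\sum_{i<n-1}\mu_iz^i$ and only the coefficients of $z^0,\dots,z^{n-1}$ of the four series are set to zero. Give $x_i$ bidegree $(2i+2,2i)$ and $\mu_i$ bidegree $(2i+8,2i+3)$ (exponents of $q$ and $t$). Define polynomials $K_n(q,t)$, $n\ge 1$, by $K_1=1+q^2$, $K_2=1+q^2+q^4t^2+q^8t^3$, $K_3=1+q^2+q^4t^2+q^8t^3+q^6t^4+q^8t^4+q^{10}t^5+q^{12}t^5$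 and the Shumakovitch–Turner recursion $$K_n=K_{n-1}+q^{2n}t^{2n-2}K_{n-2}+q^{2n+4}t^{2n-1}K_{n-3}\qquad(n\ge 4),$$ and put $K_0=1$. Call a sequence of 0's and 1's (positions numbered from $0$) admissible if it contains no block $1111$, and no block $111$ except possibly at the beginning. The weight of an admissible sequence is the product of the weights of its maximal blocks of 1's: $q^{2i+2}t^{2i}$ for a block $1$ at position $i$, $q^{2i+8}t^{2i+3}$ for a block $11$ starting at position $i$, and $q^{12}t^5$ for an initial block $111$. To an infinite admissible sequence with finitely many 1's associate the monomial in $A_\infty$ that is the product over its blocks, from left to right, of $x_i$ for a block $1$ at position $i$, $\mu_i$ for a block $11$ starting at position $i$, and $x_0\mu_1$ for an initial block $111$. Then: 1. each $A_n$ ($0\le n\le\infty$) is the direct sum of its bihomogeneous components, and these are finite-dimensional; 2. for every $n\ge 0$, $K_n$ is the sum of the weights of all admissible sequences of length $n$; 3. the limit $K(q,t)=\lim_{n\to\infty}K_n(q,t)$ exists coefficientwise, and it is the bigraded Hilbert series of $A_\infty$; 4. the bigraded Hilbert series $P_n(q,t)$ of $A_n$ satisfy $\lim_{n\to\infty}P_n(q,t)=K(q,t)$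 coefficientwise; 5. the bidegree of the monomial associated to an admissible sequence is given by the weight of the sequence, and these monomials form a $\mathbb{Q}$-basis of $A_\infty$. -/

import Mathlib

open Filter
open scoped Topology MvPowerSeries.WithPiTopology

namespace StableKh

noncomputable section

/-! ## The algebra -/

/-- The generators: even variables `x i` and odd variables `mu i`. -/
inductive Gen : Type
  | x (i : ℕ) : Gen
  | mu (i : ℕ) : Gen

/-- The bidegree (exponent of `q`, exponent of `t`) of a generator. -/
def Gen.bideg : Gen → ℕ × ℕ
  | .x i => (2 * i + 2, 2 * i)
  | .mu i => (2 * i + 8, 2 * i + 3)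

/-- The free associative `ℚ`-algebra on the generators. -/
abbrev Free : Type := FreeAlgebra ℚ Gen

def fx (i : ℕ) : Free := FreeAlgebra.ι ℚ (Gen.x i)

def fmu (i : ℕ) : Free := FreeAlgebra.ι ℚ (Gen.mu i)

/-- The generating function `x(z) = ∑ x_i z^i`. -/
def xz : PowerSeries Free := PowerSeries.mk fx

/-- The generating function `μ(z) = ∑ μ_i z^i`. -/
def muz : PowerSeries Free := PowerSeries.mk fmu

/-- The formal derivative `d/dz` of a power series with coefficients in the free algebra. -/
def ddz (f : PowerSeries Free) : PowerSeries Free :=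
  PowerSeries.mk fun i => ((i : Free) + 1) * PowerSeries.coeff (i + 1) f

/-- The defining relations of the algebra at level `N`. The rules `xx`, `xmu`, `mumu` say that the
`x i` are even and the `mu i` are odd. The rules `xzero`, `muzero` leave only the generators
`x_0, …, x_{N-1}` and `μ_0, …, μ_{N-2}`. The last four rules are the coefficients of
`x(z)^2`, `x(z) μ(z)`, `x''(z) μ(z) - x'(z) μ'(z)` and `μ(z) μ'(z)`, modulo `z^N`.
For `N = ⊤` all generators and all coefficients are present. -/
inductive Rel (N : ℕ∞) : Free → Free → Prop
  | xx (i j : ℕ) : Rel N (fx i * fx j) (fx j * fx i)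
  | xmu (i j : ℕ) : Rel N (fx i * fmu j) (fmu j * fx i)
  | mumu (i j : ℕ) : Rel N (fmu i * fmu j) (-(fmu j * fmu i))
  | xzero (i : ℕ) (h : N ≤ (i : ℕ∞)) : Rel N (fx i) 0
  | muzero (i : ℕ) (h : N ≤ ((i + 1 : ℕ) : ℕ∞)) : Rel N (fmu i) 0
  | sq (m : ℕ) (h : (m : ℕ∞) < N) : Rel N (PowerSeries.coeff m (xz ^ 2)) 0
  | prod (m : ℕ) (h : (m : ℕ∞) < N) : Rel N (PowerSeries.coeff m (xz * muz)) 0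
  | deriv (m : ℕ) (h : (m : ℕ∞) < N) :
      Rel N (PowerSeries.coeff m (ddz (ddz xz) * muz - ddz xz * ddz muz)) 0
  | odd (m : ℕ) (h : (m : ℕ∞) < N) : Rel N (PowerSeries.coeff m (muz * ddz muz)) 0

/-- The algebra with generators `x_i` (`i < N`), `μ_i` (`i + 1 < N`) and the relations `Rel N`;
the algebra on infinitely many generators is `Alg ⊤`. -/
abbrev Alg (N : ℕ∞) : Type := RingQuot (Rel N)

/-- The class of a generator. -/
def gen (N : ℕ∞) (g : Gen) : Alg N := RingQuot.mkAlgHom ℚ (Rel N) (FreeAlgebra.ι ℚ g)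

/-- The class of a product of generators. -/
def wordProd (N : ℕ∞) (w : List Gen) : Alg N := (w.map (gen N)).prod

/-- The component of bidegree `d`, spanned by the monomials of total bidegree `d`. -/
def piece (N : ℕ∞) (d : ℕ × ℕ) : Submodule ℚ (Alg N) :=
  Submodule.span ℚ {a | ∃ w : List Gen, (w.map Gen.bideg).sum = d ∧ a = wordProd N w}

/-! ## Series in `q` and `t` -/

/-- Formal power series in `q` and `t`. -/
abbrev QT : Type := MvPowerSeries (Fin 2) ℤ

def q : QT := MvPowerSeries.X 0

def t : QT := MvPowerSeries.X 1

/-- The bigraded Hilbert series: the coefficient of `q^i t^j` is the dimension of the component of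
bidegree `(i, j)`. -/
def hilbertSeries (N : ℕ∞) : QT :=
  fun d => (Module.finrank ℚ (piece N (d 0, d 1)) : ℤ)

/-- The Shumakovitch-Turner recursion
`K_n = K_{n-1} + q^{2n} t^{2n-2} K_{n-2} + q^{2n+4} t^{2n-1} K_{n-3}` for `n ≥ 4`, started at the
Poincare polynomials of the torus knots `T(1,2)`, `T(2,3)`, `T(3,4)`. -/
def K : ℕ → QT
  | 0 => 1
  | 1 => 1 + q ^ 2
  | 2 => 1 + q ^ 2 + q ^ 4 * t ^ 2 + q ^ 8 * t ^ 3
  | 3 => 1 + q ^ 2 + q ^ 4 * t ^ 2 + q ^ 8 * t ^ 3 + q ^ 6 * t ^ 4 + q ^ 8 * t ^ 4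
      + q ^ 10 * t ^ 5 + q ^ 12 * t ^ 5
  | n + 4 => K (n + 3) + K (n + 2) * q ^ (2 * (n + 4)) * t ^ (2 * (n + 4) - 2)
      + K (n + 1) * q ^ (2 * (n + 4) + 4) * t ^ (2 * (n + 4) - 1)

/-! ## The combinatorial model

A sequence of 0's and 1's with finitely many 1's is given by the set of positions of its 1's;
the sequences of length `n` are the subsets of `Finset.range n`. -/

/-- No `1111` anywhere, and no `111` except at the beginning. -/
def Admissible (S : Finset ℕ) : Prop :=
  (∀ i ∈ S, ¬ (i + 1 ∈ S ∧ i + 2 ∈ S ∧ i + 3 ∈ S)) ∧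
    ∀ i ∈ S, i + 1 ∈ S → i + 2 ∈ S → i = 0

instance : DecidablePred Admissible := fun S => by
  unfold Admissible
  infer_instance

/-- The positions at which the blocks of 1's begin. -/
def blockStarts (S : Finset ℕ) : Finset ℕ := S.filter fun i => ∀ j ∈ S, j + 1 ≠ i

/-- The weight of the block beginning at `i`: a block `1`, a block `11`, or an initial `111`. -/
def blockWeight (S : Finset ℕ) (i : ℕ) : QT :=
  if i + 1 ∉ S then q ^ (2 * i + 2) * t ^ (2 * i)
  else if i + 2 ∉ S then q ^ (2 * i + 8) * t ^ (2 * i + 3)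
  else q ^ 12 * t ^ 5

/-- The weight of a sequence. -/
def weight (S : Finset ℕ) : QT := ∏ i ∈ blockStarts S, blockWeight S i

/-- The sum of the weights of all admissible sequences of length `n`. -/
def stateSum (n : ℕ) : QT := ∑ S ∈ (Finset.range n).powerset.filter Admissible, weight S

/-- The monomial matched to the block beginning at `i`: `x_i` for a block `1`, `μ_i` for a block
`11`, and `x_0 μ_1` for an initial `111`. -/
def blockWord (S : Finset ℕ) (i : ℕ) : List Gen :=
  if i + 1 ∉ S then [Gen.x i]
  else if i + 2 ∉ S then [Gen.mu i]
  else [Gen.x 0, Gen.mu 1]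

/-- The monomial in `Alg ⊤` matched to a sequence: the product over its blocks, from left to
right. -/
def seqMonomial (S : Finset ℕ) : Alg ⊤ :=
  wordProd ⊤ (((blockStarts S).sort (· ≤ ·)).flatMap (blockWord S))

end

end StableKh

/-!
The words in the generators that come from admissible sequences are the words in which adjacent
letters are far enough apart, with the one exception `x 0`, `mu 1`. Coding `x i` by `2 i` and `mu i`
by `2 i + 1`, the pairs `a b` of letters that may be adjacent are the `Good` ones, and a word is
`Normal` when all its adjacent pairs are good. The theorem rests on the fact
that normal words form a basis of `Alg ⊤`.

*Spanning.* Every pair `a b` that is not good is the leading term of a combination of the quadratic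
relations (`single_mem_lowerMod_of_not_good`), for the order in which a word is lower when its
letters are more spread out. Rewriting leading terms ends at normal words.

*Independence.* By Bergman's diamond lemma (`exists_normalForm_map`) it suffices to resolve the
overlaps `a b c` of two rewriting rules. The difference of the two ways to rewrite `a b c` reduces
to a combination of normal words of length three that lies in the ideal of the relations, so it
vanishes as soon as the normal words of length three are independent in the algebra. This is shown
by duality: in each degree, a linear functional on words of length three is a polynomial in
three variables, the generating function of its values. To kill the ideal it has to be
symmetric or antisymmetric in the variables of equal parity, and by the relations `x ^ 2`, `x μ`,
`x'' μ - x' μ'` and `μ μ'` it, or a derivative of it, has to vanish on the diagonals. The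
solutions are, according to the number of letters `mu`, the symmetric multiples of `vander ^ 2`,
two explicit families (`polyXXM` and `polyXMM`), and the symmetric multiples of `vander ^ 3`, where
`vander` is the product of the differences of the variables. Since a functional is determined by
its values on normal words, it is enough to exhibit as many independent solutions as there are
normal words of each degree; the injections `idxXXX`, `idxXXM`, `idxXMM`, `idxMMM` do this, and
`exists_dual` states the outcome.

*Gradings and limits.* A function on words extends to the algebra when it respects the relations in
every context (`exists_linearMap_of_words`). Applied to the function that keeps the words of
bidegree `d` and discards the others, this gives the projections to the components. It also
identifies the components of bidegree `d` at any two levels above the degree in `t`, because every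
relation of small degree holds at both levels (`exists_transfer`). Hence the Hilbert series
converge. The coefficient of the limit counts the admissible sequences of bidegree `d`, and so does
that of `stateSum n` for large `n`. Splitting off the last block of a sequence gives the recursion
for `stateSum`.
-/

namespace StableKh

/-! ### Rewriting of words and the diamond lemma -/

section Diamond

lemma linearMap_apply_eq_sum {β k M : Type*} [Field k] [AddCommGroup M] [Module k M]
    (T : (β →₀ k) →ₗ[k] M) (f : β →₀ k) :
    T f = f.sum fun u x => x • T (Finsupp.single u 1) := by
  conv_lhs => rw [← Finsupp.sum_single f]
  rw [Finsupp.sum, map_sum]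
  refine Finset.sum_congr rfl fun u _ => ?_
  show T _ = f u • T _
  rw [← map_smul, Finsupp.smul_single, smul_eq_mul, mul_one]

variable {α k : Type*} [Field k]

/-- Multiplication of a combination of words by the word `p` on the left and `s` on the right. -/
noncomputable def sandwich (p s : List α) : (List α →₀ k) →ₗ[k] (List α →₀ k) :=
  Finsupp.lmapDomain k k fun u => p ++ u ++ s

@[simp] lemma sandwich_single (p s u : List α) (c : k) :
    sandwich p s (Finsupp.single u c) = Finsupp.single (p ++ u ++ s) c := by
  simp [sandwich]

lemma sandwich_sandwich (p p' s s' : List α) (f : List α →₀ k) :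
    sandwich p s (sandwich p' s' f) = sandwich (p ++ p') (s' ++ s) f := by
  induction f using Finsupp.induction_linear with
  | zero => simp
  | add f g hf hg => simp [hf, hg]
  | single u c => simp

lemma exists_of_mem_support_sandwich {p s u : List α} {f : List α →₀ k}
    (h : u ∈ (sandwich p s f).support) : ∃ v ∈ f.support, u = p ++ v ++ s := by
  classical
  have := Finsupp.mapDomain_support h
  obtain ⟨v, hv, rfl⟩ := Finset.mem_image.1 this
  exact ⟨v, hv, rfl⟩

lemma apply_sandwich_eq_sum {M : Type*} [AddCommGroup M] [Module k M]
    (T : (List α →₀ k) →ₗ[k] M) (p s : List α) (f : List α →₀ k) :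
    T (sandwich p s f) = f.sum fun u x => x • T (Finsupp.single (p ++ u ++ s) 1) := by
  simpa using linearMap_apply_eq_sum (T ∘ₗ sandwich p s) f

/-- A word none of whose length-two factors can be rewritten. -/
def Irred (Red : α → α → Prop) (w : List α) : Prop :=
  ∀ p a b s, w = p ++ [a, b] ++ s → ¬ Red a b

/-- The combinations `p (ab - S a b) s` for the rewriting rules `ab → S a b` and words `p, s`, with
`p a b s` subject to the condition `P`. -/
def ruleSet (Red : α → α → Prop) (S : α → α → (List α →₀ k)) (P : List α → Prop) :
    Set (List α →₀ k) :=
  {f | ∃ p a b s, Red a b ∧ P (p ++ [a, b] ++ s) ∧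
    f = sandwich p s (Finsupp.single [a, b] 1 - S a b)}

variable {Red : α → α → Prop} {S : α → α → (List α →₀ k)} {r : List α → List α → Prop}

/-- Every combination of words satisfying a condition `P` that is inherited by lower words reduces
to irreducible words satisfying `P`, by means of rules applied to words satisfying `P`. -/
lemma exists_reduction (wf : WellFounded r)
    (ctx : ∀ p s u v, r u v → r (p ++ u ++ s) (p ++ v ++ s))
    (hS : ∀ a b, Red a b → ∀ u ∈ (S a b).support, r u [a, b])
    (P : List α → Prop) (hP : ∀ u v, r u v → P v → P u)
    (f : List α →₀ k) (hf : ∀ u ∈ f.support, P u) :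
    ∃ g : List α →₀ k, (∀ u ∈ g.support, Irred Red u ∧ P u) ∧
      f - g ∈ Submodule.span k (ruleSet Red S P) := by
  classical
  -- the property is closed under linear combinations
  let M : Submodule k (List α →₀ k) :=
    Finsupp.supported k k {u | Irred Red u ∧ P u} ⊔ Submodule.span k (ruleSet Red S P)
  have key : ∀ w : List α, P w → Finsupp.single w (1 : k) ∈ M := by
    intro w
    induction w using wf.induction with
    | _ w ih =>
      intro hw
      by_cases h : Irred Red w
      · exact Submodule.mem_sup_left (Finsupp.single_mem_supported k _ ⟨h, hw⟩)
      · simp only [Irred, not_forall, not_not] at h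
        obtain ⟨p, a, b, s, rfl, hab⟩ := h
        have h1 : sandwich p s (Finsupp.single [a, b] (1 : k) - S a b) ∈ M :=
          Submodule.mem_sup_right (Submodule.subset_span ⟨p, a, b, s, hab, hw, rfl⟩)
        have h2 : sandwich p s (S a b) ∈ M := by
          rw [← Finsupp.sum_single (S a b), Finsupp.sum, map_sum]
          refine Submodule.sum_mem _ fun u hu => ?_
          have hlt := ctx p s _ _ (hS a b hab u hu)
          have := M.smul_mem (S a b u) (ih _ hlt (hP _ _ hlt hw))
          simpa using this
        have := M.add_mem h1 h2
        simpa [← map_add] using this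
  have hfM : f ∈ M := by
    rw [← Finsupp.sum_single f, Finsupp.sum]
    refine Submodule.sum_mem _ fun u hu => ?_
    simpa using M.smul_mem (f u) (key u (hf u hu))
  obtain ⟨g, hg, e, he, rfl⟩ := Submodule.mem_sup.1 hfM
  exact ⟨g, fun u hu => (Finsupp.mem_supported k g).1 hg hu, by simpa using he⟩

open Classical in
/-- The normal form of a word, obtained by rewriting one reducible factor and recursing. -/
noncomputable def normalForm (Red : α → α → Prop) (S : α → α → (List α →₀ k))
    {r : List α → List α → Prop} (wf : WellFounded r) : List α → (List α →₀ k) :=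
  wf.fix fun w ih =>
    if h : ∃ p a b s, w = p ++ [a, b] ++ s ∧ Red a b then
      (sandwich h.choose h.choose_spec.choose_spec.choose_spec.choose
        (S h.choose_spec.choose h.choose_spec.choose_spec.choose)).sum
          fun u c => c • if hu : r u w then ih u hu else 0
    else Finsupp.single w 1

lemma normalForm_of_irred (wf : WellFounded r) {w : List α} (hw : Irred Red w) :
    normalForm Red S wf w = Finsupp.single w 1 := by
  rw [normalForm, WellFounded.fix_eq, dif_neg]
  rintro ⟨p, a, b, s, rfl, h⟩
  exact hw p a b s rfl h

lemma exists_normalForm_eq (wf : WellFounded r)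
    (ctx : ∀ p s u v, r u v → r (p ++ u ++ s) (p ++ v ++ s))
    (hS : ∀ a b, Red a b → ∀ u ∈ (S a b).support, r u [a, b])
    {w : List α} (hw : ¬ Irred Red w) :
    ∃ p a b s, w = p ++ [a, b] ++ s ∧ Red a b ∧ normalForm Red S wf w =
      Finsupp.linearCombination k (normalForm Red S wf) (sandwich p s (S a b)) := by
  have h : ∃ p a b s, w = p ++ [a, b] ++ s ∧ Red a b := by
    simpa only [Irred, not_forall, not_not, exists_prop] using hw
  refine ⟨h.choose, h.choose_spec.choose, h.choose_spec.choose_spec.choose,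
    h.choose_spec.choose_spec.choose_spec.choose,
    h.choose_spec.choose_spec.choose_spec.choose_spec.1,
    h.choose_spec.choose_spec.choose_spec.choose_spec.2, ?_⟩
  conv_lhs => rw [normalForm, WellFounded.fix_eq, dif_pos h]
  rw [Finsupp.linearCombination_apply]
  refine Finset.sum_congr rfl fun u hu => ?_
  have hlt : r u w := by
    obtain ⟨v, hv, rfl⟩ := exists_of_mem_support_sandwich hu
    have := ctx h.choose h.choose_spec.choose_spec.choose_spec.choose _ _
      (hS _ _ h.choose_spec.choose_spec.choose_spec.choose_spec.2 v hv)
    rwa [← h.choose_spec.choose_spec.choose_spec.choose_spec.1] at this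
  simp only [dif_pos hlt]
  rfl

/-- Bergman's diamond lemma for rules `ab → S a b` rewriting words of length two: if every overlap
`abc` is resolvable relative to the order, then rewriting at any place computes the normal form. -/
lemma normalForm_eq (wf : WellFounded r)
    (ctx : ∀ p s u v, r u v → r (p ++ u ++ s) (p ++ v ++ s))
    (hS : ∀ a b, Red a b → ∀ u ∈ (S a b).support, r u [a, b])
    (overlap : ∀ a b c, Red a b → Red b c →
      sandwich [] [c] (S a b) - sandwich [a] [] (S b c) ∈
        Submodule.span k (ruleSet Red S fun u => r u [a, b, c])) :
    ∀ (w p : List α) (a b : α) (s : List α), w = p ++ [a, b] ++ s → Red a b →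
      normalForm Red S wf w =
        Finsupp.linearCombination k (normalForm Red S wf) (sandwich p s (S a b)) := by
  intro w
  induction w using wf.induction with
  | _ w ih =>
  set NF := Finsupp.linearCombination k (normalForm Red S wf) with hNF
  -- below `w` the normal form may be computed by rewriting at any place
  have ih' : ∀ p a b s, Red a b → r (p ++ [a, b] ++ s) w →
      NF (sandwich p s (Finsupp.single [a, b] 1)) = NF (sandwich p s (S a b)) := by
    intro p a b s hab hlt
    rw [sandwich_single, hNF, Finsupp.linearCombination_single, one_smul]
    exact ih _ hlt p a b s rfl hab
  have overlap' : ∀ p a b c s, w = p ++ [a, b, c] ++ s → Red a b → Red b c →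
      NF (sandwich p (c :: s) (S a b)) = NF (sandwich (p ++ [a]) s (S b c)) := by
    rintro p a b c s rfl hab hbc
    have h1 := overlap a b c hab hbc
    have h2 : Submodule.span k (ruleSet Red S fun u => r u [a, b, c]) ≤
        LinearMap.ker (NF ∘ₗ sandwich p s) := by
      refine Submodule.span_le.2 ?_
      rintro _ ⟨p', d, e, s', hde, hlt, rfl⟩
      have := ih' (p ++ p') d e (s' ++ s) hde (by simpa using ctx p s _ _ hlt)
      simp only [SetLike.mem_coe, LinearMap.mem_ker, LinearMap.comp_apply, sandwich_sandwich,
        map_sub, this, sub_self]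
    have h3 := h2 h1
    simpa [LinearMap.mem_ker, sandwich_sandwich, sub_eq_zero] using h3
  -- rewriting at two disjoint places
  have disj : ∀ p a b m c d s, w = p ++ [a, b] ++ m ++ [c, d] ++ s → Red a b → Red c d →
      NF (sandwich p (m ++ [c, d] ++ s) (S a b)) = NF (sandwich (p ++ [a, b] ++ m) s (S c d)) := by
    rintro p a b m c d s rfl hab hcd
    have h1 : NF (sandwich p (m ++ [c, d] ++ s) (S a b)) =
        (S a b).sum fun u x => x • (S c d).sum fun v y =>
          y • NF (Finsupp.single (p ++ u ++ m ++ v ++ s) 1) := by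
      rw [apply_sandwich_eq_sum]
      refine Finset.sum_congr rfl fun u hu => ?_
      have hlt := ctx p (m ++ [c, d] ++ s) _ _ (hS a b hab u hu)
      have h := ih' (p ++ u ++ m) c d s hcd (by simpa using hlt)
      rw [sandwich_single, apply_sandwich_eq_sum] at h
      simp only [List.append_assoc] at h ⊢
      rw [h]
    have h2 : NF (sandwich (p ++ [a, b] ++ m) s (S c d)) =
        (S c d).sum fun v y => y • (S a b).sum fun u x =>
          x • NF (Finsupp.single (p ++ u ++ m ++ v ++ s) 1) := by
      rw [apply_sandwich_eq_sum]
      refine Finset.sum_congr rfl fun v hv => ?_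
      have hlt := ctx (p ++ [a, b] ++ m) s _ _ (hS c d hcd v hv)
      have h := ih' p a b (m ++ v ++ s) hab (by simpa using hlt)
      rw [sandwich_single, apply_sandwich_eq_sum] at h
      simp only [List.append_assoc] at h ⊢
      rw [h]
    rw [h1, h2]
    simp only [Finsupp.sum, Finset.smul_sum]
    rw [Finset.sum_comm]
    refine Finset.sum_congr rfl fun v _ => Finset.sum_congr rfl fun u _ => ?_
    rw [smul_comm]
  -- hence rewriting at two arbitrary places
  have any : ∀ n p a b s p' a' b' s', w = p ++ [a, b] ++ s → w = p' ++ [a', b'] ++ s' →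
      Red a b → Red a' b' → p'.length = p.length + n →
      NF (sandwich p s (S a b)) = NF (sandwich p' s' (S a' b')) := by
    intro n p a b s p' a' b' s' hw hw' hab hab' hn
    have heq : p ++ ([a, b] ++ s) = p' ++ ([a', b'] ++ s') := by
      rw [← List.append_assoc, ← hw, hw', List.append_assoc]
    obtain ⟨m, rfl⟩ : ∃ m, p' = p ++ m := by
      obtain ⟨m, hm, -⟩ | ⟨m, hm, -⟩ := List.append_eq_append_iff.1 heq
      · exact ⟨m, hm⟩
      · have : m = [] := by
          rw [← List.length_eq_zero_iff]; have := congrArg List.length hm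
          simp at this; omega
        exact ⟨[], by simp [hm, this]⟩
    rw [List.append_assoc, List.append_cancel_left_eq] at heq
    match m, heq with
    | [], heq =>
      simp only [List.cons_append, List.nil_append, List.cons.injEq] at heq
      obtain ⟨rfl, rfl, rfl⟩ := heq
      simp
    | [e], heq =>
      simp only [List.cons_append, List.nil_append, List.cons.injEq] at heq
      obtain ⟨rfl, rfl, rfl⟩ := heq
      exact overlap' p _ _ _ s' (by simpa using hw) hab hab'
    | e :: e' :: m, heq =>
      simp only [List.cons_append, List.nil_append, List.cons.injEq] at heq
      obtain ⟨rfl, rfl, rfl⟩ := heq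
      have := disj p a b m a' b' s' (by simpa using hw) hab hab'
      simpa using this
  intro p a b s hw hab
  obtain ⟨p', a', b', s', hw', hab', h⟩ := exists_normalForm_eq (S := S) wf ctx hS
    (w := w) (fun h => h p a b s hw hab)
  rw [h]
  rcases le_total p.length p'.length with hl | hl
  · exact (any _ p a b s p' a' b' s' hw hw' hab hab' (Nat.add_sub_of_le hl).symm).symm
  · exact any _ p' a' b' s' p a b s hw' hw hab' hab (Nat.add_sub_of_le hl).symm

/-- A resolvable system of rules has a linear normal form map: it fixes irreducible words, kills
the two-sided ideal generated by the rules, and changes words only within that ideal. -/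
theorem exists_normalForm_map (wf : WellFounded r)
    (ctx : ∀ p s u v, r u v → r (p ++ u ++ s) (p ++ v ++ s))
    (hS : ∀ a b, Red a b → ∀ u ∈ (S a b).support, r u [a, b])
    (overlap : ∀ a b c, Red a b → Red b c →
      sandwich [] [c] (S a b) - sandwich [a] [] (S b c) ∈
        Submodule.span k (ruleSet Red S fun u => r u [a, b, c])) :
    ∃ NF : (List α →₀ k) →ₗ[k] (List α →₀ k),
      (∀ w, Irred Red w → NF (Finsupp.single w 1) = Finsupp.single w 1) ∧
      (∀ f ∈ Submodule.span k (ruleSet Red S fun _ => True), NF f = 0) ∧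
      ∀ f, f - NF f ∈ Submodule.span k (ruleSet Red S fun _ => True) := by
  have h1 : ∀ w, Irred Red w → Finsupp.linearCombination k (normalForm Red S wf)
      (Finsupp.single w 1) = Finsupp.single w 1 := by
    intro w hw
    rw [Finsupp.linearCombination_single, one_smul, normalForm_of_irred wf hw]
  have h2 : ∀ f ∈ Submodule.span k (ruleSet Red S fun _ => True),
      Finsupp.linearCombination k (normalForm Red S wf) f = 0 := by
    intro f hf
    rw [← LinearMap.mem_ker]
    refine (Submodule.span_le.2 ?_ :
      _ ≤ LinearMap.ker (Finsupp.linearCombination k (normalForm Red S wf))) hf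
    rintro _ ⟨p, a, b, s, hab, -, rfl⟩
    rw [SetLike.mem_coe, LinearMap.mem_ker, map_sub, map_sub, sandwich_single,
      Finsupp.linearCombination_single, one_smul, normalForm_eq wf ctx hS overlap _ p a b s rfl hab,
      sub_self]
  refine ⟨_, h1, h2, fun f => ?_⟩
  obtain ⟨g, hg, hfg⟩ := exists_reduction (k := k) wf ctx hS (fun _ => True)
    (fun _ _ _ _ => trivial) f (fun _ _ => trivial)
  have hNg : Finsupp.linearCombination k (normalForm Red S wf) g = g := by
    rw [linearMap_apply_eq_sum]
    conv_rhs => rw [← Finsupp.sum_single g]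
    refine Finset.sum_congr rfl fun u hu => ?_
    simp only [h1 u (hg u hu).1, Finsupp.smul_single, smul_eq_mul, mul_one]
  have h3 := h2 _ hfg
  rw [map_sub, hNg, sub_eq_zero] at h3
  rwa [h3]

end Diamond

/-! ### The order on words in the letters `2 i ↔ x i`, `2 i + 1 ↔ mu i` -/

/-- The sum of the squares of the letters. -/
def sqSum (w : List ℕ) : ℕ := (w.map (· ^ 2)).sum

/-- The sum of the letters, each multiplied by its position. -/
def posSum : List ℕ → ℕ
  | [] => 0
  | _ :: w => w.sum + posSum w

/-- The order along which words are rewritten: among words with the same length and sum, a word is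
lower when its letters are more spread out or, for equal spread, closer to being sorted. -/
def Lower (u v : List ℕ) : Prop :=
  u.length = v.length ∧ u.sum = v.sum ∧
    (sqSum v < sqSum u ∨ sqSum v = sqSum u ∧ posSum v < posSum u)

lemma sqSum_append (u v : List ℕ) : sqSum (u ++ v) = sqSum u + sqSum v := by
  simp [sqSum]

lemma posSum_append (u v : List ℕ) :
    posSum (u ++ v) = posSum u + u.length * v.sum + posSum v := by
  induction u with
  | nil => simp [posSum]
  | cons a u ih =>
    simp only [List.cons_append, posSum, ih, List.sum_append, List.length_cons]
    ring

lemma sqSum_le (w : List ℕ) : sqSum w ≤ w.sum ^ 2 := by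
  induction w with
  | nil => simp [sqSum]
  | cons a w ih =>
    simp only [sqSum, List.map_cons, List.sum_cons] at ih ⊢
    nlinarith [Nat.zero_le (a * w.sum)]

lemma posSum_le (w : List ℕ) : posSum w ≤ w.length * w.sum := by
  induction w with
  | nil => simp [posSum]
  | cons a w ih =>
    simp only [posSum, List.sum_cons, List.length_cons]
    nlinarith [Nat.zero_le (w.length * a)]

lemma Lower.append {u v : List ℕ} (h : Lower u v) (p s : List ℕ) :
    Lower (p ++ u ++ s) (p ++ v ++ s) := by
  obtain ⟨hl, hs, h⟩ := h
  refine ⟨by simp [hl], by simp [hs], ?_⟩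
  simp only [sqSum_append, posSum_append, List.length_append, hl, hs]
  omega

lemma Lower.trans {u v w : List ℕ} (h : Lower u v) (h' : Lower v w) : Lower u w := by
  obtain ⟨hl, hs, h⟩ := h
  obtain ⟨hl', hs', h'⟩ := h'
  exact ⟨hl.trans hl', hs.trans hs', by omega⟩

lemma lower_wf : WellFounded Lower := by
  let m : List ℕ → ℕ ×ₗ ℕ := fun w =>
    toLex (w.sum ^ 2 - sqSum w, w.length * w.sum - posSum w)
  refine Subrelation.wf (r := InvImage (· < ·) m) ?_ (InvImage.wf m wellFounded_lt)
  rintro u v ⟨hl, hs, h⟩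
  simp only [InvImage, m, Prod.Lex.toLex_lt_toLex]
  have h1 := sqSum_le u
  have h2 := sqSum_le v
  have h3 := posSum_le u
  have h4 := posSum_le v
  rw [hl, hs] at h3
  rw [hs] at h1
  rw [hl, hs]
  omega

lemma lower_pair {a b c d : ℕ} (hsum : c + d = a + b) (hab : a ≤ b) (h : c < a ∨ d < a) :
    Lower [c, d] [a, b] := by
  refine ⟨rfl, by simpa using hsum, Or.inl ?_⟩
  simp only [sqSum, List.map_cons, List.map_nil, List.sum_cons, List.sum_nil, add_zero]
  obtain h | h := h
  · obtain ⟨e, rfl⟩ := Nat.exists_eq_add_of_lt h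
    obtain rfl : d = e + 1 + b := by omega
    nlinarith
  · obtain ⟨e, rfl⟩ := Nat.exists_eq_add_of_lt h
    obtain rfl : c = e + 1 + b := by omega
    nlinarith

/-! ### The quadratic relations -/

/-- Linear combinations of words. -/
abbrev Words : Type := List ℕ →₀ ℚ

/-- The sign by which the letters `a` and `b` commute. -/
def sgn (a b : ℕ) : ℚ := if a % 2 = 1 ∧ b % 2 = 1 then -1 else 1

/-- The combination of the words of length two in letters of the parities `ε₁`, `ε₂` with indices
of sum `m`, with coefficients `w`. -/
noncomputable def quad (w : ℕ × ℕ → ℚ) (ε₁ ε₂ m : ℕ) : Words :=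
  ∑ p ∈ Finset.HasAntidiagonal.antidiagonal m, w p • Finsupp.single [2 * p.1 + ε₁, 2 * p.2 + ε₂] 1

/-- The coefficients of the words `x i`, `mu j` in the relation `x'' μ - x' μ'`, with
`p = (i, j)`. -/
def derivCoeff (p : ℕ × ℕ) : ℚ := (p.1 : ℚ) * (p.1 - 1) - p.1 * p.2

/-- The quadratic relations of the infinite algebra. -/
inductive IsQuadRel : Words → Prop
  | comm (a b : ℕ) :
      IsQuadRel (Finsupp.single [a, b] 1 - sgn a b • Finsupp.single [b, a] 1)
  | sq (m : ℕ) : IsQuadRel (quad 1 0 0 m)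
  | prod (m : ℕ) : IsQuadRel (quad 1 0 1 m)
  | deriv (m : ℕ) : IsQuadRel (quad derivCoeff 0 1 m)
  | odd (m : ℕ) : IsQuadRel (quad (fun p => (p.2 : ℚ)) 1 1 m)

/-- The span of the quadratic relations. -/
noncomputable def quadSpan : Submodule ℚ Words := Submodule.span ℚ {f | IsQuadRel f}

/-- The pairs of letters allowed to be adjacent in a normal word. -/
def Good (a b : ℕ) : Prop := a + 4 + a % 2 + b % 2 ≤ b ∨ a = 0 ∧ b = 3

/-- The combinations of words lower than `[a, b]`, up to the quadratic relations. -/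
noncomputable def lowerMod (a b : ℕ) : Submodule ℚ Words :=
  Finsupp.supported ℚ ℚ {u | Lower u [a, b]} ⊔ quadSpan

lemma single_mem_lowerMod {a b : ℕ} {u : List ℕ} (h : Lower u [a, b]) :
    Finsupp.single u (1 : ℚ) ∈ lowerMod a b :=
  Submodule.mem_sup_left (Finsupp.single_mem_supported ℚ _ h)

lemma quadRel_mem_lowerMod {a b : ℕ} {f : Words} (h : IsQuadRel f) : f ∈ lowerMod a b :=
  Submodule.mem_sup_right (Submodule.subset_span h)

lemma swap_mem_lowerMod {a b c d : ℕ}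
    (h : Finsupp.single [d, c] (1 : ℚ) ∈ lowerMod a b) :
    Finsupp.single [c, d] (1 : ℚ) ∈ lowerMod a b := by
  have h1 : Finsupp.single [c, d] (1 : ℚ) - sgn c d • Finsupp.single [d, c] 1 ∈ lowerMod a b :=
    quadRel_mem_lowerMod (IsQuadRel.comm c d)
  simpa using (lowerMod a b).add_mem h1 ((lowerMod a b).smul_mem (sgn c d) h)

lemma odd_sq_mem_lowerMod {a b : ℕ} (c : ℕ) (hc : c % 2 = 1) :
    Finsupp.single [c, c] (1 : ℚ) ∈ lowerMod a b := by
  have h1 : Finsupp.single [c, c] (1 : ℚ) - sgn c c • Finsupp.single [c, c] 1 ∈ lowerMod a b :=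
    quadRel_mem_lowerMod (IsQuadRel.comm c c)
  have h2 : Finsupp.single [c, c] (1 : ℚ) =
      (2⁻¹ : ℚ) • (Finsupp.single [c, c] (1 : ℚ) - sgn c c • Finsupp.single [c, c] 1) := by
    simp only [sgn, hc, and_self, if_true]
    module
  rw [h2]
  exact (lowerMod a b).smul_mem _ h1

lemma sum_mem_lowerMod {a b m ε₁ ε₂ : ℕ} {w : ℕ × ℕ → ℚ} (hw : quad w ε₁ ε₂ m ∈ lowerMod a b)
    (T : Finset (ℕ × ℕ)) (hT : T ⊆ Finset.HasAntidiagonal.antidiagonal m)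
    (h : ∀ p ∈ Finset.HasAntidiagonal.antidiagonal m, p ∉ T →
      w p = 0 ∨ Finsupp.single [2 * p.1 + ε₁, 2 * p.2 + ε₂] (1 : ℚ) ∈ lowerMod a b) :
    ∑ p ∈ T, w p • Finsupp.single [2 * p.1 + ε₁, 2 * p.2 + ε₂] (1 : ℚ) ∈ lowerMod a b := by
  have h1 : ∑ p ∈ Finset.HasAntidiagonal.antidiagonal m \ T,
      w p • Finsupp.single [2 * p.1 + ε₁, 2 * p.2 + ε₂] (1 : ℚ) ∈ lowerMod a b := by
    refine Submodule.sum_mem _ fun p hp => ?_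
    obtain ⟨hp, hpT⟩ := Finset.mem_sdiff.1 hp
    obtain h | h := h p hp hpT
    · simp [h]
    · exact Submodule.smul_mem _ _ h
  have h2 := (lowerMod a b).sub_mem hw h1
  rwa [quad, ← Finset.sum_sdiff hT, add_sub_cancel_left] at h2

/-- The single term `p₀` of a quadratic relation is lower when all other terms are. -/
lemma term_mem_lowerMod {a b m ε₁ ε₂ : ℕ} {w : ℕ × ℕ → ℚ} (hw : quad w ε₁ ε₂ m ∈ lowerMod a b)
    (p₀ : ℕ × ℕ) (hp₀ : p₀.1 + p₀.2 = m) (hne : w p₀ ≠ 0)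
    (h : ∀ p : ℕ × ℕ, p.1 + p.2 = m → p ≠ p₀ →
      w p = 0 ∨ Finsupp.single [2 * p.1 + ε₁, 2 * p.2 + ε₂] (1 : ℚ) ∈ lowerMod a b) :
    Finsupp.single [2 * p₀.1 + ε₁, 2 * p₀.2 + ε₂] (1 : ℚ) ∈ lowerMod a b := by
  have h1 := sum_mem_lowerMod hw {p₀} (by simpa using hp₀)
    fun p hp hpT => h p (by simpa using hp) (by simpa using hpT)
  rw [Finset.sum_singleton] at h1
  simpa [hne, smul_smul] using (lowerMod a b).smul_mem (w p₀)⁻¹ h1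

/-- Every pair of letters not allowed in a normal word is the leading term of a relation: in the
relation of its degree all other terms are lower, after commuting the letters or, where two terms
compete, after combining two relations. -/
lemma single_mem_lowerMod_of_not_good {a b : ℕ} (hab : ¬ Good a b) :
    Finsupp.single [a, b] (1 : ℚ) ∈ lowerMod a b := by
  simp only [Good, not_or, not_and, not_le] at hab
  obtain ⟨hab, h03⟩ := hab
  rcases lt_or_ge b a with hlt | hle
  · refine swap_mem_lowerMod (single_mem_lowerMod ⟨rfl, by simp [add_comm], Or.inr ⟨?_, ?_⟩⟩)
    · simp [sqSum, add_comm]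
    · simpa [posSum] using hlt
  have lead : ∀ c d, c + d = a + b → c < a ∨ d < a →
      Finsupp.single [c, d] (1 : ℚ) ∈ lowerMod a b :=
    fun c d h h' => single_mem_lowerMod (lower_pair h hle h')
  obtain ⟨i, rfl | rfl⟩ : ∃ i, a = 2 * i + 0 ∨ a = 2 * i + 1 := ⟨a / 2, by omega⟩ <;>
  obtain ⟨j, rfl | rfl⟩ : ∃ j, b = 2 * j + 0 ∨ b = 2 * j + 1 := ⟨b / 2, by omega⟩
  · obtain rfl | rfl : j = i ∨ j = i + 1 := by omega
    · refine term_mem_lowerMod (w := 1) (quadRel_mem_lowerMod (IsQuadRel.sq _)) (j, j) rfl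
        one_ne_zero fun p hp hne => Or.inr (lead _ _ ?_ ?_)
      · dsimp only at hp; omega
      · simp only [ne_eq, Prod.ext_iff] at hne; dsimp only at hp hne; omega
    · have h1 := sum_mem_lowerMod (a := 2 * i + 0) (b := 2 * (i + 1) + 0)
        (quadRel_mem_lowerMod (IsQuadRel.sq (2 * i + 1))) {(i, i + 1), (i + 1, i)}
        (by intro p
            simp only [Finset.mem_insert, Finset.mem_singleton,
              Finset.HasAntidiagonal.mem_antidiagonal]
            rintro (rfl | rfl) <;> dsimp only <;> omega)
        (fun p hp hne => Or.inr (lead _ _ ?_ ?_))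
      rotate_left
      · rw [Finset.HasAntidiagonal.mem_antidiagonal] at hp; omega
      · simp only [Finset.mem_insert, Finset.mem_singleton, Prod.ext_iff,
          Finset.HasAntidiagonal.mem_antidiagonal] at hp hne
        omega
      rw [Finset.sum_pair (by simp)] at h1
      have h2 := quadRel_mem_lowerMod (a := 2 * i + 0) (b := 2 * (i + 1) + 0)
        (IsQuadRel.comm (2 * i + 0) (2 * (i + 1) + 0))
      have h3 := (lowerMod _ _).smul_mem (2⁻¹ : ℚ) ((lowerMod _ _).add_mem h1 h2)
      convert h3 using 1
      simp only [sgn, Pi.one_apply]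
      rw [if_neg (by omega)]
      module
  · obtain rfl | rfl : j = i ∨ j = i + 1 := by omega
    · refine term_mem_lowerMod (w := 1) (quadRel_mem_lowerMod (IsQuadRel.prod _)) (j, j) rfl
        one_ne_zero fun p hp hne => Or.inr (lead _ _ ?_ ?_)
      · dsimp only at hp; omega
      · simp only [ne_eq, Prod.ext_iff] at hne; dsimp only at hp hne; omega
    · have hi : i ≠ 0 := by rintro rfl; simp at h03
      refine term_mem_lowerMod (w := derivCoeff) (quadRel_mem_lowerMod (IsQuadRel.deriv _))
        (i, i + 1) rfl ?_ fun p hp hne => ?_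
      · have : (i : ℚ) ≠ 0 := by exact_mod_cast hi
        simp only [derivCoeff]
        push_cast
        intro h
        apply this
        linarith
      · by_cases hp' : p = (i + 1, i)
        · left
          subst hp'
          simp only [derivCoeff]
          push_cast
          ring
        · refine Or.inr (lead _ _ ?_ ?_)
          · dsimp only at hp; omega
          · simp only [ne_eq, Prod.ext_iff] at hne hp'; dsimp only at hp hne hp'; omega
  · apply swap_mem_lowerMod
    obtain rfl | rfl : j = i + 1 ∨ j = i + 2 := by omega
    · refine term_mem_lowerMod (w := 1) (quadRel_mem_lowerMod (IsQuadRel.prod _)) (i + 1, i) rfl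
        one_ne_zero fun p hp hne => Or.inr (lead _ _ ?_ ?_)
      · dsimp only at hp; omega
      · simp only [ne_eq, Prod.ext_iff] at hne; dsimp only at hp hne; omega
    · -- a combination of the two relations without the term closest to the diagonal
      have hw : quad (derivCoeff + ((i : ℚ) + 1) • 1) 0 1 (i + 2 + i) ∈
          lowerMod (2 * i + 1) (2 * (i + 2) + 0) := by
        have := (lowerMod (2 * i + 1) (2 * (i + 2) + 0)).add_mem
          (quadRel_mem_lowerMod (IsQuadRel.deriv (i + 2 + i)))
          ((lowerMod (2 * i + 1) (2 * (i + 2) + 0)).smul_mem ((i : ℚ) + 1)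
            (quadRel_mem_lowerMod (IsQuadRel.prod (i + 2 + i))))
        convert this using 1
        simp only [quad, Finset.smul_sum, ← Finset.sum_add_distrib, Pi.add_apply, Pi.smul_apply,
          add_smul, smul_assoc]
      refine term_mem_lowerMod hw (i + 2, i) rfl ?_ fun p hp hne => ?_
      · simp only [derivCoeff, Pi.add_apply, Pi.smul_apply, Pi.one_apply, smul_eq_mul]
        push_cast
        have : (0 : ℚ) ≤ i := Nat.cast_nonneg i
        nlinarith
      · by_cases hp' : p = (i + 1, i + 1)
        · left
          subst hp'
          simp only [derivCoeff, Pi.add_apply, Pi.smul_apply, Pi.one_apply, smul_eq_mul]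
          push_cast
          ring
        · refine Or.inr (lead _ _ ?_ ?_)
          · omega
          · simp only [ne_eq, Prod.ext_iff] at hne hp'; omega
  · obtain rfl | ⟨e, rfl, he⟩ : j = i ∨ ∃ e, j = i + e ∧ (e = 1 ∨ e = 2) := by
      rcases Nat.lt_or_ge i j with h | h
      · exact Or.inr ⟨j - i, by omega, by omega⟩
      · left; omega
    · exact odd_sq_mem_lowerMod _ (by omega)
    · have h1 := sum_mem_lowerMod (a := 2 * i + 1) (b := 2 * (i + e) + 1)
        (quadRel_mem_lowerMod (IsQuadRel.odd (2 * i + e))) {(i, i + e), (i + e, i)}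
        (by intro p
            simp only [Finset.mem_insert, Finset.mem_singleton,
              Finset.HasAntidiagonal.mem_antidiagonal]
            rintro (rfl | rfl) <;> dsimp only <;> omega)
        (fun p hp hne => Or.inr ?_)
      rotate_left
      · by_cases hp' : p.1 = p.2
        · rw [hp']
          exact odd_sq_mem_lowerMod _ (by omega)
        · simp only [Finset.mem_insert, Finset.mem_singleton, Prod.ext_iff,
            Finset.HasAntidiagonal.mem_antidiagonal] at hp hne
          refine lead _ _ ?_ ?_ <;> omega
      rw [Finset.sum_pair (by simp only [ne_eq, Prod.ext_iff]; omega)] at h1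
      have h2 := quadRel_mem_lowerMod (a := 2 * i + 1) (b := 2 * (i + e) + 1)
        (IsQuadRel.comm (2 * i + 1) (2 * (i + e) + 1))
      have h3 := (lowerMod _ _).smul_mem ((e : ℚ)⁻¹)
        ((lowerMod _ _).sub_mem h1 ((lowerMod _ _).smul_mem (i : ℚ) h2))
      convert h3 using 1
      simp only [sgn]
      rw [if_pos (by omega)]
      have he0 : (e : ℚ) ≠ 0 := by
        have : e ≠ 0 := by omega
        exact_mod_cast this
      rw [← smul_right_injective Words he0 |>.eq_iff]
      simp only [smul_smul, mul_inv_cancel₀ he0, one_smul]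
      push_cast
      module

/-- A rewriting system for the quadratic relations whose irreducible words are the normal words. -/
lemma exists_rules : ∃ S : ℕ → ℕ → Words, ∀ a b, ¬ Good a b →
    (∀ u ∈ (S a b).support, Lower u [a, b]) ∧ Finsupp.single [a, b] (1 : ℚ) - S a b ∈ quadSpan := by
  have : ∀ a b, ∃ f : Words, ¬ Good a b →
      (∀ u ∈ f.support, Lower u [a, b]) ∧ Finsupp.single [a, b] (1 : ℚ) - f ∈ quadSpan := by
    intro a b
    by_cases hab : Good a b
    · exact ⟨0, fun h => absurd hab h⟩
    · obtain ⟨f, hf, g, hg, h⟩ := Submodule.mem_sup.1 (single_mem_lowerMod_of_not_good hab)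
      exact ⟨f, fun _ => ⟨fun u hu => (Finsupp.mem_supported ℚ f).1 hf hu, by simpa [← h] using hg⟩⟩
  choose S hS using this
  exact ⟨S, hS⟩

/-! ### Cubic functionals -/

/-- The linear functionals on words of length three, given by their values, that are
supersymmetric and vanish on all products of a quadratic relation and a letter. -/
structure IsCubicDual (φ : ℕ → ℕ → ℕ → ℚ) : Prop where
  swap₁ (a b c : ℕ) : φ b a c = sgn a b * φ a b c
  swap₂ (a b c : ℕ) : φ a c b = sgn b c * φ a b c
  sq (m c : ℕ) : ∑ p ∈ Finset.HasAntidiagonal.antidiagonal m, φ (2 * p.1) (2 * p.2) c = 0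
  prod (m c : ℕ) :
    ∑ p ∈ Finset.HasAntidiagonal.antidiagonal m, φ (2 * p.1) (2 * p.2 + 1) c = 0
  deriv (m c : ℕ) : ∑ p ∈ Finset.HasAntidiagonal.antidiagonal m,
    derivCoeff p * φ (2 * p.1) (2 * p.2 + 1) c = 0
  odd (m c : ℕ) : ∑ p ∈ Finset.HasAntidiagonal.antidiagonal m,
    (p.2 : ℚ) * φ (2 * p.1 + 1) (2 * p.2 + 1) c = 0

/-- The space of cubic functionals. -/
def cubicDual : Submodule ℚ (ℕ → ℕ → ℕ → ℚ) where
  carrier := {φ | IsCubicDual φ}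
  add_mem' := by
    rintro φ ψ ⟨h1, h2, h3, h4, h5, h6⟩ ⟨g1, g2, g3, g4, g5, g6⟩
    refine ⟨fun a b c => ?_, fun a b c => ?_, fun m c => ?_, fun m c => ?_, fun m c => ?_,
      fun m c => ?_⟩
    · simp only [Pi.add_apply, h1 a b c, g1 a b c, mul_add]
    · simp only [Pi.add_apply, h2 a b c, g2 a b c, mul_add]
    · simp only [Pi.add_apply, Finset.sum_add_distrib, h3, g3, add_zero]
    · simp only [Pi.add_apply, Finset.sum_add_distrib, h4, g4, add_zero]
    · simp only [Pi.add_apply, mul_add, Finset.sum_add_distrib, h5, g5, add_zero]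
    · simp only [Pi.add_apply, mul_add, Finset.sum_add_distrib, h6, g6, add_zero]
  zero_mem' := by constructor <;> simp
  smul_mem' := by
    rintro k φ ⟨h1, h2, h3, h4, h5, h6⟩
    refine ⟨fun a b c => ?_, fun a b c => ?_, fun m c => ?_, fun m c => ?_, fun m c => ?_,
      fun m c => ?_⟩
    · simp only [Pi.smul_apply, smul_eq_mul, h1 a b c]; ring
    · simp only [Pi.smul_apply, smul_eq_mul, h2 a b c]; ring
    · simp only [Pi.smul_apply, smul_eq_mul, ← Finset.mul_sum, h3, mul_zero]
    · simp only [Pi.smul_apply, smul_eq_mul, ← Finset.mul_sum, h4, mul_zero]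
    · simp only [Pi.smul_apply, smul_eq_mul, mul_left_comm _ k, ← Finset.mul_sum, h5, mul_zero]
    · simp only [Pi.smul_apply, smul_eq_mul, mul_left_comm _ k, ← Finset.mul_sum, h6, mul_zero]

/-- The value of a cubic functional on a word. -/
def cubicVal (φ : ℕ → ℕ → ℕ → ℚ) : List ℕ → ℚ
  | [a, b, c] => φ a b c
  | _ => 0

/-- The linear extension of a cubic functional. -/
noncomputable def cubicEval (φ : ℕ → ℕ → ℕ → ℚ) : Words →ₗ[ℚ] ℚ :=
  Finsupp.linearCombination ℚ (cubicVal φ)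

lemma cubicEval_single (φ : ℕ → ℕ → ℕ → ℚ) (u : List ℕ) :
    cubicEval φ (Finsupp.single u 1) = cubicVal φ u := by
  simp [cubicEval]

lemma sandwich_quad (p s : List ℕ) (w : ℕ × ℕ → ℚ) (ε₁ ε₂ m : ℕ) :
    sandwich p s (quad w ε₁ ε₂ m) = ∑ x ∈ Finset.HasAntidiagonal.antidiagonal m,
      w x • Finsupp.single (p ++ [2 * x.1 + ε₁, 2 * x.2 + ε₂] ++ s) 1 := by
  simp only [quad, map_sum, map_smul, sandwich_single]

lemma cubicEval_sandwich_right {φ : ℕ → ℕ → ℕ → ℚ} (hφ : IsCubicDual φ) {f : Words}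
    (hf : IsQuadRel f) (c : ℕ) : cubicEval φ (sandwich [] [c] f) = 0 := by
  obtain ⟨h1, h2, h3, h4, h5, h6⟩ := hφ
  cases hf with
  | comm a b =>
    have hs : sgn a b * sgn a b = 1 := by unfold sgn; split_ifs <;> norm_num
    simp only [map_sub, map_smul, sandwich_single, cubicEval_single, List.nil_append,
      List.cons_append, cubicVal, h1 a b c, smul_eq_mul, ← mul_assoc, hs, one_mul, sub_self]
  | sq m => simpa [sandwich_quad, cubicEval_single, cubicVal] using h3 m c
  | prod m => simpa [sandwich_quad, cubicEval_single, cubicVal] using h4 m c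
  | deriv m =>
    simpa only [sandwich_quad, map_sum, map_smul, cubicEval_single, List.nil_append,
      List.cons_append, cubicVal, add_zero, smul_eq_mul] using h5 m c
  | odd m =>
    simpa only [sandwich_quad, map_sum, map_smul, cubicEval_single, List.nil_append,
      List.cons_append, cubicVal, add_zero, smul_eq_mul] using h6 m c

lemma sgn_congr {a a' b b' : ℕ} (ha : a % 2 = a' % 2) (hb : b % 2 = b' % 2) :
    sgn a b = sgn a' b' := by
  simp only [sgn, ha, hb]

lemma cubicEval_sandwich_left {φ : ℕ → ℕ → ℕ → ℚ} (hφ : IsCubicDual φ) {f : Words}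
    (hf : IsQuadRel f) (c : ℕ) : cubicEval φ (sandwich [c] [] f) = 0 := by
  have hcyc : ∀ a b, φ c a b = sgn a c * sgn b c * φ a b c := by
    intro a b
    rw [hφ.swap₁ a c b, hφ.swap₂ a b c, mul_assoc]
  have hquad : ∀ w ε₁ ε₂ m, cubicEval φ (sandwich [c] [] (quad w ε₁ ε₂ m)) =
      sgn ε₁ c * sgn ε₂ c * cubicEval φ (sandwich [] [c] (quad w ε₁ ε₂ m)) := by
    intro w ε₁ ε₂ m
    simp only [sandwich_quad, map_sum, map_smul, cubicEval_single, Finset.mul_sum]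
    refine Finset.sum_congr rfl fun p _ => ?_
    simp only [List.cons_append, List.nil_append, cubicVal, hcyc, smul_eq_mul]
    rw [sgn_congr (a := 2 * p.1 + ε₁) (a' := ε₁) (by omega) rfl,
      sgn_congr (a := 2 * p.2 + ε₂) (a' := ε₂) (by omega) rfl]
    ring
  cases hf with
  | comm a b =>
    have hs : sgn a b * sgn a b = 1 := by unfold sgn; split_ifs <;> norm_num
    simp only [map_sub, map_smul, sandwich_single, cubicEval_single, List.nil_append,
      List.cons_append, cubicVal, hφ.swap₂ c a b, smul_eq_mul, ← mul_assoc, hs, one_mul,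
      sub_self]
  | sq m => rw [hquad, cubicEval_sandwich_right hφ (.sq m), mul_zero]
  | prod m => rw [hquad, cubicEval_sandwich_right hφ (.prod m), mul_zero]
  | deriv m => rw [hquad, cubicEval_sandwich_right hφ (.deriv m), mul_zero]
  | odd m => rw [hquad, cubicEval_sandwich_right hφ (.odd m), mul_zero]

lemma length_add_length_eq_one {α : Type*} {p s : List α} (h : p.length + s.length = 1) :
    (p = [] ∧ ∃ c, s = [c]) ∨ (s = [] ∧ ∃ c, p = [c]) := by
  simp only [← List.length_eq_zero_iff, ← List.length_eq_one_iff]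
  omega

/-- A cubic functional kills the products of length three of a letter and a quadratic relation. -/
lemma cubicEval_sandwich {φ : ℕ → ℕ → ℕ → ℚ} (hφ : φ ∈ cubicDual) {f : Words}
    (hf : f ∈ quadSpan) {p s : List ℕ} (hps : p.length + s.length = 1) :
    cubicEval φ (sandwich p s f) = 0 := by
  have : quadSpan ≤ LinearMap.ker (cubicEval φ ∘ₗ sandwich p s) := by
    refine Submodule.span_le.2 fun f hf => ?_
    rw [SetLike.mem_coe, LinearMap.mem_ker, LinearMap.comp_apply]
    obtain ⟨rfl, c, rfl⟩ | ⟨rfl, c, rfl⟩ := length_add_length_eq_one hps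
    · exact cubicEval_sandwich_right hφ hf c
    · exact cubicEval_sandwich_left hφ hf c
  exact this hf

lemma cubicEval_eq_zero_of_mem_span {φ : ℕ → ℕ → ℕ → ℚ} (hφ : φ ∈ cubicDual)
    {S : ℕ → ℕ → Words}
    (hS : ∀ a b, ¬ Good a b → Finsupp.single [a, b] (1 : ℚ) - S a b ∈ quadSpan)
    {P : List ℕ → Prop} (hP : ∀ u, P u → u.length = 3) {f : Words}
    (hf : f ∈ Submodule.span ℚ (ruleSet (fun a b => ¬ Good a b) S P)) :
    cubicEval φ f = 0 := by
  have : Submodule.span ℚ (ruleSet (fun a b => ¬ Good a b) S P) ≤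
      LinearMap.ker (cubicEval φ) := by
    refine Submodule.span_le.2 ?_
    rintro _ ⟨p, a, b, s, hab, h, rfl⟩
    have := hP _ h
    simp only [List.length_append, List.length_cons, List.length_nil] at this
    exact cubicEval_sandwich hφ (hS a b hab) (by omega)
  exact this hf

lemma irred_triple {a b c : ℕ} :
    Irred (fun a b => ¬ Good a b) [a, b, c] ↔ Good a b ∧ Good b c := by
  constructor
  · intro h
    exact ⟨not_not.1 (h [] a b [c] rfl), not_not.1 (h [a] b c [] rfl)⟩
  · rintro ⟨h1, h2⟩ p d e s hw
    have hl := congrArg List.length hw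
    simp only [List.length_append, List.length_cons, List.length_nil] at hl
    obtain ⟨rfl, f, rfl⟩ | ⟨rfl, f, rfl⟩ := length_add_length_eq_one (p := p) (s := s) (by omega)
    · simp only [List.nil_append, List.cons_append, List.cons.injEq] at hw
      obtain ⟨rfl, rfl, -⟩ := hw
      exact not_not.2 h1
    · simp only [List.append_nil, List.cons_append, List.nil_append, List.cons.injEq] at hw
      obtain ⟨-, rfl, rfl, -⟩ := hw
      exact not_not.2 h2

/-- Cubic functionals are determined by their values on normal words. -/
lemma cubicDual_ext {φ : ℕ → ℕ → ℕ → ℚ} (hφ : φ ∈ cubicDual)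
    (h : ∀ a b c, Good a b → Good b c → φ a b c = 0) : φ = 0 := by
  obtain ⟨S, hS⟩ := exists_rules
  funext a b c
  obtain ⟨g, hg, hfg⟩ := exists_reduction lower_wf (fun p s u v h => h.append p s)
    (fun a b hab => (hS a b hab).1) (fun u => u.length = 3) (fun u v huv hv => huv.1.trans hv)
    (Finsupp.single [a, b, c] 1)
    (fun u hu => by
      rw [Finset.mem_singleton.1 (Finsupp.support_single_subset hu)]
      rfl)
  have h1 := cubicEval_eq_zero_of_mem_span hφ (fun a b hab => (hS a b hab).2) (fun _ h => h) hfg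
  have h2 : cubicEval φ g = 0 := by
    rw [cubicEval, Finsupp.linearCombination_apply]
    refine Finset.sum_eq_zero fun u hu => ?_
    obtain ⟨hu1, hu2⟩ := hg u hu
    match u, hu2 with
    | [d, e, f], _ =>
      obtain ⟨h1, h2⟩ := irred_triple.1 hu1
      simp only [cubicVal, h d e f h1 h2, smul_zero]
  rw [map_sub, h2, sub_zero, cubicEval_single] at h1
  exact h1

/-! ### Cubic functionals from polynomials in three variables -/

/-- Polynomials in three variables. -/
abbrev Poly3 : Type := MvPolynomial (Fin 3) ℚ

open MvPolynomial in
/-- The monomial with the given exponents. -/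
noncomputable def mon (i j k : ℕ) : Poly3 := X 0 ^ i * X 1 ^ j * X 2 ^ k

/-- The exponent vector with the given entries. -/
noncomputable def expo (i j k : ℕ) : Fin 3 →₀ ℕ :=
  Finsupp.single 0 i + Finsupp.single 1 j + Finsupp.single 2 k

@[simp] lemma expo_zero (i j k : ℕ) : expo i j k 0 = i := by
  simp [expo]

@[simp] lemma expo_one (i j k : ℕ) : expo i j k 1 = j := by
  simp [expo]

@[simp] lemma expo_two (i j k : ℕ) : expo i j k 2 = k := by
  simp [expo]

lemma eq_expo_iff (e : Fin 3 →₀ ℕ) (i j k : ℕ) : e = expo i j k ↔ e 0 = i ∧ e 1 = j ∧ e 2 = k := by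
  constructor
  · rintro rfl; simp
  · rintro ⟨rfl, rfl, rfl⟩
    ext x
    fin_cases x <;> simp

lemma expo_eq (e : Fin 3 →₀ ℕ) : e = expo (e 0) (e 1) (e 2) :=
  (eq_expo_iff _ _ _ _).2 ⟨rfl, rfl, rfl⟩

lemma monomial_expo (i j k : ℕ) (r : ℚ) :
    MvPolynomial.monomial (expo i j k) r = MvPolynomial.C r * mon i j k := by
  rw [mon, MvPolynomial.X_pow_eq_monomial, MvPolynomial.X_pow_eq_monomial,
    MvPolynomial.X_pow_eq_monomial, MvPolynomial.monomial_mul, MvPolynomial.monomial_mul,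
    MvPolynomial.C_mul_monomial, expo]
  simp

/-- The coefficient of a monomial. -/
noncomputable def cf (f : Poly3) (i j k : ℕ) : ℚ := MvPolynomial.coeff (expo i j k) f

lemma cf_add (f g : Poly3) (i j k : ℕ) : cf (f + g) i j k = cf f i j k + cf g i j k := by
  simp [cf]

lemma cf_C_mul (r : ℚ) (f : Poly3) (i j k : ℕ) :
    cf (MvPolynomial.C r * f) i j k = r * cf f i j k := by
  simp [cf]

lemma cf_mon (i j k i' j' k' : ℕ) :
    cf (mon i j k) i' j' k' = if i = i' ∧ j = j' ∧ k = k' then 1 else 0 := by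
  have := monomial_expo i j k 1
  rw [MvPolynomial.C_1, one_mul] at this
  rw [cf, ← this, MvPolynomial.coeff_monomial]
  simp only [eq_expo_iff, expo_zero, expo_one, expo_two]

lemma cf_ext {f g : Poly3} (h : ∀ i j k, cf f i j k = cf g i j k) : f = g := by
  ext e
  rw [expo_eq e]
  exact h _ _ _

lemma poly3_induction {P : Poly3 → Prop} (f : Poly3)
    (add : ∀ f g, P f → P g → P (f + g))
    (mon : ∀ r i j k, P (MvPolynomial.C r * mon i j k)) : P f := by
  induction f using MvPolynomial.monomial_add_induction_on with
  | C a => simpa [StableKh.mon] using mon a 0 0 0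
  | monomial_add e r f _ _ ih =>
    refine add _ _ ?_ ih
    rw [expo_eq e, monomial_expo]
    exact mon _ _ _ _

open MvPolynomial in
/-- The substitution of the variable `a` for the variable `b`. -/
noncomputable def merge (a b : Fin 3) : Poly3 →ₐ[ℚ] Poly3 :=
  aeval fun i => if i = b then X a else X i

lemma merge_C_mul_mon (a b : Fin 3) (r : ℚ) (i j k : ℕ) :
    merge a b (MvPolynomial.C r * mon i j k) = MvPolynomial.C r * merge a b (mon i j k) := by
  rw [map_mul, MvPolynomial.algHom_C, MvPolynomial.algebraMap_eq]

lemma sum_antidiagonal_ite (m i j : ℕ) (Q : Prop) [Decidable Q] :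
    ∑ p ∈ Finset.HasAntidiagonal.antidiagonal m,
      (if i = p.1 ∧ j = p.2 ∧ Q then (1 : ℚ) else 0) = if i + j = m ∧ Q then 1 else 0 := by
  by_cases hQ : Q
  · simp only [hQ, and_true]
    have : ∀ p : ℕ × ℕ, (i = p.1 ∧ j = p.2) ↔ (i, j) = p := fun p => by simp [Prod.ext_iff]
    simp [this, Finset.sum_ite_eq]
  · simp [hQ]

/-- Restricting a polynomial to a diagonal sums its coefficients over antidiagonals. -/
lemma sum_cf_merge_zero_one (f : Poly3) (m k : ℕ) :
    ∑ p ∈ Finset.HasAntidiagonal.antidiagonal m, cf f p.1 p.2 k = cf (merge 0 1 f) m 0 k := by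
  induction f using poly3_induction with
  | add f g hf hg => simp only [cf_add, map_add, Finset.sum_add_distrib, hf, hg]
  | mon r i j l =>
    have h : merge 0 1 (mon i j l) = mon (i + j) 0 l := by
      simp [merge, mon, pow_add]
    simp only [merge_C_mul_mon, h, cf_C_mul, cf_mon, ← Finset.mul_sum]
    rw [sum_antidiagonal_ite]
    simp

lemma sum_cf_merge_zero_two (f : Poly3) (m k : ℕ) :
    ∑ p ∈ Finset.HasAntidiagonal.antidiagonal m, cf f p.1 k p.2 = cf (merge 0 2 f) m k 0 := by
  induction f using poly3_induction with
  | add f g hf hg => simp only [cf_add, map_add, Finset.sum_add_distrib, hf, hg]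
  | mon r i j l =>
    have h : merge 0 2 (mon i j l) = mon (i + l) j 0 := by
      simp [merge, mon, pow_add, mul_right_comm]
    have h' : ∀ p : ℕ × ℕ, (i = p.1 ∧ j = k ∧ l = p.2) ↔ (i = p.1 ∧ l = p.2 ∧ j = k) :=
      fun p => by tauto
    simp only [merge_C_mul_mon, h, cf_C_mul, cf_mon, ← Finset.mul_sum, h']
    rw [sum_antidiagonal_ite]
    simp

lemma sum_cf_merge_one_two (f : Poly3) (m k : ℕ) :
    ∑ p ∈ Finset.HasAntidiagonal.antidiagonal m, cf f k p.1 p.2 = cf (merge 1 2 f) k m 0 := by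
  induction f using poly3_induction with
  | add f g hf hg => simp only [cf_add, map_add, Finset.sum_add_distrib, hf, hg]
  | mon r i j l =>
    have h : merge 1 2 (mon i j l) = mon i (j + l) 0 := by
      simp [merge, mon, pow_add, mul_assoc]
    have h' : ∀ p : ℕ × ℕ, (i = k ∧ j = p.1 ∧ l = p.2) ↔ (j = p.1 ∧ l = p.2 ∧ i = k) :=
      fun p => by tauto
    simp only [merge_C_mul_mon, h, cf_C_mul, cf_mon, ← Finset.mul_sum, h']
    rw [sum_antidiagonal_ite]
    simp [and_comm]

lemma coeff_X_mul_pderiv (a : Fin 3) (f : Poly3) (e : Fin 3 →₀ ℕ) :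
    MvPolynomial.coeff e (MvPolynomial.X a * MvPolynomial.pderiv a f) =
      e a * MvPolynomial.coeff e f := by
  classical
  induction f using poly3_induction with
  | add f g hf hg => simp only [map_add, mul_add, MvPolynomial.coeff_add, hf, hg]
  | mon r i j l =>
    rw [← monomial_expo, MvPolynomial.X_mul_pderiv_monomial, MvPolynomial.coeff_smul,
      MvPolynomial.coeff_monomial, nsmul_eq_mul]
    split_ifs with h
    · rw [h]
    · simp

open MvPolynomial in
/-- The differential operator with eigenvalues `e a (e a - 1) - e a e b` on monomials. -/
lemma coeff_deriv_op (a b : Fin 3) (hab : a ≠ b) (f : Poly3) (e : Fin 3 →₀ ℕ) :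
    coeff e (X a * (X a * pderiv a (pderiv a f)) - X a * (X b * pderiv a (pderiv b f))) =
      ((e a : ℚ) * (e a - 1) - e a * e b) * coeff e f := by
  have h1 : X a * (X a * pderiv a (pderiv a f)) - X a * (X b * pderiv a (pderiv b f)) =
      X a * pderiv a (X a * pderiv a f) - X a * pderiv a f
        - X a * pderiv a (X b * pderiv b f) := by
    simp only [pderiv_mul, pderiv_X_self, pderiv_X_of_ne hab.symm]
    ring
  rw [h1, coeff_sub, coeff_sub, coeff_X_mul_pderiv, coeff_X_mul_pderiv, coeff_X_mul_pderiv,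
    coeff_X_mul_pderiv]
  ring

open MvPolynomial in
/-- The second-order operator corresponding to the relation `x'' μ - x' μ'`. -/
noncomputable def derivOp (a b : Fin 3) (f : Poly3) : Poly3 :=
  pderiv a (pderiv a f) - pderiv a (pderiv b f)

lemma merge_X_self (a b : Fin 3) : merge a b (MvPolynomial.X a) = MvPolynomial.X a := by
  by_cases h : a = b <;> simp [merge, h]

lemma merge_X_right (a b : Fin 3) : merge a b (MvPolynomial.X b) = MvPolynomial.X a := by
  simp [merge]

open MvPolynomial in
lemma merge_deriv_op {a b : Fin 3} {f : Poly3} (h : merge a b (derivOp a b f) = 0) :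
    merge a b (X a * (X a * pderiv a (pderiv a f)) - X a * (X b * pderiv a (pderiv b f))) = 0 := by
  have h1 : merge a b (X a * (X a * pderiv a (pderiv a f)) - X a * (X b * pderiv a (pderiv b f))) =
      X a * X a * merge a b (derivOp a b f) := by
    simp only [derivOp, map_sub, map_mul, merge_X_self, merge_X_right]
    ring
  rw [h1, h, mul_zero]

lemma sum_derivCoeff_zero_one {f : Poly3} (h : merge 0 1 (derivOp 0 1 f) = 0) (m k : ℕ) :
    ∑ p ∈ Finset.HasAntidiagonal.antidiagonal m, derivCoeff p * cf f p.1 p.2 k = 0 := by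
  have h1 := sum_cf_merge_zero_one (_ - _) m k |>.trans
    (congrArg (fun g => cf g m 0 k) (merge_deriv_op h))
  simpa only [cf, coeff_deriv_op _ _ (show (0 : Fin 3) ≠ 1 by decide), derivCoeff,
    expo_zero, expo_one, expo_two, MvPolynomial.coeff_zero] using h1

lemma sum_derivCoeff_zero_two {f : Poly3} (h : merge 0 2 (derivOp 0 2 f) = 0) (m k : ℕ) :
    ∑ p ∈ Finset.HasAntidiagonal.antidiagonal m, derivCoeff p * cf f p.1 k p.2 = 0 := by
  have h1 := sum_cf_merge_zero_two (_ - _) m k |>.trans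
    (congrArg (fun g => cf g m k 0) (merge_deriv_op h))
  simpa only [cf, coeff_deriv_op _ _ (show (0 : Fin 3) ≠ 2 by decide), derivCoeff,
    expo_zero, expo_one, expo_two, MvPolynomial.coeff_zero] using h1

lemma sum_snd_zero_one {f : Poly3} (h : merge 0 1 (MvPolynomial.pderiv 1 f) = 0) (m k : ℕ) :
    ∑ p ∈ Finset.HasAntidiagonal.antidiagonal m, (p.2 : ℚ) * cf f p.1 p.2 k = 0 := by
  have h1 := sum_cf_merge_zero_one (MvPolynomial.X 1 * MvPolynomial.pderiv 1 f) m k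
  rw [map_mul, h, mul_zero] at h1
  simpa [cf, coeff_X_mul_pderiv] using h1

lemma sum_snd_one_two {f : Poly3} (h : merge 1 2 (MvPolynomial.pderiv 2 f) = 0) (m k : ℕ) :
    ∑ p ∈ Finset.HasAntidiagonal.antidiagonal m, (p.2 : ℚ) * cf f k p.1 p.2 = 0 := by
  have h1 := sum_cf_merge_one_two (MvPolynomial.X 2 * MvPolynomial.pderiv 2 f) m k
  rw [map_mul, h, mul_zero] at h1
  simpa [cf, coeff_X_mul_pderiv] using h1

/-- The exchange of the first two variables. -/
noncomputable def swap01 : Poly3 →ₐ[ℚ] Poly3 := MvPolynomial.rename (Equiv.swap 0 1)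

/-- The exchange of the last two variables. -/
noncomputable def swap12 : Poly3 →ₐ[ℚ] Poly3 := MvPolynomial.rename (Equiv.swap 1 2)

lemma cf_swap01 (f : Poly3) (i j k : ℕ) : cf (swap01 f) i j k = cf f j i k := by
  induction f using poly3_induction with
  | add f g hf hg => simp only [cf_add, map_add, hf, hg]
  | mon r i' j' l =>
    have h : swap01 (MvPolynomial.C r * mon i' j' l) = MvPolynomial.C r * mon j' i' l := by
      simp only [swap01, mon, map_mul, map_pow, MvPolynomial.rename_X, MvPolynomial.rename_C,
        Equiv.swap_apply_left, Equiv.swap_apply_right,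
        Equiv.swap_apply_of_ne_of_ne (show (2 : Fin 3) ≠ 0 by decide)
          (show (2 : Fin 3) ≠ 1 by decide)]
      ring
    simp only [h, cf_C_mul, cf_mon, and_left_comm]

lemma cf_swap12 (f : Poly3) (i j k : ℕ) : cf (swap12 f) i j k = cf f i k j := by
  induction f using poly3_induction with
  | add f g hf hg => simp only [cf_add, map_add, hf, hg]
  | mon r i' j' l =>
    have h : swap12 (MvPolynomial.C r * mon i' j' l) = MvPolynomial.C r * mon i' l j' := by
      simp only [swap12, mon, map_mul, map_pow, MvPolynomial.rename_X, MvPolynomial.rename_C,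
        Equiv.swap_apply_left, Equiv.swap_apply_right,
        Equiv.swap_apply_of_ne_of_ne (show (0 : Fin 3) ≠ 1 by decide)
          (show (0 : Fin 3) ≠ 2 by decide)]
      ring
    simp only [h, cf_C_mul, cf_mon, and_comm (a := l = j)]

/-- The functional on words `x x x` given by the coefficients of a polynomial. -/
noncomputable def evXXX (f : Poly3) (a b c : ℕ) : ℚ :=
  if a % 2 = 0 ∧ b % 2 = 0 ∧ c % 2 = 0 then cf f (a / 2) (b / 2) (c / 2) else 0

/-- The functional on words in two letters `x` and one letter `mu` given by the coefficients of a
polynomial, the variables `0`, `1` belonging to the letters `x`. -/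
noncomputable def evXXM (f : Poly3) (a b c : ℕ) : ℚ :=
  if a % 2 = 0 ∧ b % 2 = 0 ∧ c % 2 = 1 then cf f (a / 2) (b / 2) (c / 2)
  else if a % 2 = 0 ∧ b % 2 = 1 ∧ c % 2 = 0 then cf f (a / 2) (c / 2) (b / 2)
  else if a % 2 = 1 ∧ b % 2 = 0 ∧ c % 2 = 0 then cf f (b / 2) (c / 2) (a / 2)
  else 0

/-- The functional on words in one letter `x` and two letters `mu` given by the coefficients of a
polynomial, the variable `0` belonging to the letter `x`. -/
noncomputable def evXMM (f : Poly3) (a b c : ℕ) : ℚ :=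
  if a % 2 = 0 ∧ b % 2 = 1 ∧ c % 2 = 1 then cf f (a / 2) (b / 2) (c / 2)
  else if a % 2 = 1 ∧ b % 2 = 0 ∧ c % 2 = 1 then cf f (b / 2) (a / 2) (c / 2)
  else if a % 2 = 1 ∧ b % 2 = 1 ∧ c % 2 = 0 then cf f (c / 2) (a / 2) (b / 2)
  else 0

/-- The functional on words `mu mu mu` given by the coefficients of a polynomial. -/
noncomputable def evMMM (f : Poly3) (a b c : ℕ) : ℚ :=
  if a % 2 = 1 ∧ b % 2 = 1 ∧ c % 2 = 1 then cf f (a / 2) (b / 2) (c / 2) else 0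

lemma eq_double (a : ℕ) : ∃ i, a = 2 * i ∨ a = 2 * i + 1 := ⟨a / 2, by omega⟩

lemma cf_zero (i j k : ℕ) : cf 0 i j k = 0 := by simp [cf]

lemma cf_neg (f : Poly3) (i j k : ℕ) : cf (-f) i j k = -cf f i j k := by simp [cf]

lemma double_add_one_div (i : ℕ) : (2 * i + 1) / 2 = i := by omega

lemma isCubicDual_evXXX {f : Poly3} (h01 : swap01 f = f) (h12 : swap12 f = f)
    (hm : merge 0 1 f = 0) : IsCubicDual (evXXX f) := by
  have s01 : ∀ i j k, cf f i j k = cf f j i k := fun i j k => by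
    conv_lhs => rw [← h01, cf_swap01]
  have s12 : ∀ i j k, cf f i j k = cf f i k j := fun i j k => by
    conv_lhs => rw [← h12, cf_swap12]
  constructor
  · intro a b c
    obtain ⟨i, rfl | rfl⟩ := eq_double a <;> obtain ⟨j, rfl | rfl⟩ := eq_double b <;>
    obtain ⟨k, rfl | rfl⟩ := eq_double c <;> simp [evXXX, sgn, Nat.add_mod, s01 j i k]
  · intro a b c
    obtain ⟨i, rfl | rfl⟩ := eq_double a <;> obtain ⟨j, rfl | rfl⟩ := eq_double b <;>
    obtain ⟨k, rfl | rfl⟩ := eq_double c <;> simp [evXXX, sgn, Nat.add_mod, s12 i k j]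
  · intro m c
    obtain ⟨k, rfl | rfl⟩ := eq_double c
    · simpa [evXXX, hm, cf_zero] using sum_cf_merge_zero_one f m k
    · simp [evXXX, Nat.add_mod]
  · intro m c; simp [evXXX, Nat.add_mod]
  · intro m c; simp [evXXX, Nat.add_mod]
  · intro m c; simp [evXXX, Nat.add_mod]

lemma isCubicDual_evXXM {f : Poly3} (h01 : swap01 f = f) (hm : merge 0 1 f = 0)
    (hm' : merge 0 2 f = 0) (hd : merge 0 2 (derivOp 0 2 f) = 0) : IsCubicDual (evXXM f) := by
  have s01 : ∀ i j k, cf f i j k = cf f j i k := fun i j k => by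
    conv_lhs => rw [← h01, cf_swap01]
  constructor
  · intro a b c
    obtain ⟨i, rfl | rfl⟩ := eq_double a <;> obtain ⟨j, rfl | rfl⟩ := eq_double b <;>
    obtain ⟨k, rfl | rfl⟩ := eq_double c <;>
      simp [evXXM, sgn, Nat.add_mod, s01 j i k, double_add_one_div]
  · intro a b c
    obtain ⟨i, rfl | rfl⟩ := eq_double a <;> obtain ⟨j, rfl | rfl⟩ := eq_double b <;>
    obtain ⟨k, rfl | rfl⟩ := eq_double c <;>
      simp [evXXM, sgn, Nat.add_mod, s01 k j i, double_add_one_div]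
  · intro m c
    obtain ⟨k, rfl | rfl⟩ := eq_double c
    · simp [evXXM]
    · simpa [evXXM, hm, cf_zero, double_add_one_div] using sum_cf_merge_zero_one f m k
  · intro m c
    obtain ⟨k, rfl | rfl⟩ := eq_double c
    · simpa [evXXM, hm', cf_zero, double_add_one_div] using sum_cf_merge_zero_two f m k
    · simp [evXXM, Nat.add_mod]
  · intro m c
    obtain ⟨k, rfl | rfl⟩ := eq_double c
    · simpa [evXXM, double_add_one_div] using sum_derivCoeff_zero_two hd m k
    · simp [evXXM, Nat.add_mod]
  · intro m c; simp [evXXM, Nat.add_mod]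

lemma isCubicDual_evXMM {f : Poly3} (h12 : swap12 f = -f) (hm : merge 0 1 f = 0)
    (hd : merge 0 1 (derivOp 0 1 f) = 0) (ho : merge 1 2 (MvPolynomial.pderiv 2 f) = 0) :
    IsCubicDual (evXMM f) := by
  have s12 : ∀ i j k, cf f i j k = -cf f i k j := fun i j k => by
    rw [← cf_swap12 f i j k, h12, cf_neg, neg_neg]
  constructor
  · intro a b c
    obtain ⟨i, rfl | rfl⟩ := eq_double a <;> obtain ⟨j, rfl | rfl⟩ := eq_double b <;>
    obtain ⟨k, rfl | rfl⟩ := eq_double c <;>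
      simp [evXMM, sgn, Nat.add_mod, s12 k j i, double_add_one_div]
  · intro a b c
    obtain ⟨i, rfl | rfl⟩ := eq_double a <;> obtain ⟨j, rfl | rfl⟩ := eq_double b <;>
    obtain ⟨k, rfl | rfl⟩ := eq_double c <;>
      simp [evXMM, sgn, Nat.add_mod, s12 i k j, double_add_one_div]
  · intro m c; simp [evXMM]
  · intro m c
    obtain ⟨k, rfl | rfl⟩ := eq_double c
    · simp [evXMM, Nat.add_mod]
    · simpa [evXMM, hm, cf_zero, double_add_one_div] using sum_cf_merge_zero_one f m k
  · intro m c
    obtain ⟨k, rfl | rfl⟩ := eq_double c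
    · simp [evXMM, Nat.add_mod]
    · simpa [evXMM, double_add_one_div] using sum_derivCoeff_zero_one hd m k
  · intro m c
    obtain ⟨k, rfl | rfl⟩ := eq_double c
    · simpa [evXMM, double_add_one_div] using sum_snd_one_two ho m k
    · simp [evXMM, Nat.add_mod]

lemma isCubicDual_evMMM {f : Poly3} (h01 : swap01 f = -f) (h12 : swap12 f = -f)
    (ho : merge 0 1 (MvPolynomial.pderiv 1 f) = 0) : IsCubicDual (evMMM f) := by
  have s01 : ∀ i j k, cf f i j k = -cf f j i k := fun i j k => by
    rw [← cf_swap01 f i j k, h01, cf_neg, neg_neg]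
  have s12 : ∀ i j k, cf f i j k = -cf f i k j := fun i j k => by
    rw [← cf_swap12 f i j k, h12, cf_neg, neg_neg]
  constructor
  · intro a b c
    obtain ⟨i, rfl | rfl⟩ := eq_double a <;> obtain ⟨j, rfl | rfl⟩ := eq_double b <;>
    obtain ⟨k, rfl | rfl⟩ := eq_double c <;>
      simp [evMMM, sgn, Nat.add_mod, s01 j i k, double_add_one_div]
  · intro a b c
    obtain ⟨i, rfl | rfl⟩ := eq_double a <;> obtain ⟨j, rfl | rfl⟩ := eq_double b <;>
    obtain ⟨k, rfl | rfl⟩ := eq_double c <;>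
      simp [evMMM, sgn, Nat.add_mod, s12 i k j, double_add_one_div]
  · intro m c; simp [evMMM]
  · intro m c; simp [evMMM, Nat.add_mod]
  · intro m c; simp [evMMM, Nat.add_mod]
  · intro m c
    obtain ⟨k, rfl | rfl⟩ := eq_double c
    · simp [evMMM, Nat.add_mod]
    · simpa [evMMM, double_add_one_div] using sum_snd_zero_one ho m k

/-! ### Solutions of the differential conditions -/

section Solutions

open MvPolynomial

lemma pderiv_ofNat (i : Fin 3) (n : ℕ) [n.AtLeastTwo] :
    pderiv i (OfNat.ofNat n : Poly3) = 0 := Derivation.map_natCast _ n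

lemma C_ofNat (n : ℕ) [n.AtLeastTwo] : (C (OfNat.ofNat n) : Poly3) = OfNat.ofNat n := map_ofNat C n

lemma pderiv_aeval (y : Fin 3 → Poly3) (i : Fin 3) (G : Poly3) :
    pderiv i (aeval y G) = aeval y (pderiv 0 G) * pderiv i (y 0) +
      aeval y (pderiv 1 G) * pderiv i (y 1) + aeval y (pderiv 2 G) * pderiv i (y 2) := by
  induction G using MvPolynomial.induction_on with
  | C a => simp
  | add p q hp hq => simp only [map_add, hp, hq]; ring
  | mul_X p j hp =>
    simp only [map_mul, pderiv_mul, hp, aeval_X, map_add]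
    fin_cases j <;> simp [pderiv_X] <;> ring

lemma merge_sub_mul (a b : Fin 3) (g : Poly3) : merge a b ((X a - X b) * g) = 0 := by
  rw [map_mul, map_sub, merge_X_self, merge_X_right, sub_self, zero_mul]

/-- For a multiple of `X a - X b` the second-order condition reduces to a first-order one. -/
lemma merge_derivOp {a b : Fin 3} (hab : a ≠ b) (g : Poly3) :
    merge a b (derivOp a b ((X a - X b) * g)) = merge a b (3 * pderiv a g - pderiv b g) := by
  have h : derivOp a b ((X a - X b) * g) = (3 * pderiv a g - pderiv b g) +
      (X a - X b) * (pderiv a (pderiv a g) - pderiv a (pderiv b g)) := by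
    simp only [derivOp, pderiv_mul, map_sub, map_add, pderiv_X_self, pderiv_X_of_ne hab,
      pderiv_X_of_ne hab.symm, pderiv_one, map_zero]
    ring
  rw [h, map_add, merge_sub_mul, add_zero]

lemma merge_pderiv_cube {a b : Fin 3} (hab : a ≠ b) (g : Poly3) :
    merge a b (pderiv b ((X a - X b) ^ 3 * g)) = 0 := by
  have h : pderiv b ((X a - X b) ^ 3 * g) =
      (X a - X b) * ((X a - X b) * (-3 * g + (X a - X b) * pderiv b g)) := by
    simp only [pderiv_mul, pderiv_pow, map_sub, pderiv_X_self, pderiv_X_of_ne hab]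
    push_cast
    ring
  rw [h, merge_sub_mul]

/-- Setting the first variable to zero. -/
noncomputable def setZero : Poly3 →ₐ[ℚ] Poly3 := aeval ![0, X 1, X 2]

/-- The coordinates `z₁ - w`, `z₂ - w`, `z₁ + z₂ + 3 w` adapted to two letters `x` and one `mu`:
the operator `3 ∂ / ∂ z₁ - ∂ / ∂ w` kills the last one. -/
noncomputable def coordXXM : Poly3 →ₐ[ℚ] Poly3 :=
  aeval ![X 0 - X 2, X 1 - X 2, X 0 + X 1 + 3 * X 2]

/-- The coordinates `w₁ - z`, `w₂ - z`, `z + 3 w₁ + 3 w₂` adapted to one letter `x` and two `mu`: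
the operator `3 ∂ / ∂ z - ∂ / ∂ w₁` kills the last one. -/
noncomputable def coordXMM : Poly3 →ₐ[ℚ] Poly3 :=
  aeval ![X 1 - X 0, X 2 - X 0, X 0 + 3 * X 1 + 3 * X 2]

lemma coordXXM_injective : Function.Injective coordXXM := by
  let W : Poly3 := C (1 / 5) * (X 2 - X 0 - X 1)
  have hW : 5 * W = X 2 - X 0 - X 1 := by
    have : (5 : Poly3) * C (1 / 5) = 1 := by
      rw [← C_ofNat, ← C_mul]; norm_num
    rw [← mul_assoc, this, one_mul]
  refine Function.LeftInverse.injective (g := aeval ![X 0 + W, X 1 + W, W]) fun f => ?_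
  rw [← AlgHom.comp_apply]
  conv_rhs => rw [← AlgHom.id_apply (R := ℚ) f]
  congr 1
  refine algHom_ext fun i => ?_
  fin_cases i <;> simp [coordXXM]
  rw [map_ofNat]
  linear_combination hW

lemma coordXMM_injective : Function.Injective coordXMM := by
  let W : Poly3 := C (1 / 7) * (X 2 - 3 * X 0 - 3 * X 1)
  have hW : 7 * W = X 2 - 3 * X 0 - 3 * X 1 := by
    have : (7 : Poly3) * C (1 / 7) = 1 := by
      rw [← C_ofNat, ← C_mul]; norm_num
    rw [← mul_assoc, this, one_mul]
  refine Function.LeftInverse.injective (g := aeval ![W, X 0 + W, X 1 + W]) fun f => ?_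
  rw [← AlgHom.comp_apply]
  conv_rhs => rw [← AlgHom.id_apply (R := ℚ) f]
  congr 1
  refine algHom_ext fun i => ?_
  fin_cases i <;> simp [coordXMM]
  rw [map_ofNat]
  linear_combination hW

lemma swap01_coordXXM (G : Poly3) : swap01 (coordXXM G) = coordXXM (swap01 G) := by
  rw [← AlgHom.comp_apply, ← AlgHom.comp_apply]
  congr 1
  refine algHom_ext fun i => ?_
  fin_cases i <;> simp [coordXXM, swap01, Equiv.swap_apply_of_ne_of_ne]
  rw [map_ofNat]
  ring

lemma swap12_coordXMM (G : Poly3) : swap12 (coordXMM G) = coordXMM (swap01 G) := by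
  rw [← AlgHom.comp_apply, ← AlgHom.comp_apply]
  congr 1
  refine algHom_ext fun i => ?_
  fin_cases i <;> simp [coordXMM, swap01, swap12, Equiv.swap_apply_of_ne_of_ne]
  rw [map_ofNat]
  ring

lemma merge_coordXXM {G : Poly3} (h : setZero G = 0) : merge 0 2 (coordXXM G) = 0 := by
  have : (merge 0 2).comp coordXXM =
      (aeval ![0, X 1 - X 0, X 0 + X 1 + 3 * X 0] : Poly3 →ₐ[ℚ] Poly3).comp setZero := by
    refine algHom_ext fun i => ?_
    fin_cases i <;> simp [coordXXM, setZero, merge]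
    rw [map_ofNat]
  rw [← AlgHom.comp_apply, this, AlgHom.comp_apply, h, map_zero]

lemma merge_coordXMM {G : Poly3} (h : setZero G = 0) : merge 0 1 (coordXMM G) = 0 := by
  have : (merge 0 1).comp coordXMM =
      (aeval ![0, X 2 - X 0, X 0 + 3 * X 0 + 3 * X 2] : Poly3 →ₐ[ℚ] Poly3).comp setZero := by
    refine algHom_ext fun i => ?_
    fin_cases i <;> simp [coordXMM, setZero, merge]
    rw [map_ofNat]
  rw [← AlgHom.comp_apply, this, AlgHom.comp_apply, h, map_zero]

/-- The polynomial giving a functional on words in two letters `x` and one `mu`. The linear factors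
make it vanish on all diagonals, as the relations `x ^ 2` and `x μ` demand, and be symmetric in the
two letters `x`; the relation `x'' μ - x' μ'` is a condition on `G`. -/
noncomputable def polyXXM (G : Poly3) : Poly3 :=
  (X 0 - X 1) ^ 2 * (X 0 - X 2) * (X 1 - X 2) * coordXXM G

/-- The polynomial giving a functional on words in one letter `x` and two `mu`. The linear factors
account for the antisymmetry in the two letters `mu` and for the relations `x μ` and `μ μ'`; the
relation `x'' μ - x' μ'` is a condition on `G`. -/
noncomputable def polyXMM (G : Poly3) : Poly3 :=
  (X 1 - X 2) ^ 3 * (X 1 - X 0) * (X 2 - X 0) * coordXMM G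

lemma isCubicDual_polyXXM {G : Poly3} (hs : swap01 G = G)
    (hG : setZero (X 1 * (4 * pderiv 0 G + pderiv 1 G) - 5 * G) = 0) :
    IsCubicDual (evXXM (polyXXM G)) := by
  have hf : polyXXM G = (X 0 - X 2) * ((X 0 - X 1) ^ 2 * (X 1 - X 2) * coordXXM G) := by
    rw [polyXXM]; ring
  have hf' : polyXXM G = (X 0 - X 1) * ((X 0 - X 1) * (X 0 - X 2) * (X 1 - X 2) * coordXXM G) := by
    rw [polyXXM]; ring
  refine isCubicDual_evXXM ?_ ?_ ?_ ?_
  · rw [polyXXM, map_mul, swap01_coordXXM, hs]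
    congr 1
    simp [swap01, Equiv.swap_apply_of_ne_of_ne]
    ring
  · rw [hf', merge_sub_mul]
  · rw [hf, merge_sub_mul]
  · have h1 : 3 * pderiv 0 (coordXXM G) - pderiv 2 (coordXXM G) =
        coordXXM (4 * pderiv 0 G + pderiv 1 G) := by
      rw [coordXXM, pderiv_aeval, pderiv_aeval]
      simp [pderiv_X]
      rw [pderiv_ofNat, pderiv_ofNat]
      repeat rw [map_ofNat]
      ring
    have h2 : 3 * pderiv 0 ((X 0 - X 1) ^ 2 * (X 1 - X 2) * coordXXM G) -
        pderiv 2 ((X 0 - X 1) ^ 2 * (X 1 - X 2) * coordXXM G) =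
        (X 0 - X 1) ^ 2 * coordXXM (X 1 * (4 * pderiv 0 G + pderiv 1 G) - 5 * G) +
          (X 0 - X 2) * (6 * (X 0 - X 1) * coordXXM G) := by
      have h3 : coordXXM (X 1) = X 1 - X 2 := by simp [coordXXM]
      have h4 : coordXXM (X 1 * (4 * pderiv 0 G + pderiv 1 G) - 5 * G) =
          (X 1 - X 2) * (3 * pderiv 0 (coordXXM G) - pderiv 2 (coordXXM G)) -
            5 * coordXXM G := by
        rw [h1, map_sub coordXXM, map_mul coordXXM, map_mul coordXXM, h3, map_ofNat coordXXM]
      rw [h4]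
      simp [pderiv_X]
      ring
    rw [hf, merge_derivOp (by decide), h2, map_add, merge_sub_mul, map_mul, merge_coordXXM hG,
      mul_zero, add_zero]

lemma isCubicDual_polyXMM {G : Poly3} (hs : swap01 G = G)
    (hG : setZero (4 * pderiv 0 G + 3 * pderiv 1 G) = 0) :
    IsCubicDual (evXMM (polyXMM G)) := by
  have hf : polyXMM G = (X 0 - X 1) * (-((X 1 - X 2) ^ 3 * (X 2 - X 0)) * coordXMM G) := by
    rw [polyXMM]; ring
  have hf' : polyXMM G = (X 1 - X 2) ^ 3 * ((X 1 - X 0) * (X 2 - X 0) * coordXMM G) := by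
    rw [polyXMM]; ring
  refine isCubicDual_evXMM ?_ ?_ ?_ ?_
  · rw [polyXMM, map_mul, swap12_coordXMM, hs, ← neg_mul]
    congr 1
    simp [swap12, Equiv.swap_apply_of_ne_of_ne]
    ring
  · rw [hf, merge_sub_mul]
  · have h1 : 3 * pderiv 0 (coordXMM G) - pderiv 1 (coordXMM G) =
        -coordXMM (4 * pderiv 0 G + 3 * pderiv 1 G) := by
      rw [coordXMM, pderiv_aeval, pderiv_aeval]
      simp [pderiv_X]
      rw [pderiv_ofNat, pderiv_ofNat]
      repeat rw [map_ofNat]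
      ring
    have h2 : 3 * pderiv 0 (-((X 1 - X 2) ^ 3 * (X 2 - X 0)) * coordXMM G) -
        pderiv 1 (-((X 1 - X 2) ^ 3 * (X 2 - X 0)) * coordXMM G) =
        (X 1 - X 2) ^ 3 * (X 2 - X 0) * coordXMM (4 * pderiv 0 G + 3 * pderiv 1 G) +
          (X 0 - X 1) * (-3 * (X 1 - X 2) ^ 2 * coordXMM G) := by
      rw [← neg_neg (coordXMM (4 * pderiv 0 G + 3 * pderiv 1 G)), ← h1]
      simp [pderiv_X]
      ring
    rw [hf, merge_derivOp (by decide), h2, map_add, merge_sub_mul, map_mul, merge_coordXMM hG,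
      mul_zero, add_zero]
  · rw [hf', merge_pderiv_cube (by decide)]

/-- The symmetric polynomial in the first two variables with value `X 1 ^ n` for `X 0 = 0` and
prescribed normal derivative there, times a power of the third variable. -/
noncomputable def edgePoly (lam : ℚ) (n l : ℕ) : Poly3 :=
  X 2 ^ l * ((X 0 + X 1) ^ n - C lam * (X 0 * X 1 * (X 0 + X 1) ^ (n - 2)))

/-- The symmetrization of a monomial in the first two variables. -/
noncomputable def symPoly (m n l : ℕ) : Poly3 := X 2 ^ l * (X 0 ^ m * X 1 ^ n + X 0 ^ n * X 1 ^ m)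

/-- A family of symmetric polynomials in the first two variables, with prescribed value and normal
derivative for `X 0 = 0`. -/
noncomputable def basisPoly (lam : ℕ → ℚ) (e : ℕ × ℕ × ℕ) : Poly3 :=
  if e.1 = 0 then edgePoly (lam e.2.1) e.2.1 e.2.2 else symPoly e.1 e.2.1 e.2.2

/-- The exponents that occur as indices of `basisPoly`. -/
def IsIndex (e : ℕ × ℕ × ℕ) : Prop := e.1 = 0 ∨ 2 ≤ e.1 ∧ e.1 ≤ e.2.1

lemma swap01_basisPoly (lam : ℕ → ℚ) (e : ℕ × ℕ × ℕ) :
    swap01 (basisPoly lam e) = basisPoly lam e := by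
  unfold basisPoly
  split_ifs
  · simp [edgePoly, swap01, Equiv.swap_apply_of_ne_of_ne]
    ring
  · simp [symPoly, swap01, Equiv.swap_apply_of_ne_of_ne]
    ring

/-- The factor `5 (n - 1) / 4` solves the condition of `isCubicDual_polyXXM`, which prescribes the
normal derivative for `X 0 = 0` in terms of the value there. There is no solution for `n = 0`. -/
lemma isCubicDual_basisXXM {e : ℕ × ℕ × ℕ} (he : IsIndex e) (he' : e.1 = 0 → e.2.1 ≠ 0) :
    IsCubicDual (evXXM (polyXXM (basisPoly (fun n => 5 * (n - 1) / 4) e))) := by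
  refine isCubicDual_polyXXM (swap01_basisPoly _ _) ?_
  obtain ⟨m, n, l⟩ := e
  dsimp only [IsIndex] at he he'
  unfold basisPoly
  split_ifs with h
  · obtain rfl | ⟨k, rfl⟩ : n = 1 ∨ ∃ k, n = k + 2 := by
      rcases n with _ | _ | k
      · exact absurd rfl (he' h)
      · exact Or.inl rfl
      · exact Or.inr ⟨k, rfl⟩
    · simp [edgePoly, setZero, pderiv_X]
      repeat rw [map_ofNat]
      ring
    · have hC : (4 : Poly3) * C (5 * ((k + 2 : ℕ) - 1) / 4 : ℚ) = 5 * ((k : Poly3) + 1) := by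
        rw [← C_ofNat, ← C_mul]
        have : (4 : ℚ) * (5 * ((k + 2 : ℕ) - 1) / 4) = 5 * ((k : ℚ) + 1) := by push_cast; ring
        rw [this, map_mul, map_add, map_natCast, map_one, map_ofNat]
      dsimp only
      generalize 5 * (((k + 2 : ℕ) : ℚ) - 1) / 4 = lam at hC ⊢
      simp [edgePoly, setZero, pderiv_X]
      repeat rw [map_ofNat]
      linear_combination (-(X 2 ^ l * X 1 ^ (k + 2))) * hC
  · obtain ⟨m, rfl⟩ : ∃ k, m = k + 2 := ⟨m - 2, by omega⟩
    obtain ⟨n, rfl⟩ : ∃ k, n = k + 2 := ⟨n - 2, by omega⟩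
    simp [symPoly, setZero, pderiv_X]

/-- The factor `7 n / 4` solves the condition of `isCubicDual_polyXMM`. For `n = 1` the polynomial
`edgePoly` is not a solution. -/
lemma isCubicDual_basisXMM {e : ℕ × ℕ × ℕ} (he : IsIndex e) (he' : e.1 = 0 → e.2.1 ≠ 1) :
    IsCubicDual (evXMM (polyXMM (basisPoly (fun n => 7 * n / 4) e))) := by
  refine isCubicDual_polyXMM (swap01_basisPoly _ _) ?_
  obtain ⟨m, n, l⟩ := e
  dsimp only [IsIndex] at he he'
  unfold basisPoly
  split_ifs with h
  · obtain rfl | ⟨k, rfl⟩ : n = 0 ∨ ∃ k, n = k + 2 := by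
      rcases n with _ | _ | k
      · exact Or.inl rfl
      · exact absurd rfl (he' h)
      · exact Or.inr ⟨k, rfl⟩
    · simp [edgePoly, setZero, pderiv_X]
    · have hC : (4 : Poly3) * C (7 * (k + 2 : ℕ) / 4 : ℚ) = 7 * ((k : Poly3) + 2) := by
        rw [← C_ofNat, ← C_mul]
        have : (4 : ℚ) * (7 * (k + 2 : ℕ) / 4) = 7 * ((k : ℚ) + 2) := by push_cast; ring
        rw [this, map_mul, map_add, map_natCast, map_ofNat, map_ofNat]
      dsimp only
      generalize 7 * ((k + 2 : ℕ) : ℚ) / 4 = lam at hC ⊢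
      simp [edgePoly, setZero, pderiv_X]
      repeat rw [map_ofNat]
      linear_combination (-(X 2 ^ l * X 1 ^ (k + 1))) * hC
  · obtain ⟨m, rfl⟩ : ∃ k, m = k + 2 := ⟨m - 2, by omega⟩
    obtain ⟨n, rfl⟩ : ∃ k, n = k + 2 := ⟨n - 2, by omega⟩
    simp [symPoly, setZero, pderiv_X]

end Solutions

/-! ### Functionals dual to the normal words of length three -/

/-- Normal words of length three. -/
def GoodTriple (t : ℕ × ℕ × ℕ) : Prop := Good t.1 t.2.1 ∧ Good t.2.1 t.2.2

/-- A linearly independent family of cubic functionals indexed by a finite set of normal words and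
supported there spans the functions on this set, because cubic functionals are determined by their
values on normal words. -/
lemma exists_dual_of_family (N : Finset (ℕ × ℕ × ℕ))
    (F : ℕ × ℕ × ℕ → ℕ → ℕ → ℕ → ℚ) (hF : ∀ t ∈ N, F t ∈ cubicDual)
    (hsupp : ∀ t ∈ N, ∀ a b c, GoodTriple (a, b, c) → F t a b c ≠ 0 → (a, b, c) ∈ N)
    (hind : ∀ c : N → ℚ, ∑ t, c t • F t = 0 → c = 0) {t : ℕ × ℕ × ℕ} (ht : t ∈ N) :
    ∃ φ ∈ cubicDual, ∀ a b c, GoodTriple (a, b, c) → φ a b c = if (a, b, c) = t then 1 else 0 := by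
  classical
  let T : (N → ℚ) →ₗ[ℚ] (N → ℚ) :=
    { toFun := fun c n => (∑ m, c m • F m) n.1.1 n.1.2.1 n.1.2.2
      map_add' := by
        intro c d
        funext n
        simp [add_smul, Finset.sum_add_distrib]
      map_smul' := by
        intro r c
        funext n
        simp [mul_smul, Finset.mul_sum, Finset.sum_apply] }
  have hmem : ∀ c : N → ℚ, ∑ m, c m • F m ∈ cubicDual := fun c =>
    Submodule.sum_mem _ fun m _ => Submodule.smul_mem _ _ (hF m m.2)
  have hout : ∀ c : N → ℚ, ∀ x y z, GoodTriple (x, y, z) → (x, y, z) ∉ N →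
      (∑ m, c m • F m) x y z = 0 := by
    intro c x y z hg hn
    simp only [Finset.sum_apply, Pi.smul_apply]
    refine Finset.sum_eq_zero fun m _ => ?_
    by_contra h
    exact hn (hsupp m m.2 x y z hg (right_ne_zero_of_mul h))
  have hinj : Function.Injective T := by
    rw [injective_iff_map_eq_zero]
    intro c hc
    refine hind c (cubicDual_ext (hmem c) fun x y z h1 h2 => ?_)
    by_cases hn : (x, y, z) ∈ N
    · exact congrFun hc ⟨(x, y, z), hn⟩
    · exact hout c x y z ⟨h1, h2⟩ hn
  obtain ⟨c, hc⟩ := LinearMap.injective_iff_surjective.1 hinj (Pi.single ⟨t, ht⟩ 1)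
  refine ⟨_, hmem c, fun x y z hg => ?_⟩
  by_cases hn : (x, y, z) ∈ N
  · have := congrFun hc ⟨(x, y, z), hn⟩
    refine this.trans ?_
    simp [Pi.single_apply]
  · rw [hout c x y z hg hn, if_neg]
    rintro rfl
    exact hn ht

lemma cf_sum_smul {ι : Type*} (N : Finset ι) (c : ι → ℚ) (P : ι → Poly3) (i j k : ℕ) :
    cf (∑ t ∈ N, c t • P t) i j k = ∑ t ∈ N, c t * cf (P t) i j k := by
  simp [cf, MvPolynomial.coeff_sum]

/-- A version of `exists_dual_of_family` for functionals given by polynomials: `ev` turns the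
homogeneous polynomials `P t`, independent over the normal words `t` with `o` odd letters, into
cubic functionals. Homogeneity leaves a finite set of normal words, those with given sum. -/
lemma exists_dual_of_poly (o : ℕ) (ev : Poly3 → ℕ → ℕ → ℕ → ℚ) (P : ℕ × ℕ × ℕ → Poly3)
    (D : ℕ × ℕ × ℕ → ℕ) (ev_sum : ∀ (N : Finset (ℕ × ℕ × ℕ)) (c : N → ℚ) (Q : N → Poly3),
      ev (∑ t, c t • Q t) = ∑ t, c t • ev (Q t))
    (ev_inj : ∀ f, ev f = 0 → f = 0)
    (ev_ne : ∀ f d a b c, f.IsHomogeneous d → ev f a b c ≠ 0 →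
      a % 2 + b % 2 + c % 2 = o ∧ a + b + c = 2 * d + o)
    (hdual : ∀ a b c, GoodTriple (a, b, c) → a % 2 + b % 2 + c % 2 = o →
      IsCubicDual (ev (P (a, b, c))))
    (hdeg : ∀ a b c, GoodTriple (a, b, c) → a % 2 + b % 2 + c % 2 = o →
      (P (a, b, c)).IsHomogeneous (D (a, b, c)) ∧ a + b + c = 2 * D (a, b, c) + o)
    (hind : ∀ (N : Finset (ℕ × ℕ × ℕ)),
      (∀ t ∈ N, GoodTriple t ∧ t.1 % 2 + t.2.1 % 2 + t.2.2 % 2 = o) →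
      ∀ c : N → ℚ, ∑ t : N, c t • P t = 0 → c = 0)
    {a b c : ℕ} (ht : GoodTriple (a, b, c)) (ho : a % 2 + b % 2 + c % 2 = o) :
    ∃ φ ∈ cubicDual, ∀ a' b' c', GoodTriple (a', b', c') →
      φ a' b' c' = if (a', b', c') = (a, b, c) then 1 else 0 := by
  classical
  let s := a + b + c
  let N : Finset (ℕ × ℕ × ℕ) :=
    (Finset.range (s + 1) ×ˢ Finset.range (s + 1) ×ˢ Finset.range (s + 1)).filter fun t =>
      GoodTriple t ∧ t.1 % 2 + t.2.1 % 2 + t.2.2 % 2 = o ∧ t.1 + t.2.1 + t.2.2 = s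
  have hN : ∀ x y z, (x, y, z) ∈ N ↔
      GoodTriple (x, y, z) ∧ x % 2 + y % 2 + z % 2 = o ∧ x + y + z = s := by
    intro x y z
    simp only [N, Finset.mem_filter, Finset.mem_product, Finset.mem_range, and_iff_right_iff_imp]
    omega
  refine exists_dual_of_family N (fun t => ev (P t))
    (fun t h => hdual _ _ _ ((hN _ _ _).1 h).1 ((hN _ _ _).1 h).2.1) ?_ ?_
    ((hN a b c).2 ⟨ht, ho, rfl⟩)
  · rintro ⟨x, y, z⟩ h x' y' z' hg hne
    obtain ⟨h1, h2, h3⟩ := (hN _ _ _).1 h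
    obtain ⟨h4, h5⟩ := hdeg x y z h1 h2
    obtain ⟨h6, h7⟩ := ev_ne _ _ _ _ _ h4 hne
    exact (hN _ _ _).2 ⟨hg, h6, by omega⟩
  · intro d hd
    rw [← ev_sum] at hd
    exact hind N (fun t h => ⟨((hN _ _ _).1 h).1, ((hN _ _ _).1 h).2.1⟩) d (ev_inj _ hd)

/-! ### Linear independence of the polynomials -/

section Independence

open MvPolynomial

lemma setZero_basisPoly (lam : ℕ → ℚ) {e : ℕ × ℕ × ℕ} (he : IsIndex e) :
    setZero (basisPoly lam e) = if e.1 = 0 then mon 0 e.2.1 e.2.2 else 0 := by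
  obtain ⟨m, n, l⟩ := e
  dsimp only [IsIndex] at he ⊢
  unfold basisPoly
  dsimp only
  split_ifs with h
  · simp [edgePoly, setZero, mon]
    ring
  · obtain ⟨m, rfl⟩ : ∃ k, m = k + 1 := ⟨m - 1, by omega⟩
    obtain ⟨n, rfl⟩ : ∃ k, n = k + 1 := ⟨n - 1, by omega⟩
    simp [symPoly, setZero]

lemma basisPoly_indep (lam : ℕ → ℚ) {ι : Type*} (N : Finset ι) (idx : ι → ℕ × ℕ × ℕ)
    (hinj : ∀ t ∈ N, ∀ t' ∈ N, idx t = idx t' → t = t') (hidx : ∀ t ∈ N, IsIndex (idx t))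
    (c : ι → ℚ) (h : ∑ t ∈ N, c t • basisPoly lam (idx t) = 0) : ∀ t ∈ N, c t = 0 := by
  -- the restriction to `X 0 = 0` sees only the indices with first entry zero
  have h0 : ∀ t ∈ N, (idx t).1 = 0 → c t = 0 := by
    intro t ht ht0
    have h1 := congrArg (fun f => cf (setZero f) 0 (idx t).2.1 (idx t).2.2) h
    simp only [map_sum, map_smul, cf_sum_smul, map_zero, cf_zero] at h1
    rw [Finset.sum_eq_single t] at h1
    · rw [setZero_basisPoly lam (hidx t ht), if_pos ht0, cf_mon] at h1
      simpa using h1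
    · intro t' ht' hne
      rw [setZero_basisPoly lam (hidx t' ht')]
      split_ifs with h2
      · rw [cf_mon, if_neg, mul_zero]
        rintro ⟨-, h3, h4⟩
        exact hne (hinj _ ht' _ ht (Prod.ext (h2.trans ht0.symm) (Prod.ext h3 h4)))
      · rw [cf_zero, mul_zero]
    · exact fun hn => absurd ht hn
  intro t ht
  by_cases ht0 : (idx t).1 = 0
  · exact h0 t ht ht0
  have hsym : ∀ m n l i j k, cf (symPoly m n l) i j k =
      (if m = i ∧ n = j ∧ l = k then 1 else 0) + if n = i ∧ m = j ∧ l = k then 1 else 0 := by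
    intro m n l i j k
    rw [← cf_mon, ← cf_mon, ← cf_add]
    congr 1
    simp only [symPoly, mon]
    ring
  have h1 := congrArg (fun f => cf f (idx t).1 (idx t).2.1 (idx t).2.2) h
  simp only [cf_sum_smul, cf_zero] at h1
  have hpos : ∀ t' ∈ N, (idx t').1 ≠ 0 → 2 ≤ (idx t').1 ∧ (idx t').1 ≤ (idx t').2.1 :=
    fun t' ht' hne => (hidx t' ht').resolve_left hne
  rw [Finset.sum_eq_single t] at h1
  · rw [basisPoly, if_neg ht0, hsym] at h1
    simp only [and_self, if_true] at h1
    refine (mul_eq_zero.1 h1).resolve_right ?_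
    split_ifs <;> norm_num
  · intro t' ht' hne
    by_cases h2 : (idx t').1 = 0
    · rw [h0 t' ht' h2, zero_mul]
    · have hne' : idx t' ≠ idx t := fun h => hne (hinj _ ht' _ ht h)
      have := hpos t ht ht0
      have := hpos t' ht' h2
      simp only [ne_eq, Prod.ext_iff] at hne'
      rw [basisPoly, if_neg h2, hsym, if_neg (by omega), if_neg (by omega), add_zero, mul_zero]
  · exact fun hn => absurd ht hn

/-- The symmetrization of a monomial in three variables. -/
noncomputable def symMon (e : ℕ × ℕ × ℕ) : Poly3 :=
  mon e.1 e.2.1 e.2.2 + mon e.1 e.2.2 e.2.1 + mon e.2.1 e.1 e.2.2 + mon e.2.1 e.2.2 e.1 +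
    mon e.2.2 e.1 e.2.1 + mon e.2.2 e.2.1 e.1

lemma symMon_indep {ι : Type*} (N : Finset ι) (idx : ι → ℕ × ℕ × ℕ)
    (hinj : ∀ t ∈ N, ∀ t' ∈ N, idx t = idx t' → t = t')
    (hidx : ∀ t ∈ N, (idx t).1 ≤ (idx t).2.1 ∧ (idx t).2.1 ≤ (idx t).2.2)
    (c : ι → ℚ) (h : ∑ t ∈ N, c t • symMon (idx t) = 0) : ∀ t ∈ N, c t = 0 := by
  intro t ht
  have h1 := congrArg (fun f => cf f (idx t).1 (idx t).2.1 (idx t).2.2) h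
  simp only [cf_sum_smul, cf_zero] at h1
  rw [Finset.sum_eq_single t] at h1
  · refine (mul_eq_zero.1 h1).resolve_right ?_
    simp only [symMon, cf_add, cf_mon, and_self, if_true]
    have : ∀ (Q : Prop) [Decidable Q], (0 : ℚ) ≤ if Q then 1 else 0 := by
      intro Q _; split_ifs <;> norm_num
    positivity
  · intro t' ht' hne
    have hne' : idx t' ≠ idx t := fun h => hne (hinj _ ht' _ ht h)
    have := hidx t ht
    have := hidx t' ht'
    simp only [ne_eq, Prod.ext_iff] at hne'
    simp only [symMon, cf_add, cf_mon]
    rw [if_neg (by omega), if_neg (by omega), if_neg (by omega), if_neg (by omega),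
      if_neg (by omega), if_neg (by omega)]
    simp
  · exact fun hn => absurd ht hn

lemma symMon_isHomogeneous (e : ℕ × ℕ × ℕ) : (symMon e).IsHomogeneous (e.1 + e.2.1 + e.2.2) := by
  have h : ∀ i j k, i + j + k = e.1 + e.2.1 + e.2.2 →
      (mon i j k).IsHomogeneous (e.1 + e.2.1 + e.2.2) := by
    intro i j k hs
    have := (((isHomogeneous_X ℚ (0 : Fin 3)).pow i).mul
      ((isHomogeneous_X ℚ (1 : Fin 3)).pow j)).mul ((isHomogeneous_X ℚ (2 : Fin 3)).pow k)
    rw [← hs]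
    simpa [mon] using this
  unfold symMon
  refine (((((h _ _ _ ?_).add (h _ _ _ ?_)).add (h _ _ _ ?_)).add (h _ _ _ ?_)).add
    (h _ _ _ ?_)).add (h _ _ _ ?_) <;> omega

lemma isHomogeneous_X_sub_X (i j : Fin 3) : (X i - X j : Poly3).IsHomogeneous 1 :=
  (isHomogeneous_X ℚ i).sub (isHomogeneous_X ℚ j)

lemma basisPoly_isHomogeneous (lam : ℕ → ℚ) {e : ℕ × ℕ × ℕ} (he : IsIndex e)
    (hlam : e.1 = 0 → 2 ≤ e.2.1 ∨ lam e.2.1 = 0) :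
    (basisPoly lam e).IsHomogeneous (e.1 + e.2.1 + e.2.2) := by
  obtain ⟨m, n, l⟩ := e
  dsimp only [IsIndex] at he hlam ⊢
  unfold basisPoly
  dsimp only
  have h2 := (isHomogeneous_X ℚ (2 : Fin 3)).pow l
  have h01 := (isHomogeneous_X ℚ (0 : Fin 3)).add (isHomogeneous_X ℚ (1 : Fin 3))
  split_ifs with h
  · have h3 : (C (lam n) * (X 0 * X 1 * (X 0 + X 1) ^ (n - 2)) : Poly3).IsHomogeneous n := by
      obtain h4 | h4 := hlam h
      · have := (isHomogeneous_C (Fin 3) (lam n)).mul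
          (((isHomogeneous_X ℚ (0 : Fin 3)).mul (isHomogeneous_X ℚ (1 : Fin 3))).mul
            (h01.pow (n - 2)))
        convert this using 1
        omega
      · rw [h4, C_0, zero_mul]
        exact isHomogeneous_zero _ _ _
    have h4 := h01.pow n
    rw [one_mul] at h4
    have := h2.mul (h4.sub h3)
    unfold edgePoly
    convert this using 1
    omega
  · have h3 : ∀ i j, i + j = m + n → (X 0 ^ i * X 1 ^ j : Poly3).IsHomogeneous (m + n) := by
      intro i j hij
      have := ((isHomogeneous_X ℚ (0 : Fin 3)).pow i).mul ((isHomogeneous_X ℚ (1 : Fin 3)).pow j)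
      rw [← hij]
      simpa using this
    have := h2.mul ((h3 m n rfl).add (h3 n m (add_comm _ _)))
    unfold symPoly
    convert this using 1
    omega

lemma isHomogeneous_ofNat (n : ℕ) [n.AtLeastTwo] : (OfNat.ofNat n : Poly3).IsHomogeneous 0 := by
  rw [← C_ofNat]
  exact isHomogeneous_C _ _

lemma polyXXM_isHomogeneous {G : Poly3} {d : ℕ} (hG : G.IsHomogeneous d) :
    (polyXXM G).IsHomogeneous (d + 4) := by
  have h1 : (coordXXM G).IsHomogeneous (1 * d) := by
    refine hG.aeval _ fun i => ?_
    fin_cases i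
    · exact isHomogeneous_X_sub_X _ _
    · exact isHomogeneous_X_sub_X _ _
    · refine ((isHomogeneous_X ℚ (0 : Fin 3)).add (isHomogeneous_X ℚ (1 : Fin 3))).add ?_
      exact (isHomogeneous_ofNat 3).mul (isHomogeneous_X ℚ (2 : Fin 3))
  have := ((((isHomogeneous_X_sub_X 0 1).pow 2).mul (isHomogeneous_X_sub_X 0 2)).mul
    (isHomogeneous_X_sub_X 1 2)).mul h1
  unfold polyXXM
  convert this using 1
  omega

lemma polyXMM_isHomogeneous {G : Poly3} {d : ℕ} (hG : G.IsHomogeneous d) :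
    (polyXMM G).IsHomogeneous (d + 5) := by
  have h1 : (coordXMM G).IsHomogeneous (1 * d) := by
    refine hG.aeval _ fun i => ?_
    fin_cases i
    · exact isHomogeneous_X_sub_X _ _
    · exact isHomogeneous_X_sub_X _ _
    · refine ((isHomogeneous_X ℚ (0 : Fin 3)).add ?_).add ?_
      · exact (isHomogeneous_ofNat 3).mul (isHomogeneous_X ℚ (1 : Fin 3))
      · exact (isHomogeneous_ofNat 3).mul (isHomogeneous_X ℚ (2 : Fin 3))
  have := ((((isHomogeneous_X_sub_X 1 2).pow 3).mul (isHomogeneous_X_sub_X 1 0)).mul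
    (isHomogeneous_X_sub_X 2 0)).mul h1
  unfold polyXMM
  convert this using 1
  omega

lemma X_sub_X_ne_zero {i j : Fin 3} (h : i ≠ j) : (X i - X j : Poly3) ≠ 0 := by
  rw [sub_ne_zero]
  exact fun h' => h (X_injective h')

lemma sum_smul_mul_map {ι : Type*} (N : Finset ι) (c : ι → ℚ) (B : Poly3)
    (Ψ : Poly3 →ₐ[ℚ] Poly3) (G : ι → Poly3) :
    ∑ t ∈ N, c t • (B * Ψ (G t)) = B * Ψ (∑ t ∈ N, c t • G t) := by
  simp only [map_sum, map_smul, Finset.mul_sum, mul_smul_comm]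

end Independence

/-! ### Matching normal words of length three with polynomials -/

section Matching

open MvPolynomial

lemma isHomogeneous_cf {f : Poly3} {d : ℕ} (hf : f.IsHomogeneous d) {i j k : ℕ}
    (h : cf f i j k ≠ 0) : i + j + k = d := by
  have := hf h
  rw [Finsupp.weight_apply, Finsupp.sum_fintype _ _ (by simp), Fin.sum_univ_three] at this
  simpa using this

lemma evXXX_sum {ι : Type*} (N : Finset ι) (c : ι → ℚ) (Q : ι → Poly3) :
    evXXX (∑ t ∈ N, c t • Q t) = ∑ t ∈ N, c t • evXXX (Q t) := by
  funext x y z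
  simp only [Finset.sum_apply, Pi.smul_apply, smul_eq_mul, evXXX]
  split_ifs <;> simp [cf_sum_smul]

lemma evXXM_sum {ι : Type*} (N : Finset ι) (c : ι → ℚ) (Q : ι → Poly3) :
    evXXM (∑ t ∈ N, c t • Q t) = ∑ t ∈ N, c t • evXXM (Q t) := by
  funext x y z
  simp only [Finset.sum_apply, Pi.smul_apply, smul_eq_mul, evXXM]
  split_ifs <;> simp [cf_sum_smul]

lemma evXMM_sum {ι : Type*} (N : Finset ι) (c : ι → ℚ) (Q : ι → Poly3) :
    evXMM (∑ t ∈ N, c t • Q t) = ∑ t ∈ N, c t • evXMM (Q t) := by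
  funext x y z
  simp only [Finset.sum_apply, Pi.smul_apply, smul_eq_mul, evXMM]
  split_ifs <;> simp [cf_sum_smul]

lemma evMMM_sum {ι : Type*} (N : Finset ι) (c : ι → ℚ) (Q : ι → Poly3) :
    evMMM (∑ t ∈ N, c t • Q t) = ∑ t ∈ N, c t • evMMM (Q t) := by
  funext x y z
  simp only [Finset.sum_apply, Pi.smul_apply, smul_eq_mul, evMMM]
  split_ifs <;> simp [cf_sum_smul]

lemma evXXX_inj {f : Poly3} (h : evXXX f = 0) : f = 0 := by
  refine cf_ext fun i j k => ?_
  have := congrFun (congrFun (congrFun h (2 * i)) (2 * j)) (2 * k)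
  simpa [evXXX, cf_zero] using this

lemma evXXM_inj {f : Poly3} (h : evXXM f = 0) : f = 0 := by
  refine cf_ext fun i j k => ?_
  have := congrFun (congrFun (congrFun h (2 * i)) (2 * j)) (2 * k + 1)
  simpa [evXXM, cf_zero, Nat.add_mod, double_add_one_div] using this

lemma evXMM_inj {f : Poly3} (h : evXMM f = 0) : f = 0 := by
  refine cf_ext fun i j k => ?_
  have := congrFun (congrFun (congrFun h (2 * i)) (2 * j + 1)) (2 * k + 1)
  simpa [evXMM, cf_zero, Nat.add_mod, double_add_one_div] using this

lemma evMMM_inj {f : Poly3} (h : evMMM f = 0) : f = 0 := by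
  refine cf_ext fun i j k => ?_
  have := congrFun (congrFun (congrFun h (2 * i + 1)) (2 * j + 1)) (2 * k + 1)
  simpa [evMMM, cf_zero, Nat.add_mod, double_add_one_div] using this

/-- The exponents matched to a normal word `x x x`. -/
def idxXXX (t : ℕ × ℕ × ℕ) : ℕ × ℕ × ℕ := (t.1 / 2, t.2.1 / 2 - 2, t.2.2 / 2 - 4)

/-- The exponents matched to a normal word `mu mu mu`. -/
def idxMMM (t : ℕ × ℕ × ℕ) : ℕ × ℕ × ℕ := (t.1 / 2, t.2.1 / 2 - 3, t.2.2 / 2 - 6)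

/-- The index of `basisPoly` matched to exponents `m ≤ n` of the adapted coordinates `1` and `2` and
an exponent `l` of the last one. The value `m = 0` yields a polynomial `edgePoly`. -/
def shiftIdx (m n l : ℕ) : ℕ × ℕ × ℕ := if m = 0 then (0, n + 2, l) else (m + 1, n + 1, l)

/-- The index of `basisPoly` matched to a normal word in two letters `x` and one `mu`: the gaps
forced between neighbours are removed, and the three positions of `mu` correspond to the three
positions of `l` relative to `m ≤ n` in `shiftIdx`. The words beginning with `x 0`, `mu 1` are
matched to the polynomials `edgePoly` with `n = 1`. -/
def idxXXM (t : ℕ × ℕ × ℕ) : ℕ × ℕ × ℕ :=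
  if t.2.2 % 2 = 1 then shiftIdx (t.2.1 / 2 - 2) (t.2.2 / 2 - 4) (t.1 / 2)
  else if t.2.1 % 2 = 1 then
    if t.2.1 = 3 then (0, 1, t.2.2 / 2 - 4)
    else shiftIdx (t.1 / 2) (t.2.1 / 2 - 2) (t.2.2 / 2 - 4)
  else shiftIdx (t.1 / 2) (t.2.2 / 2 - 4) (t.2.1 / 2 - 2)

/-- The index of `basisPoly` matched to a normal word in one letter `x` and two letters `mu`. The
words beginning with `x 0`, `mu 1` are matched to the polynomials `edgePoly` with `n = 0`. -/
def idxXMM (t : ℕ × ℕ × ℕ) : ℕ × ℕ × ℕ :=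
  if t.1 % 2 = 0 then
    if t.2.1 = 3 then (0, 0, t.2.2 / 2 - 4)
    else shiftIdx (t.2.1 / 2 - 2) (t.2.2 / 2 - 5) (t.1 / 2)
  else if t.2.1 % 2 = 0 then shiftIdx (t.1 / 2) (t.2.1 / 2 - 3) (t.2.2 / 2 - 4)
  else shiftIdx (t.1 / 2) (t.2.2 / 2 - 5) (t.2.1 / 2 - 2)

lemma good_iff_of_ne_zero {b c : ℕ} (hb : b ≠ 0) : Good b c ↔ b + 4 + b % 2 + c % 2 ≤ c := by
  simp [Good, hb]

/-- The normal words in two letters `x` and one `mu`, with their indices. -/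
lemma idxXXM_cases {t : ℕ × ℕ × ℕ} (ht : GoodTriple t)
    (ho : t.1 % 2 + t.2.1 % 2 + t.2.2 % 2 = 1) :
    ∃ A B C, A ≤ B ∧ B ≤ C ∧
      (t = (2 * A, 2 * (B + 2), 2 * (C + 4) + 1) ∧ idxXXM t = shiftIdx B C A ∨
       t = (2 * A, 2 * (B + 2) + 1, 2 * (C + 5)) ∧ idxXXM t = shiftIdx A B (C + 1) ∨
       t = (2 * A + 1, 2 * (B + 3), 2 * (C + 5)) ∧ idxXXM t = shiftIdx A (C + 1) (B + 1) ∨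
       t = (0, 3, 2 * (C + 4)) ∧ idxXXM t = (0, 1, C)) := by
  obtain ⟨a, b, c⟩ := t
  obtain ⟨h1, h2⟩ := ht
  have hb : b ≠ 0 := by simp only [Good] at h1; omega
  rw [good_iff_of_ne_zero hb] at h2
  simp only [Good] at h1 h2 ho
  simp only [idxXXM]
  split_ifs with h3 h4 h5
  · refine ⟨a / 2, b / 2 - 2, c / 2 - 4, by omega, by omega, Or.inl ⟨?_, rfl⟩⟩
    simp only [Prod.mk.injEq]; omega
  · refine ⟨0, 0, c / 2 - 4, by omega, by omega, Or.inr (Or.inr (Or.inr ⟨?_, rfl⟩))⟩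
    simp only [Prod.mk.injEq]; omega
  · refine ⟨a / 2, b / 2 - 2, c / 2 - 5, by omega, by omega, Or.inr (Or.inl ⟨?_, ?_⟩)⟩
    · simp only [Prod.mk.injEq]; omega
    · rw [show c / 2 - 5 + 1 = c / 2 - 4 by omega]
  · refine ⟨a / 2, b / 2 - 3, c / 2 - 5, by omega, by omega, Or.inr (Or.inr (Or.inl ⟨?_, ?_⟩))⟩
    · simp only [Prod.mk.injEq]; omega
    · rw [show c / 2 - 5 + 1 = c / 2 - 4 by omega, show b / 2 - 3 + 1 = b / 2 - 2 by omega]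

/-- The normal words in one letter `x` and two letters `mu`, with their indices. -/
lemma idxXMM_cases {t : ℕ × ℕ × ℕ} (ht : GoodTriple t)
    (ho : t.1 % 2 + t.2.1 % 2 + t.2.2 % 2 = 2) :
    ∃ A B C, A ≤ B ∧ B ≤ C ∧
      (t = (2 * A, 2 * (B + 2) + 1, 2 * (C + 5) + 1) ∧ idxXMM t = shiftIdx B C A ∨
       t = (2 * A + 1, 2 * (B + 3), 2 * (C + 5) + 1) ∧ idxXMM t = shiftIdx A B (C + 1) ∨
       t = (2 * A + 1, 2 * (B + 3) + 1, 2 * (C + 6)) ∧ idxXMM t = shiftIdx A (C + 1) (B + 1) ∨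
       t = (0, 3, 2 * (C + 4) + 1) ∧ idxXMM t = (0, 0, C)) := by
  obtain ⟨a, b, c⟩ := t
  obtain ⟨h1, h2⟩ := ht
  have hb : b ≠ 0 := by simp only [Good] at h1; omega
  rw [good_iff_of_ne_zero hb] at h2
  simp only [Good] at h1 h2 ho
  simp only [idxXMM]
  split_ifs with h3 h4 h5
  · refine ⟨0, 0, c / 2 - 4, by omega, by omega, Or.inr (Or.inr (Or.inr ⟨?_, rfl⟩))⟩
    simp only [Prod.mk.injEq]; omega
  · refine ⟨a / 2, b / 2 - 2, c / 2 - 5, by omega, by omega, Or.inl ⟨?_, rfl⟩⟩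
    simp only [Prod.mk.injEq]; omega
  · refine ⟨a / 2, b / 2 - 3, c / 2 - 5, by omega, by omega, Or.inr (Or.inl ⟨?_, ?_⟩)⟩
    · simp only [Prod.mk.injEq]; omega
    · rw [show c / 2 - 5 + 1 = c / 2 - 4 by omega]
  · refine ⟨a / 2, b / 2 - 3, c / 2 - 6, by omega, by omega, Or.inr (Or.inr (Or.inl ⟨?_, ?_⟩))⟩
    · simp only [Prod.mk.injEq]; omega
    · rw [show c / 2 - 6 + 1 = c / 2 - 5 by omega, show b / 2 - 3 + 1 = b / 2 - 2 by omega]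

lemma shiftIdx_spec {m n : ℕ} (l : ℕ) (h : m ≤ n) :
    IsIndex (shiftIdx m n l) ∧ ((shiftIdx m n l).1 = 0 → 2 ≤ (shiftIdx m n l).2.1) ∧
      (shiftIdx m n l).1 + (shiftIdx m n l).2.1 + (shiftIdx m n l).2.2 = m + n + l + 2 := by
  unfold shiftIdx IsIndex
  split_ifs <;> dsimp only <;> omega

lemma shiftIdx_inj {m n l m' n' l' : ℕ} (h : shiftIdx m n l = shiftIdx m' n' l') :
    m = m' ∧ n = n' ∧ l = l' := by
  unfold shiftIdx at h
  split_ifs at h <;> simp only [Prod.mk.injEq] at h <;> omega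

lemma idxXXM_spec {t : ℕ × ℕ × ℕ} (ht : GoodTriple t) (ho : t.1 % 2 + t.2.1 % 2 + t.2.2 % 2 = 1) :
    IsIndex (idxXXM t) ∧ ((idxXXM t).1 = 0 → 1 ≤ (idxXXM t).2.1) ∧
      t.1 + t.2.1 + t.2.2 = 2 * ((idxXXM t).1 + (idxXXM t).2.1 + (idxXXM t).2.2 + 4) + 1 := by
  obtain ⟨A, B, C, hAB, hBC, ⟨h1, h2⟩ | ⟨h1, h2⟩ | ⟨h1, h2⟩ | ⟨h1, h2⟩⟩ := idxXXM_cases ht ho <;>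
    rw [h2, h1]
  · obtain ⟨h3, h4, h5⟩ := shiftIdx_spec A hBC
    exact ⟨h3, fun h => by have := h4 h; omega, by dsimp only; omega⟩
  · obtain ⟨h3, h4, h5⟩ := shiftIdx_spec (C + 1) hAB
    exact ⟨h3, fun h => by have := h4 h; omega, by dsimp only; omega⟩
  · obtain ⟨h3, h4, h5⟩ := shiftIdx_spec (B + 1) (show A ≤ C + 1 by omega)
    exact ⟨h3, fun h => by have := h4 h; omega, by dsimp only; omega⟩
  · exact ⟨Or.inl rfl, fun _ => le_rfl, by dsimp only; omega⟩

lemma idxXMM_spec {t : ℕ × ℕ × ℕ} (ht : GoodTriple t) (ho : t.1 % 2 + t.2.1 % 2 + t.2.2 % 2 = 2) :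
    IsIndex (idxXMM t) ∧ ((idxXMM t).1 = 0 → (idxXMM t).2.1 ≠ 1) ∧
      t.1 + t.2.1 + t.2.2 = 2 * ((idxXMM t).1 + (idxXMM t).2.1 + (idxXMM t).2.2 + 5) + 2 := by
  obtain ⟨A, B, C, hAB, hBC, ⟨h1, h2⟩ | ⟨h1, h2⟩ | ⟨h1, h2⟩ | ⟨h1, h2⟩⟩ := idxXMM_cases ht ho <;>
    rw [h2, h1]
  · obtain ⟨h3, h4, h5⟩ := shiftIdx_spec A hBC
    exact ⟨h3, fun h => by have := h4 h; omega, by dsimp only; omega⟩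
  · obtain ⟨h3, h4, h5⟩ := shiftIdx_spec (C + 1) hAB
    exact ⟨h3, fun h => by have := h4 h; omega, by dsimp only; omega⟩
  · obtain ⟨h3, h4, h5⟩ := shiftIdx_spec (B + 1) (show A ≤ C + 1 by omega)
    exact ⟨h3, fun h => by have := h4 h; omega, by dsimp only; omega⟩
  · exact ⟨Or.inl rfl, fun _ => zero_ne_one, by dsimp only; omega⟩

lemma shiftIdx_ne {m n l n' l' : ℕ} (hn : n' < 2) : shiftIdx m n l ≠ (0, n', l') := by
  unfold shiftIdx
  split_ifs <;> simp only [ne_eq, Prod.mk.injEq] <;> omega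

lemma idxXXM_inj {t t' : ℕ × ℕ × ℕ} (ht : GoodTriple t)
    (ho : t.1 % 2 + t.2.1 % 2 + t.2.2 % 2 = 1) (ht' : GoodTriple t')
    (ho' : t'.1 % 2 + t'.2.1 % 2 + t'.2.2 % 2 = 1) (h : idxXXM t = idxXXM t') : t = t' := by
  obtain ⟨A, B, C, hAB, hBC, ⟨h1, h2⟩ | ⟨h1, h2⟩ | ⟨h1, h2⟩ | ⟨h1, h2⟩⟩ := idxXXM_cases ht ho <;>
  obtain ⟨A', B', C', hAB', hBC', ⟨h1', h2'⟩ | ⟨h1', h2'⟩ | ⟨h1', h2'⟩ | ⟨h1', h2'⟩⟩ :=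
    idxXXM_cases ht' ho' <;>
  rw [h2, h2'] at h <;> rw [h1, h1']
  case inr.inr.inr.inr.inr.inr => rw [(Prod.mk.inj (Prod.mk.inj h).2).2]
  all_goals first
    | exact absurd h (shiftIdx_ne (by norm_num))
    | exact absurd h.symm (shiftIdx_ne (by norm_num))
    | (have := shiftIdx_inj h; simp only [Prod.mk.injEq]; omega)

lemma idxXMM_inj {t t' : ℕ × ℕ × ℕ} (ht : GoodTriple t)
    (ho : t.1 % 2 + t.2.1 % 2 + t.2.2 % 2 = 2) (ht' : GoodTriple t')
    (ho' : t'.1 % 2 + t'.2.1 % 2 + t'.2.2 % 2 = 2) (h : idxXMM t = idxXMM t') : t = t' := by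
  obtain ⟨A, B, C, hAB, hBC, ⟨h1, h2⟩ | ⟨h1, h2⟩ | ⟨h1, h2⟩ | ⟨h1, h2⟩⟩ := idxXMM_cases ht ho <;>
  obtain ⟨A', B', C', hAB', hBC', ⟨h1', h2'⟩ | ⟨h1', h2'⟩ | ⟨h1', h2'⟩ | ⟨h1', h2'⟩⟩ :=
    idxXMM_cases ht' ho' <;>
  rw [h2, h2'] at h <;> rw [h1, h1']
  case inr.inr.inr.inr.inr.inr => rw [(Prod.mk.inj (Prod.mk.inj h).2).2]
  all_goals first
    | exact absurd h (shiftIdx_ne (by norm_num))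
    | exact absurd h.symm (shiftIdx_ne (by norm_num))
    | (have := shiftIdx_inj h; simp only [Prod.mk.injEq]; omega)

/-- The product of the differences of the variables. -/
noncomputable def vander : Poly3 := (X 0 - X 1) * (X 0 - X 2) * (X 1 - X 2)

lemma vander_ne_zero : vander ≠ 0 :=
  mul_ne_zero (mul_ne_zero (X_sub_X_ne_zero (by decide)) (X_sub_X_ne_zero (by decide)))
    (X_sub_X_ne_zero (by decide))

lemma vander_isHomogeneous : vander.IsHomogeneous 3 :=
  ((isHomogeneous_X_sub_X 0 1).mul (isHomogeneous_X_sub_X 0 2)).mul (isHomogeneous_X_sub_X 1 2)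

lemma swap01_mon (i j k : ℕ) : swap01 (mon i j k) = mon j i k :=
  cf_ext fun i' j' k' => by simp only [cf_swap01, cf_mon, and_left_comm]

lemma swap12_mon (i j k : ℕ) : swap12 (mon i j k) = mon i k j :=
  cf_ext fun i' j' k' => by simp only [cf_swap12, cf_mon, and_comm (a := k = j')]

lemma swap01_symMon (e : ℕ × ℕ × ℕ) : swap01 (symMon e) = symMon e := by
  simp only [symMon, map_add, swap01_mon]
  ring

lemma swap12_symMon (e : ℕ × ℕ × ℕ) : swap12 (symMon e) = symMon e := by
  simp only [symMon, map_add, swap12_mon]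
  ring

lemma swap01_vander : swap01 vander = -vander := by
  simp [vander, swap01, Equiv.swap_apply_of_ne_of_ne]
  ring

lemma swap12_vander : swap12 vander = -vander := by
  simp [vander, swap12, Equiv.swap_apply_of_ne_of_ne]
  ring

lemma isCubicDual_symXXX (e : ℕ × ℕ × ℕ) : IsCubicDual (evXXX (vander ^ 2 * symMon e)) := by
  refine isCubicDual_evXXX ?_ ?_ ?_
  · rw [map_mul, map_pow, swap01_vander, swap01_symMon, neg_sq]
  · rw [map_mul, map_pow, swap12_vander, swap12_symMon, neg_sq]
  · rw [map_mul, map_pow, vander, mul_assoc, merge_sub_mul, zero_pow two_ne_zero, zero_mul]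

lemma isCubicDual_symMMM (e : ℕ × ℕ × ℕ) : IsCubicDual (evMMM (vander ^ 3 * symMon e)) := by
  refine isCubicDual_evMMM ?_ ?_ ?_
  · rw [map_mul, map_pow, swap01_vander, swap01_symMon]
    ring
  · rw [map_mul, map_pow, swap12_vander, swap12_symMon]
    ring
  · have : vander ^ 3 * symMon e =
        (X 0 - X 1) ^ 3 * (((X 0 - X 2) * (X 1 - X 2)) ^ 3 * symMon e) := by
      rw [vander]; ring
    rw [this, merge_pderiv_cube (by decide)]

/-- Every normal word of length three has a dual cubic functional. The four cases are distinguished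
by the number of letters `mu`. -/
theorem exists_dual {a b c : ℕ} (h : GoodTriple (a, b, c)) :
    ∃ φ ∈ cubicDual, ∀ a' b' c', GoodTriple (a', b', c') →
      φ a' b' c' = if (a', b', c') = (a, b, c) then 1 else 0 := by
  obtain ho | ho | ho | ho : a % 2 + b % 2 + c % 2 = 0 ∨ a % 2 + b % 2 + c % 2 = 1 ∨
      a % 2 + b % 2 + c % 2 = 2 ∨ a % 2 + b % 2 + c % 2 = 3 := by omega
  · refine exists_dual_of_poly 0 evXXX (fun t => vander ^ 2 * symMon (idxXXX t))
      (fun t => 6 + ((idxXXX t).1 + (idxXXX t).2.1 + (idxXXX t).2.2))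
      (fun N c Q => evXXX_sum _ c Q) (fun f => evXXX_inj) ?_
      (fun a b c _ _ => isCubicDual_symXXX _) ?_ ?_ h ho
    · intro f d a b c hf hne
      unfold evXXX at hne
      split_ifs at hne
      · have := isHomogeneous_cf hf hne
        omega
      · exact absurd rfl hne
    · intro a b c ht ho
      refine ⟨(vander_isHomogeneous.pow 2).mul (symMon_isHomogeneous _), ?_⟩
      simp only [GoodTriple, Good] at ht
      simp only [idxXXX]
      omega
    · intro N hN c hc
      simp only [← mul_smul_comm, ← Finset.mul_sum] at hc
      have hc := (mul_eq_zero.1 hc).resolve_left (pow_ne_zero _ vander_ne_zero)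
      funext t
      refine symMon_indep Finset.univ (fun t : N => idxXXX t) ?_ ?_ c hc t (Finset.mem_univ _)
      · rintro ⟨⟨a, b, c⟩, h⟩ - ⟨⟨a', b', c'⟩, h'⟩ - heq
        obtain ⟨h1, h2⟩ := hN _ h
        obtain ⟨h3, h4⟩ := hN _ h'
        simp only [GoodTriple, Good] at h1 h2 h3 h4
        simp only [idxXXX, Prod.mk.injEq] at heq
        simp only [Subtype.mk.injEq, Prod.mk.injEq]
        omega
      · rintro ⟨⟨a, b, c⟩, h⟩ -
        obtain ⟨h1, h2⟩ := hN _ h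
        simp only [GoodTriple, Good] at h1 h2
        simp only [idxXXX]
        omega
  · have hlam : ∀ t, GoodTriple t → t.1 % 2 + t.2.1 % 2 + t.2.2 % 2 = 1 → (idxXXM t).1 = 0 →
        2 ≤ (idxXXM t).2.1 ∨ (5 * (((idxXXM t).2.1 : ℚ) - 1) / 4 : ℚ) = 0 := by
      intro t ht ho h0
      have h1 := (idxXXM_spec ht ho).2.1 h0
      rcases Nat.lt_or_ge (idxXXM t).2.1 2 with h2 | h2
      · right
        rw [show (idxXXM t).2.1 = 1 by omega]
        norm_num
      · exact Or.inl h2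
    refine exists_dual_of_poly 1 evXXM
      (fun t => polyXXM (basisPoly (fun n => 5 * (n - 1) / 4) (idxXXM t)))
      (fun t => (idxXXM t).1 + (idxXXM t).2.1 + (idxXXM t).2.2 + 4)
      (fun N c Q => evXXM_sum _ c Q) (fun f => evXXM_inj) ?_ ?_ ?_ ?_ h ho
    · intro f d a b c hf hne
      unfold evXXM at hne
      split_ifs at hne
      all_goals first | exact absurd rfl hne | (have := isHomogeneous_cf hf hne; omega)
    · intro a b c ht ho
      obtain ⟨h1, h2, -⟩ := idxXXM_spec ht ho
      exact isCubicDual_basisXXM h1 fun h => Nat.one_le_iff_ne_zero.1 (h2 h)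
    · intro a b c ht ho
      obtain ⟨h1, h2, h3⟩ := idxXXM_spec ht ho
      exact ⟨polyXXM_isHomogeneous (basisPoly_isHomogeneous _ h1 (hlam _ ht ho)), h3⟩
    · intro N hN c hc
      simp only [polyXXM, sum_smul_mul_map] at hc
      have hc := (mul_eq_zero.1 hc).resolve_left
        (mul_ne_zero (mul_ne_zero (pow_ne_zero _ (X_sub_X_ne_zero (by decide)))
          (X_sub_X_ne_zero (by decide))) (X_sub_X_ne_zero (by decide)))
      have hc := (map_eq_zero_iff coordXXM coordXXM_injective).1 hc
      funext t
      refine basisPoly_indep _ Finset.univ (fun t : N => idxXXM t) ?_ ?_ c hc t (Finset.mem_univ _)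
      · rintro t - t' - heq
        exact Subtype.ext (idxXXM_inj (hN _ t.2).1 (hN _ t.2).2 (hN _ t'.2).1 (hN _ t'.2).2 heq)
      · exact fun t _ => (idxXXM_spec (hN _ t.2).1 (hN _ t.2).2).1
  · have hlam : ∀ t, GoodTriple t → t.1 % 2 + t.2.1 % 2 + t.2.2 % 2 = 2 → (idxXMM t).1 = 0 →
        2 ≤ (idxXMM t).2.1 ∨ (7 * ((idxXMM t).2.1 : ℚ) / 4 : ℚ) = 0 := by
      intro t ht ho h0
      have h1 := (idxXMM_spec ht ho).2.1 h0
      rcases Nat.lt_or_ge (idxXMM t).2.1 2 with h2 | h2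
      · right
        rw [show (idxXMM t).2.1 = 0 by omega]
        norm_num
      · exact Or.inl h2
    refine exists_dual_of_poly 2 evXMM
      (fun t => polyXMM (basisPoly (fun n => 7 * n / 4) (idxXMM t)))
      (fun t => (idxXMM t).1 + (idxXMM t).2.1 + (idxXMM t).2.2 + 5)
      (fun N c Q => evXMM_sum _ c Q) (fun f => evXMM_inj) ?_ ?_ ?_ ?_ h ho
    · intro f d a b c hf hne
      unfold evXMM at hne
      split_ifs at hne
      all_goals first | exact absurd rfl hne | (have := isHomogeneous_cf hf hne; omega)
    · intro a b c ht ho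
      obtain ⟨h1, h2, -⟩ := idxXMM_spec ht ho
      exact isCubicDual_basisXMM h1 h2
    · intro a b c ht ho
      obtain ⟨h1, h2, h3⟩ := idxXMM_spec ht ho
      exact ⟨polyXMM_isHomogeneous (basisPoly_isHomogeneous _ h1 (hlam _ ht ho)), h3⟩
    · intro N hN c hc
      simp only [polyXMM, sum_smul_mul_map] at hc
      have hc := (mul_eq_zero.1 hc).resolve_left
        (mul_ne_zero (mul_ne_zero (pow_ne_zero _ (X_sub_X_ne_zero (by decide)))
          (X_sub_X_ne_zero (by decide))) (X_sub_X_ne_zero (by decide)))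
      have hc := (map_eq_zero_iff coordXMM coordXMM_injective).1 hc
      funext t
      refine basisPoly_indep _ Finset.univ (fun t : N => idxXMM t) ?_ ?_ c hc t (Finset.mem_univ _)
      · rintro t - t' - heq
        exact Subtype.ext (idxXMM_inj (hN _ t.2).1 (hN _ t.2).2 (hN _ t'.2).1 (hN _ t'.2).2 heq)
      · exact fun t _ => (idxXMM_spec (hN _ t.2).1 (hN _ t.2).2).1
  · refine exists_dual_of_poly 3 evMMM (fun t => vander ^ 3 * symMon (idxMMM t))
      (fun t => 9 + ((idxMMM t).1 + (idxMMM t).2.1 + (idxMMM t).2.2))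
      (fun N c Q => evMMM_sum _ c Q) (fun f => evMMM_inj) ?_
      (fun a b c _ _ => isCubicDual_symMMM _) ?_ ?_ h ho
    · intro f d a b c hf hne
      unfold evMMM at hne
      split_ifs at hne
      · have := isHomogeneous_cf hf hne
        omega
      · exact absurd rfl hne
    · intro a b c ht ho
      refine ⟨(vander_isHomogeneous.pow 3).mul (symMon_isHomogeneous _), ?_⟩
      simp only [GoodTriple, Good] at ht
      simp only [idxMMM]
      omega
    · intro N hN c hc
      simp only [← mul_smul_comm, ← Finset.mul_sum] at hc
      have hc := (mul_eq_zero.1 hc).resolve_left (pow_ne_zero _ vander_ne_zero)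
      funext t
      refine symMon_indep Finset.univ (fun t : N => idxMMM t) ?_ ?_ c hc t (Finset.mem_univ _)
      · rintro ⟨⟨a, b, c⟩, h⟩ - ⟨⟨a', b', c'⟩, h'⟩ - heq
        obtain ⟨h1, h2⟩ := hN _ h
        obtain ⟨h3, h4⟩ := hN _ h'
        simp only [GoodTriple, Good] at h1 h2 h3 h4
        simp only [idxMMM, Prod.mk.injEq] at heq
        simp only [Subtype.mk.injEq, Prod.mk.injEq]
        omega
      · rintro ⟨⟨a, b, c⟩, h⟩ -
        obtain ⟨h1, h2⟩ := hN _ h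
        simp only [GoodTriple, Good] at h1 h2
        simp only [idxMMM]
        omega

end Matching

/-! ### Linear maps out of the algebras -/

/-- The product of a list of generators in the free algebra. -/
noncomputable def freeWord (w : List Gen) : Free := (w.map (FreeAlgebra.ι ℚ)).prod

lemma freeWord_append (u v : List Gen) : freeWord (u ++ v) = freeWord u * freeWord v := by
  simp [freeWord]

lemma mkAlgHom_freeWord (N : ℕ∞) (w : List Gen) :
    RingQuot.mkAlgHom ℚ (Rel N) (freeWord w) = wordProd N w := by
  simp only [freeWord, wordProd, map_list_prod, List.map_map]
  rfl

lemma basisFreeMonoid_apply (w : List Gen) :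
    FreeAlgebra.basisFreeMonoid ℚ Gen (FreeMonoid.ofList w) = freeWord w := by
  rw [FreeAlgebra.basisFreeMonoid, Module.Basis.map_apply]
  have : FreeAlgebra.equivMonoidAlgebraFreeMonoid.symm
      (MonoidAlgebra.of ℚ (FreeMonoid Gen) (FreeMonoid.ofList w)) = freeWord w :=
    (MonoidAlgebra.lift_of _ _).trans (FreeMonoid.lift_apply _ _)
  rw [← this, Finsupp.coe_basisSingleOne]
  rfl

/-- The linear map on the free algebra with given values on words. -/
noncomputable def wordLift {M : Type*} [AddCommGroup M] [Module ℚ M] (F : List Gen → M) :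
    Free →ₗ[ℚ] M :=
  (FreeAlgebra.basisFreeMonoid ℚ Gen).constr ℚ fun w => F w.toList

lemma wordLift_freeWord {M : Type*} [AddCommGroup M] [Module ℚ M] (F : List Gen → M)
    (w : List Gen) : wordLift F (freeWord w) = F w := by
  rw [← basisFreeMonoid_apply, wordLift, Module.Basis.constr_basis]
  rfl

lemma span_freeWord : Submodule.span ℚ (Set.range freeWord) = ⊤ := by
  rw [← (FreeAlgebra.basisFreeMonoid ℚ Gen).span_eq]
  congr 1
  ext a
  exact ⟨fun ⟨w, h⟩ => ⟨FreeMonoid.ofList w, (basisFreeMonoid_apply w).trans h⟩,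
    fun ⟨w, h⟩ => ⟨w.toList, (basisFreeMonoid_apply w.toList).symm.trans h⟩⟩

/-- A function on words extends to a linear map on the algebra when its linear extension respects
the relations in every context. -/
lemma exists_linearMap_of_words {N : ℕ∞} {M : Type*} [AddCommGroup M] [Module ℚ M]
    (F : List Gen → M) (h : ∀ a b, Rel N a b → ∀ p s,
      wordLift F (freeWord p * (a - b) * freeWord s) = 0) :
    ∃ θ : Alg N →ₗ[ℚ] M, ∀ w, θ (wordProd N w) = F w := by
  -- the largest two-sided ideal on which the extension vanishes
  let I : TwoSidedIdeal Free := TwoSidedIdeal.mk'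
    {a | ∀ x y, wordLift F (x * a * y) = 0} (by simp)
    (fun ha hb x y => by rw [mul_add, add_mul, map_add, ha, hb, add_zero])
    (fun ha x y => by rw [mul_neg, neg_mul, map_neg, ha, neg_zero])
    (fun {z a} ha x y => by rw [← mul_assoc x]; exact ha (x * z) y)
    (fun {a z} ha x y => by
      have := ha x (z * y)
      rwa [← mul_assoc x, mul_assoc (x * a)])
  have hI : ∀ a, a ∈ I ↔ ∀ x y, wordLift F (x * a * y) = 0 := fun a =>
    TwoSidedIdeal.mem_mk' _ _ _ _ _ _ _
  have hrel : ∀ a b, Rel N a b → a - b ∈ I := by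
    intro a b hab
    rw [hI]
    intro x y
    have hx : x ∈ Submodule.span ℚ (Set.range freeWord) := by rw [span_freeWord]; trivial
    have hy : y ∈ Submodule.span ℚ (Set.range freeWord) := by rw [span_freeWord]; trivial
    induction hx using Submodule.span_induction with
    | zero => simp
    | add x x' _ _ hx hx' => rw [add_mul, add_mul, map_add, hx, hx', add_zero]
    | smul c x _ hx => rw [smul_mul_assoc, smul_mul_assoc, map_smul, hx, smul_zero]
    | mem x hx =>
      obtain ⟨p, rfl⟩ := hx
      induction hy using Submodule.span_induction with
      | zero => simp
      | add y y' _ _ hy hy' => rw [mul_add, map_add, hy, hy', add_zero]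
      | smul c y _ hy => rw [mul_smul_comm, map_smul, hy, smul_zero]
      | mem y hy =>
        obtain ⟨s, rfl⟩ := hy
        exact h a b hab p s
  have hker : ∀ a, RingQuot.mkAlgHom ℚ (Rel N) a = 0 → wordLift F a = 0 := by
    intro a ha
    have h1 : a ∈ I := by
      let g : Alg N →+* I.ringCon.Quotient := RingQuot.lift ⟨I.ringCon.mk', fun a b hab =>
        I.ringCon.eq.2 ((TwoSidedIdeal.rel_iff I a b).2 (hrel a b hab))⟩
      have h2 : g (RingQuot.mkRingHom (Rel N) a) = I.ringCon.mk' a :=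
        RingQuot.lift_mkRingHom_apply _ _ _
      have h3 : RingQuot.mkRingHom (Rel N) a = 0 := by
        rw [← RingQuot.mkAlgHom_coe ℚ (Rel N)]
        exact ha
      rw [h3, map_zero] at h2
      exact I.ringCon.eq.1 h2.symm
    simpa using (hI a).1 h1 1 1
  have hsurj := RingQuot.mkAlgHom_surjective ℚ (Rel N)
  let e := (RingQuot.mkAlgHom ℚ (Rel N)).toLinearMap.quotKerEquivOfSurjective hsurj
  refine ⟨((LinearMap.ker (RingQuot.mkAlgHom ℚ (Rel N)).toLinearMap).liftQ (wordLift F)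
    fun a ha => hker a (LinearMap.mem_ker.1 ha)) ∘ₗ e.symm.toLinearMap, fun w => ?_⟩
  have : e.symm (wordProd N w) = Submodule.Quotient.mk (freeWord w) := by
    rw [LinearEquiv.symm_apply_eq, ← mkAlgHom_freeWord]
    rfl
  rw [LinearMap.comp_apply, LinearEquiv.coe_coe, this]
  exact (Submodule.liftQ_apply _ _ _).trans (wordLift_freeWord F w)

lemma span_wordProd (N : ℕ∞) : Submodule.span ℚ (Set.range (wordProd N)) = ⊤ := by
  have h1 : Set.range (wordProd N) =
      (RingQuot.mkAlgHom ℚ (Rel N)).toLinearMap '' Set.range freeWord := by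
    rw [← Set.range_comp]
    congr 1
    funext w
    exact (mkAlgHom_freeWord N w).symm
  rw [h1, ← Submodule.map_span, span_freeWord, Submodule.map_top, LinearMap.range_eq_top]
  exact RingQuot.mkAlgHom_surjective ℚ (Rel N)

/-! ### The defining relations in terms of words in natural numbers -/

/-- The number of a generator. -/
def letter : Gen → ℕ
  | .x i => 2 * i
  | .mu i => 2 * i + 1

/-- The generator with a given number. -/
def ofLetter (n : ℕ) : Gen := if n % 2 = 0 then .x (n / 2) else .mu (n / 2)

@[simp] lemma ofLetter_letter (g : Gen) : ofLetter (letter g) = g := by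
  cases g with
  | x i => simp [letter, ofLetter]
  | mu i => simp [letter, ofLetter, Nat.add_mod, double_add_one_div]

@[simp] lemma letter_ofLetter (n : ℕ) : letter (ofLetter n) = n := by
  unfold ofLetter
  split_ifs <;> simp only [letter] <;> omega

/-- The combination of words in the free algebra with given combination of numbered words. -/
noncomputable def ofWords : Words →ₗ[ℚ] Free :=
  Finsupp.linearCombination ℚ fun w => freeWord (w.map ofLetter)

lemma ofWords_single (w : List ℕ) :
    ofWords (Finsupp.single w 1) = freeWord (w.map ofLetter) := by
  simp [ofWords]

lemma ofWords_pair (a b : ℕ) : ofWords (Finsupp.single [a, b] 1) =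
    FreeAlgebra.ι ℚ (ofLetter a) * FreeAlgebra.ι ℚ (ofLetter b) := by
  simp [ofWords_single, freeWord]

lemma ofWords_sandwich (p s : List ℕ) (f : Words) : ofWords (sandwich p s f) =
    freeWord (p.map ofLetter) * ofWords f * freeWord (s.map ofLetter) := by
  rw [apply_sandwich_eq_sum, linearMap_apply_eq_sum ofWords f, Finsupp.sum, Finsupp.sum,
    Finset.mul_sum, Finset.sum_mul]
  refine Finset.sum_congr rfl fun u _ => ?_
  simp only [ofWords_single, List.map_append, freeWord_append, mul_smul_comm, smul_mul_assoc]

lemma ofLetter_even (i : ℕ) : ofLetter (2 * i) = .x i := ofLetter_letter (.x i)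

lemma ofLetter_odd (i : ℕ) : ofLetter (2 * i + 1) = .mu i := ofLetter_letter (.mu i)

lemma coeff_sq (m : ℕ) : PowerSeries.coeff m (xz ^ 2) = ofWords (quad 1 0 0 m) := by
  simp only [sq, PowerSeries.coeff_mul, xz, PowerSeries.coeff_mk, quad, map_sum,
    ofWords_pair, add_zero, ofLetter_even, Pi.one_apply, one_smul, fx]

lemma coeff_prod (m : ℕ) : PowerSeries.coeff m (xz * muz) = ofWords (quad 1 0 1 m) := by
  simp only [PowerSeries.coeff_mul, xz, muz, PowerSeries.coeff_mk, quad, map_sum,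
    ofWords_pair, add_zero, ofLetter_even, ofLetter_odd, Pi.one_apply, one_smul, fx, fmu]

lemma natCast_add_one_mul (i : ℕ) (a : Free) : ((i : Free) + 1) * a = ((i : ℚ) + 1) • a := by
  rw [add_smul, one_smul, add_mul, one_mul, Nat.cast_smul_eq_nsmul, nsmul_eq_mul]

lemma coeff_odd (m : ℕ) : PowerSeries.coeff m (muz * ddz muz) =
    ofWords (quad (fun p => (p.2 : ℚ)) 1 1 (m + 1)) := by
  simp only [PowerSeries.coeff_mul, ddz, muz, PowerSeries.coeff_mk, quad, map_sum, map_smul,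
    ofWords_pair, ofLetter_odd, fmu]
  rw [Finset.Nat.sum_antidiagonal_succ']
  simp [natCast_add_one_mul]

lemma coeff_deriv (m : ℕ) : PowerSeries.coeff m (ddz (ddz xz) * muz - ddz xz * ddz muz) =
    ofWords (quad derivCoeff 0 1 (m + 2)) := by
  simp only [map_sub, PowerSeries.coeff_mul, ddz, xz, muz, PowerSeries.coeff_mk, quad, map_sum,
    map_smul, ofWords_pair, ofLetter_odd, ofLetter_even, add_zero, derivCoeff, sub_smul,
    Finset.sum_sub_distrib, fx, fmu]
  congr 1
  · rw [Finset.Nat.sum_antidiagonal_succ, Finset.Nat.sum_antidiagonal_succ]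
    simp only [CharP.cast_eq_zero, zero_mul, zero_smul, zero_add, zero_sub, Nat.cast_one, sub_self,
      mul_zero]
    refine Finset.sum_congr rfl fun p _ => ?_
    rw [natCast_add_one_mul, natCast_add_one_mul, smul_smul, smul_mul_assoc]
    congr 1
    push_cast
    ring
  · rw [Finset.Nat.sum_antidiagonal_succ, Finset.Nat.sum_antidiagonal_succ']
    simp only [CharP.cast_eq_zero, zero_mul, zero_smul, zero_add, mul_zero]
    refine Finset.sum_congr rfl fun p _ => ?_
    rw [natCast_add_one_mul, natCast_add_one_mul, smul_mul_smul_comm]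
    push_cast
    rfl

lemma rel_top_sub {a b : Free} (h : Rel ⊤ a b) : ∃ f, IsQuadRel f ∧ a - b = ofWords f := by
  cases h with
  | xx i j => exact ⟨_, .comm (2 * i) (2 * j), by
      simp [ofWords_pair, ofLetter_even, fx, sgn]⟩
  | xmu i j => exact ⟨_, .comm (2 * i) (2 * j + 1), by
      simp [ofWords_pair, ofLetter_even, ofLetter_odd, fx, fmu, sgn]⟩
  | mumu i j => exact ⟨_, .comm (2 * i + 1) (2 * j + 1), by
      simp [ofWords_pair, ofLetter_odd, fmu, sgn, Nat.add_mod]⟩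
  | xzero i h => simp at h
  | muzero i h => simp at h
  | sq m h => exact ⟨_, .sq m, by rw [sub_zero, coeff_sq]⟩
  | prod m h => exact ⟨_, .prod m, by rw [sub_zero, coeff_prod]⟩
  | deriv m h => exact ⟨_, .deriv (m + 2), by rw [sub_zero, coeff_deriv]⟩
  | odd m h => exact ⟨_, .odd (m + 1), by rw [sub_zero, coeff_odd]⟩

/-- The quadratic relations hold in the infinite algebra. -/
lemma mkAlgHom_ofWords {f : Words} (hf : f ∈ quadSpan) :
    RingQuot.mkAlgHom ℚ (Rel ⊤) (ofWords f) = 0 := by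
  have hrel : ∀ {a b : Free}, Rel ⊤ a b →
      RingQuot.mkAlgHom ℚ (Rel ⊤) a = RingQuot.mkAlgHom ℚ (Rel ⊤) b :=
    fun h => RingQuot.mkAlgHom_rel ℚ h
  have : quadSpan ≤ LinearMap.ker ((RingQuot.mkAlgHom ℚ (Rel ⊤)).toLinearMap ∘ₗ ofWords) := by
    refine Submodule.span_le.2 fun f hf => ?_
    rw [SetLike.mem_coe, LinearMap.mem_ker, LinearMap.comp_apply, AlgHom.toLinearMap_apply]
    cases hf with
    | comm a b =>
      obtain ⟨g, rfl⟩ : ∃ g, letter g = a := ⟨_, letter_ofLetter a⟩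
      obtain ⟨g', rfl⟩ : ∃ g, letter g = b := ⟨_, letter_ofLetter b⟩
      rw [map_sub, map_smul, ofWords_pair, ofWords_pair, ofLetter_letter, ofLetter_letter]
      cases g with
      | x i =>
        cases g' with
        | x j =>
          have := hrel (.xx i j)
          simp only [fx] at this
          simp [this, letter, sgn]
        | mu j =>
          have := hrel (.xmu i j)
          simp only [fx, fmu] at this
          simp [this, letter, sgn]
      | mu i =>
        cases g' with
        | x j =>
          have := hrel (.xmu j i)
          simp only [fx, fmu] at this
          simp [this, letter, sgn]
        | mu j =>
          have := hrel (.mumu i j)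
          simp only [fmu] at this
          simp [this, letter, sgn, Nat.add_mod]
    | sq m => rw [← coeff_sq, hrel (.sq m (ENat.natCast_lt_top m)), map_zero]
    | prod m => rw [← coeff_prod, hrel (.prod m (ENat.natCast_lt_top m)), map_zero]
    | deriv m =>
      match m with
      | 0 => simp [quad, derivCoeff]
      | 1 => simp [quad, derivCoeff, Finset.Nat.antidiagonal_succ]
      | m + 2 => rw [← coeff_deriv, hrel (.deriv m (ENat.natCast_lt_top m)), map_zero]
    | odd m =>
      match m with
      | 0 => simp [quad]
      | m + 1 => rw [← coeff_odd, hrel (.odd m (ENat.natCast_lt_top m)), map_zero]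
  exact this hf

/-! ### The normal words form a basis of the infinite algebra -/

/-- The words without adjacent letters that are not `Good`. -/
abbrev Normal (w : List ℕ) : Prop := Irred (fun a b => ¬ Good a b) w

lemma irred_pair {a b : ℕ} : Normal [a, b] ↔ Good a b := by
  constructor
  · intro h
    exact not_not.1 (h [] a b [] rfl)
  · intro h p d e s hw
    have hl := congrArg List.length hw
    simp only [List.length_append, List.length_cons, List.length_nil] at hl
    obtain rfl := List.length_eq_zero_iff.1 (show p.length = 0 by omega)
    obtain rfl := List.length_eq_zero_iff.1 (show s.length = 0 by omega)
    simp only [List.nil_append, List.append_nil, List.cons.injEq] at hw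
    obtain ⟨rfl, rfl, -⟩ := hw
    exact not_not.2 h

lemma good_of_large {a b N : ℕ} (ha : a ≤ N) (hb : N + 6 ≤ b) : Good a b := by
  left
  omega

section Resolution

variable {S : ℕ → ℕ → Words}

/-- A combination of normal words of length three on which all cubic functionals vanish is zero. -/
lemma eq_zero_of_cubicEval {g : Words} (hg : ∀ u ∈ g.support, Normal u ∧ u.length = 3)
    (h : ∀ φ ∈ cubicDual, cubicEval φ g = 0) : g = 0 := by
  by_contra hne
  obtain ⟨u, hu⟩ := Finsupp.support_nonempty_iff.2 hne
  obtain ⟨hu1, hu2⟩ := hg u hu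
  match u, hu2 with
  | [a, b, c], _ =>
    obtain ⟨φ, hφ, hval⟩ := exists_dual (irred_triple.1 hu1)
    have h1 := h φ hφ
    rw [cubicEval, Finsupp.linearCombination_apply, Finsupp.sum,
      Finset.sum_eq_single_of_mem _ hu] at h1
    · rw [cubicVal, hval a b c (irred_triple.1 hu1), if_pos rfl, smul_eq_mul, mul_one] at h1
      exact Finsupp.mem_support_iff.1 hu h1
    · intro v hv hvu
      obtain ⟨hv1, hv2⟩ := hg v hv
      match v, hv2 with
      | [a', b', c'], _ =>
        rw [cubicVal, hval a' b' c' (irred_triple.1 hv1), if_neg, smul_zero]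
        rintro heq
        simp only [Prod.mk.injEq] at heq
        obtain ⟨rfl, rfl, rfl⟩ := heq
        exact hvu rfl

/-- The overlaps of the rewriting rules resolve: the reduction of the difference of the two
results is a combination of normal words killed by all cubic functionals. -/
lemma overlap_mem_span (hS : ∀ a b, ¬ Good a b → (∀ u ∈ (S a b).support, Lower u [a, b]) ∧
    Finsupp.single [a, b] (1 : ℚ) - S a b ∈ quadSpan) {a b c : ℕ} (hab : ¬ Good a b)
    (hbc : ¬ Good b c) : sandwich [] [c] (S a b) - sandwich [a] [] (S b c) ∈
      Submodule.span ℚ (ruleSet (fun a b => ¬ Good a b) S fun u => Lower u [a, b, c]) := by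
  have hlow : ∀ u ∈ (sandwich [] [c] (S a b) - sandwich [a] [] (S b c)).support,
      Lower u [a, b, c] := by
    classical
    intro u hu
    obtain h | h := Finset.mem_union.1 (Finsupp.support_sub hu)
    · obtain ⟨v, hv, rfl⟩ := exists_of_mem_support_sandwich h
      exact ((hS a b hab).1 v hv).append [] [c]
    · obtain ⟨v, hv, rfl⟩ := exists_of_mem_support_sandwich h
      exact ((hS b c hbc).1 v hv).append [a] []
  obtain ⟨g, hg, hvg⟩ := exists_reduction lower_wf (fun p s u v h => h.append p s)
    (fun a b hab => (hS a b hab).1) (fun u => Lower u [a, b, c])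
    (fun u v huv hv => huv.trans hv) _ hlow
  have hg0 : g = 0 := by
    refine eq_zero_of_cubicEval (fun u hu => ⟨(hg u hu).1, (hg u hu).2.1⟩) fun φ hφ => ?_
    have h1 := cubicEval_eq_zero_of_mem_span hφ (fun a b hab => (hS a b hab).2)
      (fun u hu => hu.1) hvg
    have h2 := cubicEval_sandwich hφ (hS a b hab).2 (p := []) (s := [c]) rfl
    have h3 := cubicEval_sandwich hφ (hS b c hbc).2 (p := [a]) (s := []) rfl
    simp only [map_sub, sandwich_single, List.nil_append, List.append_nil, List.cons_append]
      at h1 h2 h3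
    linarith
  rwa [hg0, sub_zero] at hvg

lemma length_of_mem_support_quadSpan {f : Words} (hf : f ∈ quadSpan) :
    ∀ u ∈ f.support, u.length = 2 := by
  have : quadSpan ≤ Finsupp.supported ℚ ℚ {u : List ℕ | u.length = 2} := by
    have hs : ∀ a b, Finsupp.single [a, b] (1 : ℚ) ∈
        Finsupp.supported ℚ ℚ {u : List ℕ | u.length = 2} :=
      fun a b => Finsupp.single_mem_supported ℚ _ rfl
    have hq : ∀ w ε₁ ε₂ m, quad w ε₁ ε₂ m ∈
        Finsupp.supported ℚ ℚ {u : List ℕ | u.length = 2} :=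
      fun w ε₁ ε₂ m => Submodule.sum_mem _ fun p _ => Submodule.smul_mem _ _ (hs _ _)
    refine Submodule.span_le.2 fun f hf => ?_
    cases hf with
    | comm a b => exact Submodule.sub_mem _ (hs a b) (Submodule.smul_mem _ _ (hs b a))
    | sq m => exact hq _ _ _ _
    | prod m => exact hq _ _ _ _
    | deriv m => exact hq _ _ _ _
    | odd m => exact hq _ _ _ _
  exact fun u hu => (Finsupp.mem_supported ℚ f).1 (this hf) hu

/-- The quadratic relations are spanned by the rewriting rules: otherwise a combination of normal
words of length two would vanish, and appending a large letter would yield one of length three. -/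
lemma quadSpan_le_span (hS : ∀ a b, ¬ Good a b → (∀ u ∈ (S a b).support, Lower u [a, b]) ∧
    Finsupp.single [a, b] (1 : ℚ) - S a b ∈ quadSpan) :
    quadSpan ≤ Submodule.span ℚ (ruleSet (fun a b => ¬ Good a b) S fun u => u.length = 2) := by
  intro f hf
  obtain ⟨g, hg, hfg⟩ := exists_reduction lower_wf (fun p s u v h => h.append p s)
    (fun a b hab => (hS a b hab).1) (fun u => u.length = 2)
    (fun u v huv hv => huv.1.trans hv) f (length_of_mem_support_quadSpan hf)
  have hspan : Submodule.span ℚ (ruleSet (fun a b => ¬ Good a b) S fun u => u.length = 2) ≤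
      quadSpan := by
    refine Submodule.span_le.2 ?_
    rintro _ ⟨p, a, b, s, hab, hl, rfl⟩
    simp only [List.length_append, List.length_cons, List.length_nil] at hl
    obtain rfl := List.length_eq_zero_iff.1 (show p.length = 0 by omega)
    obtain rfl := List.length_eq_zero_iff.1 (show s.length = 0 by omega)
    have hid : ∀ f : Words, sandwich [] [] f = f := fun f => by
      induction f using Finsupp.induction_linear with
      | zero => simp
      | add f g hf hg => rw [map_add, hf, hg]
      | single u c => simp
    simpa only [SetLike.mem_coe, hid] using (hS a b hab).2
  have hgq : g ∈ quadSpan := by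
    have := quadSpan.sub_mem hf (hspan hfg)
    rwa [sub_sub_cancel] at this
  have hg0 : g = 0 := by
    set N := g.support.sup List.sum with hN
    have h1 : sandwich [] [N + 6] g = 0 := by
      refine eq_zero_of_cubicEval (fun u hu => ?_) fun φ hφ =>
        cubicEval_sandwich hφ hgq rfl
      obtain ⟨v, hv, rfl⟩ := exists_of_mem_support_sandwich hu
      obtain ⟨hv1, hv2⟩ := hg v hv
      have hle : v.sum ≤ N := Finset.le_sup (f := List.sum) hv
      match v, hv2 with
      | [a, b], _ =>
        refine ⟨irred_triple.2 ⟨irred_pair.1 hv1, good_of_large (N := N) ?_ le_rfl⟩, rfl⟩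
        simp only [List.sum_cons, List.sum_nil] at hle
        omega
    refine Finsupp.mapDomain_injective (f := fun u => [] ++ u ++ [N + 6]) ?_
      (h1.trans (map_zero (sandwich [] [N + 6])).symm)
    intro u v huv
    simpa using huv
  rwa [hg0, sub_zero] at hfg

end Resolution

/-- The normal form of a combination of words modulo the ideal of the quadratic relations. -/
theorem exists_wordNormalForm : ∃ NF : Words →ₗ[ℚ] Words,
    (∀ w, Normal w → NF (Finsupp.single w 1) = Finsupp.single w 1) ∧
      ∀ p s, ∀ f ∈ quadSpan, NF (sandwich p s f) = 0 := by
  obtain ⟨S, hS⟩ := exists_rules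
  obtain ⟨NF, h1, h2, -⟩ := exists_normalForm_map lower_wf (fun p s u v h => h.append p s)
    (fun a b hab => (hS a b hab).1) (fun a b c => overlap_mem_span hS)
  refine ⟨NF, h1, fun p s f hf => h2 _ ?_⟩
  have hle : quadSpan ≤ (Submodule.span ℚ (ruleSet (fun a b => ¬ Good a b) S fun _ => True)).comap
      (sandwich p s) := by
    refine (quadSpan_le_span hS).trans (Submodule.span_le.2 ?_)
    rintro _ ⟨p', a, b, s', hab, -, rfl⟩
    rw [SetLike.mem_coe, Submodule.mem_comap, sandwich_sandwich]
    exact Submodule.subset_span ⟨_, a, b, _, hab, trivial, rfl⟩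
  exact hle hf

lemma wordLift_ofWords {M : Type*} [AddCommGroup M] [Module ℚ M] (L : Words →ₗ[ℚ] M)
    (f : Words) : wordLift (fun w => L (Finsupp.single (w.map letter) 1)) (ofWords f) = L f := by
  rw [linearMap_apply_eq_sum L f, linearMap_apply_eq_sum ofWords f, Finsupp.sum, map_sum,
    Finsupp.sum]
  refine Finset.sum_congr rfl fun u _ => ?_
  rw [map_smul, ofWords_single, wordLift_freeWord, List.map_map]
  congr 3
  simp [Function.comp_def]

lemma linearIndependent_normal : LinearIndependent ℚ
    (fun w : {w : List ℕ // Normal w} => wordProd ⊤ (w.1.map ofLetter)) := by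
  obtain ⟨NF, h1, h2⟩ := exists_wordNormalForm
  obtain ⟨θ, hθ⟩ := exists_linearMap_of_words (N := ⊤)
    (fun w => NF (Finsupp.single (w.map letter) 1)) (by
      intro a b hab p s
      obtain ⟨f, hf, hf'⟩ := rel_top_sub hab
      have hps : freeWord p * (a - b) * freeWord s =
          ofWords (sandwich (p.map letter) (s.map letter) f) := by
        simp [hf', ofWords_sandwich, Function.comp_def]
      rw [hps, wordLift_ofWords, h2 _ _ _ (Submodule.subset_span hf)])
  refine LinearIndependent.of_comp θ ?_
  have : (θ ∘ fun w : {w : List ℕ // Normal w} => wordProd ⊤ (w.1.map ofLetter)) =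
      fun w : {w : List ℕ // Normal w} => Finsupp.single w.1 1 := by
    funext w
    simp only [Function.comp_apply, hθ, List.map_map]
    rw [← h1 w.1 w.2]
    congr 2
    simp [Function.comp_def]
  rw [this]
  exact (Finsupp.basisSingleOne (R := ℚ) (ι := List ℕ)).linearIndependent.comp _
    Subtype.val_injective

lemma span_normal : Submodule.span ℚ (Set.range
    fun w : {w : List ℕ // Normal w} => wordProd ⊤ (w.1.map ofLetter)) = ⊤ := by
  obtain ⟨S, hS⟩ := exists_rules
  rw [eq_top_iff, ← span_wordProd, Submodule.span_le]
  rintro _ ⟨w, rfl⟩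
  obtain ⟨g, hg, hfg⟩ := exists_reduction lower_wf (fun p s u v h => h.append p s)
    (fun a b hab => (hS a b hab).1) (fun _ => True) (fun _ _ _ _ => trivial)
    (Finsupp.single (w.map letter) 1) (fun _ _ => trivial)
  let π : Words →ₗ[ℚ] Alg ⊤ := (RingQuot.mkAlgHom ℚ (Rel ⊤)).toLinearMap ∘ₗ ofWords
  have hπ : ∀ u, π (Finsupp.single u 1) = wordProd ⊤ (u.map ofLetter) := by
    intro u
    simp only [π, LinearMap.comp_apply, ofWords_single]
    exact mkAlgHom_freeWord ⊤ _
  have hker : Submodule.span ℚ (ruleSet (fun a b => ¬ Good a b) S fun _ => True) ≤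
      LinearMap.ker π := by
    refine Submodule.span_le.2 ?_
    rintro _ ⟨p, a, b, s, hab, -, rfl⟩
    rw [SetLike.mem_coe, LinearMap.mem_ker, LinearMap.comp_apply, ofWords_sandwich,
      AlgHom.toLinearMap_apply, map_mul, map_mul, mkAlgHom_ofWords (hS a b hab).2, mul_zero,
      zero_mul]
  have h1 : wordProd ⊤ w = π g := by
    have := hker hfg
    rw [LinearMap.mem_ker, map_sub, sub_eq_zero, hπ] at this
    simpa [Function.comp_def] using this
  rw [SetLike.mem_coe, h1, linearMap_apply_eq_sum π g]
  refine Submodule.sum_mem _ fun u hu => Submodule.smul_mem _ _ (Submodule.subset_span ?_)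
  exact ⟨⟨u, (hg u hu).1⟩, (hπ u).symm⟩

/-! ### Normal words and admissible sequences -/

lemma Good.trans {a b c : ℕ} (h : Good a b) (h' : Good b c) : Good a c := by
  unfold Good at *
  omega

instance : IsTrans ℕ Good := ⟨fun _ _ _ => Good.trans⟩

lemma Good.lt {a b : ℕ} (h : Good a b) : a < b := by
  unfold Good at h
  omega

lemma normal_iff_pairwise {w : List ℕ} : Normal w ↔ w.Pairwise Good := by
  rw [← List.isChain_iff_pairwise, List.isChain_iff_forall_rel_of_append_cons_cons]
  constructor
  · intro h a b l₁ l₂ hw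
    exact not_not.1 (h l₁ a b l₂ (by simpa using hw))
  · intro h p a b s hw
    exact not_not.2 (h (l₁ := p) (l₂ := s) (by simpa using hw))

/-- The word of the blocks of a sequence. -/
def seqWord (S : Finset ℕ) : List Gen :=
  ((blockStarts S).sort (· ≤ ·)).flatMap (blockWord S)

lemma mem_blockStarts {S : Finset ℕ} {i : ℕ} :
    i ∈ blockStarts S ↔ i ∈ S ∧ (i = 0 ∨ i - 1 ∉ S) := by
  rw [blockStarts, Finset.mem_filter, and_congr_right_iff]
  intro hi
  constructor
  · intro h
    by_contra! hc
    exact h (i - 1) hc.2 (by omega)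
  · rintro h j hj rfl
    rcases h with h | h
    · omega
    · exact h (by simpa using hj)

lemma letters_blockWord (S : Finset ℕ) (i : ℕ) : (blockWord S i).map letter =
    if i + 1 ∉ S then [2 * i] else if i + 2 ∉ S then [2 * i + 1] else [0, 3] := by
  unfold blockWord
  split_ifs <;> simp [letter]

lemma mem_letters_seqWord {S : Finset ℕ} {n : ℕ} : n ∈ (seqWord S).map letter ↔
    ∃ i, i ∈ S ∧ (i = 0 ∨ i - 1 ∉ S) ∧ (i + 1 ∉ S ∧ n = 2 * i ∨
      i + 1 ∈ S ∧ i + 2 ∉ S ∧ n = 2 * i + 1 ∨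
      i + 1 ∈ S ∧ i + 2 ∈ S ∧ (n = 0 ∨ n = 3)) := by
  rw [seqWord, List.map_flatMap, List.mem_flatMap]
  refine exists_congr fun i => ?_
  rw [Finset.mem_sort, mem_blockStarts, letters_blockWord, and_assoc]
  refine and_congr_right fun _ => and_congr_right fun _ => ?_
  split_ifs <;> simp_all

lemma normal_seqWord {S : Finset ℕ} (hS : Admissible S) : Normal ((seqWord S).map letter) := by
  rw [normal_iff_pairwise, seqWord, List.map_flatMap, List.pairwise_flatMap]
  constructor
  · intro i _
    rw [letters_blockWord]
    split_ifs <;> simp [Good]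
  · refine (Finset.sortedLT_sort (blockStarts S)).pairwise.imp_of_mem ?_
    intro i j hi hj hij x hx y hy
    rw [Finset.mem_sort, mem_blockStarts] at hi hj
    obtain ⟨hi, hi'⟩ := hi
    obtain ⟨hj, hj'⟩ := hj
    have hj' : j - 1 ∉ S := hj'.resolve_left (by omega)
    have h1 : j ≠ i + 1 := by
      rintro rfl
      exact hj' hi
    have h3 : ¬ (j + 1 ∈ S ∧ j + 2 ∈ S) := fun h => by
      have := hS.2 j hj h.1 h.2
      omega
    rw [letters_blockWord] at hx hy
    have hy : y = 2 * j ∨ y = 2 * j + 1 := by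
      by_cases h4 : j + 1 ∈ S
      · have h5 : j + 2 ∉ S := fun h5 => h3 ⟨h4, h5⟩
        rw [if_neg (not_not.2 h4), if_pos h5, List.mem_singleton] at hy
        exact Or.inr hy
      · rw [if_pos h4, List.mem_singleton] at hy
        exact Or.inl hy
    unfold Good
    by_cases h4 : i + 1 ∈ S
    · have h6 : j ≠ i + 2 := by
        rintro rfl
        exact hj' (by simpa using h4)
      rw [if_neg (not_not.2 h4)] at hx
      by_cases h5 : i + 2 ∈ S
      · rw [if_neg (not_not.2 h5)] at hx
        obtain rfl := hS.2 i hi h4 h5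
        have h7 : j ≠ 3 := by
          rintro rfl
          exact hj' h5
        simp only [List.mem_cons, List.not_mem_nil, or_false] at hx
        omega
      · rw [if_pos h5, List.mem_singleton] at hx
        omega
    · rw [if_pos h4, List.mem_singleton] at hx
      omega

/-- The positions of the ones are determined by the letters of the word. -/
lemma mem_iff_letters {S : Finset ℕ} (hS : Admissible S) (k : ℕ) :
    k ∈ S ↔ 2 * k ∈ (seqWord S).map letter ∨ 2 * k + 1 ∈ (seqWord S).map letter ∨
      (k ≠ 0 ∧ 2 * (k - 1) + 1 ∈ (seqWord S).map letter) := by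
  simp only [mem_letters_seqWord]
  constructor
  · intro hk
    by_cases h1 : k = 0 ∨ k - 1 ∉ S
    · by_cases h2 : k + 1 ∈ S
      · by_cases h3 : k + 2 ∈ S
        · obtain rfl := hS.2 k hk h2 h3
          exact Or.inl ⟨0, hk, Or.inl rfl, by simp_all⟩
        · exact Or.inr (Or.inl ⟨k, hk, h1, by simp_all⟩)
      · exact Or.inl ⟨k, hk, h1, by simp_all⟩
    · push Not at h1
      obtain ⟨j, rfl⟩ : ∃ j, k = j + 1 := ⟨k - 1, by omega⟩
      simp only [Nat.add_sub_cancel] at h1 ⊢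
      have hj := h1.2
      by_cases h3 : j + 2 ∈ S
      · obtain rfl := hS.2 j hj hk h3
        exact Or.inr (Or.inl ⟨0, hj, Or.inl rfl, Or.inr (Or.inr ⟨hk, h3, by omega⟩)⟩)
      · by_cases h2 : j = 0 ∨ j - 1 ∉ S
        · exact Or.inr (Or.inr ⟨by omega, j, hj, h2, by simp_all⟩)
        · push Not at h2
          have := hS.2 (j - 1) h2.2 (by rwa [Nat.sub_add_cancel (by omega)])
            (by rwa [show j - 1 + 2 = j + 1 by omega])
          obtain rfl : j = 1 := by omega
          exact Or.inr (Or.inr ⟨by omega, 0, h2.2, Or.inl rfl,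
            Or.inr (Or.inr ⟨hj, hk, by omega⟩)⟩)
  · have hmem : ∀ j ∈ S, j = k → k ∈ S := fun j hj h => h ▸ hj
    rintro (⟨i, hi, -, h⟩ | ⟨i, hi, -, h⟩ | ⟨hk, i, hi, -, h⟩) <;>
    obtain ⟨h1, h⟩ | ⟨h1, h2, h⟩ | ⟨h1, h2, h⟩ := h
    · exact hmem i hi (by omega)
    · omega
    · exact hmem i hi (by have := hS.2 i hi h1 h2; omega)
    · omega
    · exact hmem i hi (by omega)
    · exact hmem (i + 1) h1 (by have := hS.2 i hi h1 h2; omega)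
    · omega
    · exact hmem (i + 1) h1 (by omega)
    · exact hmem (i + 2) h2 (by have := hS.2 i hi h1 h2; omega)

/-- A normal word is the word of a sequence: the letters `2 i` and `2 i + 1` are the blocks `1` and
`11` at position `i`, except that `0` followed by `3` is an initial block `111`. -/
lemma exists_seqWord_eq {w : List ℕ} (hw : Normal w) :
    ∃ S, Admissible S ∧ (seqWord S).map letter = w := by
  have hp := normal_iff_pairwise.1 hw
  have gap : ∀ a ∈ w, ∀ b ∈ w, a = b ∨ Good a b ∨ Good b a := fun a ha b hb =>
    haveI : Std.Symm fun a b => a = b ∨ Good a b ∨ Good b a := ⟨fun a b h => by tauto⟩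
    (hp.imp fun h => Or.inr (Or.inl h)).forall_of_forall
      (R := fun a b => a = b ∨ Good a b ∨ Good b a) (fun a _ => Or.inl rfl) ha hb
  let S : Finset ℕ := w.toFinset.biUnion fun n =>
    if n % 2 = 0 then {n / 2} else {n / 2, n / 2 + 1}
  have hS : ∀ k, k ∈ S ↔ ∃ n ∈ w, n / 2 = k ∨ n % 2 = 1 ∧ n / 2 + 1 = k := by
    intro k
    simp only [S, Finset.mem_biUnion, List.mem_toFinset]
    refine exists_congr fun n => and_congr_right fun _ => ?_
    split_ifs with h
    · simp only [Finset.mem_singleton]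
      omega
    · simp only [Finset.mem_insert, Finset.mem_singleton]
      omega
  have hadm : Admissible S := by
    have h2 : ∀ i ∈ S, i + 1 ∈ S → i + 2 ∈ S → i = 0 := by
      intro i h0 h1 h2
      obtain ⟨a, ha, ha'⟩ := (hS _).1 h0
      obtain ⟨b, hb, hb'⟩ := (hS _).1 h1
      obtain ⟨c, hc, hc'⟩ := (hS _).1 h2
      have h3 := gap a ha b hb
      have h4 := gap a ha c hc
      have h5 := gap b hb c hc
      unfold Good at h3 h4 h5
      omega
    refine ⟨fun i h0 ⟨h1, h3, h4⟩ => ?_, h2⟩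
    have := h2 (i + 1) h1 h3 h4
    omega
  refine ⟨S, hadm, ?_⟩
  refine ((normal_iff_pairwise.1 (normal_seqWord hadm)).imp Good.lt).eq_of_mem_iff
    (hp.imp Good.lt) fun n => ?_
  rw [mem_letters_seqWord]
  have hmem : ∀ a ∈ w, a = n → n ∈ w := fun a ha h => h ▸ ha
  constructor
  · rintro ⟨i, hi, hi', ⟨h1, hn⟩ | ⟨h1, h2, hn⟩ | ⟨h1, h2, hn⟩⟩
    · obtain ⟨a, ha, ha'⟩ := (hS _).1 hi
      have h3 : ¬ (a % 2 = 1 ∧ a / 2 + 1 = i + 1) := fun h => h1 ((hS _).2 ⟨a, ha, Or.inr h⟩)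
      have h4 : i = 0 ∨ a / 2 ≠ i - 1 := hi'.imp_right fun h h' => h ((hS _).2 ⟨a, ha, Or.inl h'⟩)
      exact hmem a ha (by omega)
    · obtain ⟨a, ha, ha'⟩ := (hS _).1 hi
      obtain ⟨b, hb, hb'⟩ := (hS _).1 h1
      have h4 : i = 0 ∨ a / 2 ≠ i - 1 := hi'.imp_right fun h h' => h ((hS _).2 ⟨a, ha, Or.inl h'⟩)
      have h3 : ¬ (b % 2 = 1 ∧ b / 2 + 1 = i + 2) := fun h => h2 ((hS _).2 ⟨b, hb, Or.inr h⟩)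
      have h5 := gap a ha b hb
      unfold Good at h5
      obtain h | h : a = n ∨ b = n := by omega
      · exact hmem a ha h
      · exact hmem b hb h
    · obtain rfl := hadm.2 i hi h1 h2
      obtain ⟨a, ha, ha'⟩ := (hS _).1 hi
      obtain ⟨b, hb, hb'⟩ := (hS _).1 h1
      obtain ⟨c, hc, hc'⟩ := (hS _).1 h2
      have h3 := gap a ha b hb
      have h4 := gap a ha c hc
      have h5 := gap b hb c hc
      unfold Good at h3 h4 h5
      obtain h | h : a = n ∨ c = n := by omega
      · exact hmem a ha h
      · exact hmem c hc h
  · intro hn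
    have hmemS : ∀ k, (n / 2 = k ∨ n % 2 = 1 ∧ n / 2 + 1 = k) → k ∈ S :=
      fun k h => (hS k).2 ⟨n, hn, h⟩
    -- the letters `0` and `3` of an initial block `111`
    by_cases h03 : (n = 0 ∨ n = 3) ∧ 0 ∈ w ∧ 3 ∈ w
    · exact ⟨0, (hS 0).2 ⟨0, h03.2.1, by simp⟩, Or.inl rfl, Or.inr (Or.inr
        ⟨(hS 1).2 ⟨3, h03.2.2, by simp⟩, (hS 2).2 ⟨3, h03.2.2, by simp⟩, h03.1⟩)⟩
    have hno : ¬ (n = 0 ∧ 3 ∈ w) ∧ ¬ (n = 3 ∧ 0 ∈ w) :=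
      ⟨fun h => h03 ⟨Or.inl h.1, h.1 ▸ hn, h.2⟩, fun h => h03 ⟨Or.inr h.1, h.2, h.1 ▸ hn⟩⟩
    have hgap : ∀ b ∈ w, b = n ∨ b + 4 + b % 2 + n % 2 ≤ n ∨ n + 4 + n % 2 + b % 2 ≤ b := by
      intro b hb
      have h1 := gap b hb n hn
      have h2 : ¬ (n = 0 ∧ b = 3) := fun h => hno.1 ⟨h.1, h.2 ▸ hb⟩
      have h3 : ¬ (n = 3 ∧ b = 0) := fun h => hno.2 ⟨h.1, h.2 ▸ hb⟩
      unfold Good at h1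
      omega
    refine ⟨n / 2, hmemS _ (Or.inl rfl), ?_, ?_⟩
    · by_contra! h
      obtain ⟨b, hb, hb'⟩ := (hS _).1 h.2
      have := hgap b hb
      omega
    · obtain hpar | hpar := Nat.mod_two_eq_zero_or_one n
      · refine Or.inl ⟨fun h => ?_, by omega⟩
        obtain ⟨b, hb, hb'⟩ := (hS _).1 h
        have := hgap b hb
        omega
      · refine Or.inr (Or.inl ⟨hmemS _ (Or.inr ⟨hpar, rfl⟩), fun h => ?_, by omega⟩)
        obtain ⟨b, hb, hb'⟩ := (hS _).1 h
        have := hgap b hb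
        omega

lemma seqWord_injective {S T : Finset ℕ} (hS : Admissible S) (hT : Admissible T)
    (h : seqWord S = seqWord T) : S = T := by
  ext k
  rw [mem_iff_letters hS, mem_iff_letters hT, h]

/-- The admissible sequences correspond to the normal words. -/
noncomputable def seqEquiv : {S : Finset ℕ // Admissible S} ≃ {w : List ℕ // Normal w} :=
  Equiv.ofBijective (fun S => ⟨(seqWord S.1).map letter, normal_seqWord S.2⟩) <| by
    constructor
    · intro S T h
      have h1 := congrArg (List.map ofLetter) (congrArg Subtype.val h)
      simp only [List.map_map, Function.comp_def, ofLetter_letter, List.map_id'] at h1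
      exact Subtype.ext (seqWord_injective S.2 T.2 h1)
    · rintro ⟨w, hw⟩
      obtain ⟨S, hS, h⟩ := exists_seqWord_eq hw
      exact ⟨⟨S, hS⟩, Subtype.ext h⟩

lemma seqMonomial_eq (S : {S : Finset ℕ // Admissible S}) :
    seqMonomial S.1 = wordProd ⊤ ((seqEquiv S).1.map ofLetter) := by
  simp [seqEquiv, seqMonomial, seqWord, Function.comp_def]

theorem linearIndependent_seqMonomial : LinearIndependent ℚ
    (fun S : {S : Finset ℕ // Admissible S} => seqMonomial S.1) := by
  simp only [seqMonomial_eq]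
  exact linearIndependent_normal.comp _ seqEquiv.injective

theorem span_seqMonomial : Submodule.span ℚ (Set.range
    fun S : {S : Finset ℕ // Admissible S} => seqMonomial S.1) = ⊤ := by
  simp only [seqMonomial_eq]
  rw [← span_normal]
  congr 1
  exact seqEquiv.surjective.range_comp
    fun w : {w : List ℕ // Normal w} => wordProd ⊤ (w.1.map ofLetter)

/-- The bidegree of a word. -/
def deg (w : List Gen) : ℕ × ℕ := (w.map Gen.bideg).sum

lemma deg_append (u v : List Gen) : deg (u ++ v) = deg u + deg v := by
  simp [deg]

lemma blockWeight_eq (S : Finset ℕ) (i : ℕ) :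
    blockWeight S i = q ^ (deg (blockWord S i)).1 * t ^ (deg (blockWord S i)).2 := by
  unfold blockWeight blockWord
  split_ifs <;> simp [deg, Gen.bideg]

theorem weight_eq (S : Finset ℕ) :
    weight S = q ^ (deg (seqWord S)).1 * t ^ (deg (seqWord S)).2 := by
  have key : ∀ l : List ℕ, (l.map (blockWeight S)).prod =
      q ^ (deg (l.flatMap (blockWord S))).1 * t ^ (deg (l.flatMap (blockWord S))).2 := by
    intro l
    induction l with
    | nil => simp [deg]
    | cons i l ih =>
      rw [List.map_cons, List.prod_cons, List.flatMap_cons, deg_append, ih, blockWeight_eq]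
      simp only [Prod.fst_add, Prod.snd_add, pow_add]
      ring
  rw [weight, seqWord, ← key, ← List.prod_toFinset _ (Finset.sort_nodup _ _), Finset.sort_toFinset]

/-! ### The grading -/

/-- The combinations of words of bidegree `e` in the free algebra. -/
def homog (e : ℕ × ℕ) : Submodule ℚ Free := Submodule.span ℚ {a | ∃ w, deg w = e ∧ a = freeWord w}

lemma freeWord_mem_homog {w : List Gen} {e : ℕ × ℕ} (h : deg w = e) : freeWord w ∈ homog e :=
  Submodule.subset_span ⟨w, h, rfl⟩

lemma mul_mem_homog {g h : Gen} {e : ℕ × ℕ} (he : g.bideg + h.bideg = e) :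
    FreeAlgebra.ι ℚ g * FreeAlgebra.ι ℚ h ∈ homog e := by
  simpa [freeWord] using freeWord_mem_homog (w := [g, h]) (by simpa [deg] using he)

lemma ofWords_quad_mem_homog (w : ℕ × ℕ → ℚ) {ε₁ ε₂ : ℕ} (h₁ : ε₁ < 2) (h₂ : ε₂ < 2) (m : ℕ) :
    ofWords (quad w ε₁ ε₂ m) ∈
      homog (2 * m + 4 + 6 * (ε₁ + ε₂), 2 * m + 3 * (ε₁ + ε₂)) := by
  simp only [quad, map_sum, map_smul, ofWords_pair]
  refine Submodule.sum_mem _ fun p hp => Submodule.smul_mem _ _ (mul_mem_homog ?_)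
  rw [Finset.HasAntidiagonal.mem_antidiagonal] at hp
  interval_cases ε₁ <;> interval_cases ε₂ <;>
    simp only [add_zero, ofLetter_even, ofLetter_odd, Gen.bideg, Prod.mk_add_mk, Prod.mk.injEq] <;>
    omega

/-- The relations are homogeneous, and a relation whose degree in `t` is less than the levels `N`
and `N'` is present at level `N'` when it is at level `N`. -/
lemma Rel.exists_degree {N : ℕ∞} {a b : Free} (h : Rel N a b) :
    ∃ e, a ∈ homog e ∧ b ∈ homog e ∧
      ∀ N' : ℕ∞, (e.2 : ℕ∞) < N → (e.2 : ℕ∞) < N' → Rel N' a b := by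
  have lt : ∀ {m n : ℕ} {N' : ℕ∞}, m ≤ n → (n : ℕ∞) < N' → (m : ℕ∞) < N' :=
    fun h h' => lt_of_le_of_lt (by exact_mod_cast h) h'
  cases h with
  | xx i j => exact ⟨_, mul_mem_homog rfl, mul_mem_homog (add_comm _ _), fun N' _ _ => .xx i j⟩
  | xmu i j => exact ⟨_, mul_mem_homog rfl, mul_mem_homog (add_comm _ _), fun N' _ _ => .xmu i j⟩
  | mumu i j =>
    exact ⟨_, mul_mem_homog rfl, Submodule.neg_mem _ (mul_mem_homog (add_comm _ _)),
      fun N' _ _ => .mumu i j⟩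
  | xzero i h =>
    refine ⟨_, by simpa [freeWord] using! freeWord_mem_homog (w := [.x i]) rfl,
      Submodule.zero_mem _, fun N' h' _ => absurd (lt (m := i) ?_ h') (not_lt.2 h)⟩
    simp [deg, Gen.bideg]
    omega
  | muzero i h =>
    refine ⟨_, by simpa [freeWord] using! freeWord_mem_homog (w := [.mu i]) rfl,
      Submodule.zero_mem _, fun N' h' _ => absurd (lt (m := i + 1) ?_ h') (not_lt.2 h)⟩
    simp [deg, Gen.bideg]
    omega
  | sq m h =>
    exact ⟨_, by rw [coeff_sq]; exact ofWords_quad_mem_homog _ (by norm_num) (by norm_num) _,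
      Submodule.zero_mem _, fun N' _ h' => .sq m (lt (by dsimp only; omega) h')⟩
  | prod m h =>
    exact ⟨_, by rw [coeff_prod]; exact ofWords_quad_mem_homog _ (by norm_num) (by norm_num) _,
      Submodule.zero_mem _, fun N' _ h' => .prod m (lt (by dsimp only; omega) h')⟩
  | deriv m h =>
    exact ⟨_, by rw [coeff_deriv]; exact ofWords_quad_mem_homog _ (by norm_num) (by norm_num) _,
      Submodule.zero_mem _, fun N' _ h' => .deriv m (lt (by dsimp only; omega) h')⟩
  | odd m h =>
    exact ⟨_, by rw [coeff_odd]; exact ofWords_quad_mem_homog _ (by norm_num) (by norm_num) _,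
      Submodule.zero_mem _, fun N' _ h' => .odd m (lt (by dsimp only; omega) h')⟩

lemma wordLift_mul_mul {N' : ℕ∞} (d : ℕ × ℕ) {e : ℕ × ℕ} {a : Free} (ha : a ∈ homog e)
    (p s : List Gen) :
    wordLift (fun w => if deg w = d then wordProd N' w else 0) (freeWord p * a * freeWord s) =
      if deg p + e + deg s = d then
        wordProd N' p * RingQuot.mkAlgHom ℚ (Rel N') a * wordProd N' s else 0 := by
  induction ha using Submodule.span_induction with
  | zero => simp
  | add x y _ _ hx hy =>
    rw [mul_add, add_mul, map_add, hx, hy]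
    split_ifs
    · rw [map_add, mul_add, add_mul]
    · rw [add_zero]
  | smul c x _ hx =>
    rw [mul_smul_comm, smul_mul_assoc, map_smul, hx]
    split_ifs
    · rw [map_smul, mul_smul_comm, smul_mul_assoc]
    · rw [smul_zero]
  | mem x hx =>
    obtain ⟨w, hw, rfl⟩ := hx
    rw [← freeWord_append, ← freeWord_append, wordLift_freeWord, deg_append, deg_append, hw,
      mkAlgHom_freeWord]
    simp [wordProd, mul_assoc]

/-- The projection to the component of bidegree `d`, followed by the identification of the
components of this bidegree at two levels that exceed the degree in `t`. -/
lemma exists_transfer {N N' : ℕ∞} {d : ℕ × ℕ}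
    (h : N = N' ∨ (d.2 : ℕ∞) < N ∧ (d.2 : ℕ∞) < N') :
    ∃ θ : Alg N →ₗ[ℚ] Alg N', ∀ w, θ (wordProd N w) = if deg w = d then wordProd N' w else 0 := by
  refine exists_linearMap_of_words _ fun a b hab p s => ?_
  obtain ⟨e, ha, hb, he⟩ := hab.exists_degree
  rw [mul_sub, sub_mul, map_sub, wordLift_mul_mul d ha, wordLift_mul_mul d hb]
  split_ifs with hd
  · have hrel : Rel N' a b := by
      obtain rfl | ⟨h1, h2⟩ := h
      · exact hab
      · have hle : (e.2 : ℕ∞) ≤ d.2 := by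
          rw [← hd]
          simp only [Prod.snd_add]
          exact_mod_cast (by omega)
        exact he N' (hle.trans_lt h1) (hle.trans_lt h2)
    rw [RingQuot.mkAlgHom_rel ℚ hrel, sub_self]
  · rw [sub_zero]

lemma wordProd_mem_piece {N : ℕ∞} {w : List Gen} {d : ℕ × ℕ} (h : deg w = d) :
    wordProd N w ∈ piece N d :=
  Submodule.subset_span ⟨w, h, rfl⟩

lemma eqOn_piece {N : ℕ∞} {d : ℕ × ℕ} {M : Type*} [AddCommGroup M] [Module ℚ M]
    {f g : Alg N →ₗ[ℚ] M} (h : ∀ w, deg w = d → f (wordProd N w) = g (wordProd N w))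
    {a : Alg N} (ha : a ∈ piece N d) : f a = g a := by
  refine LinearMap.eqOn_span (f := f) (g := g) ?_ ha
  rintro _ ⟨w, hw, rfl⟩
  exact h w hw

theorem isInternal_piece (N : ℕ∞) : DirectSum.IsInternal (piece N) := by
  rw [DirectSum.isInternal_submodule_iff_iSupIndep_and_iSup_eq_top]
  constructor
  · intro d
    obtain ⟨θ, hθ⟩ := exists_transfer (N := N) (N' := N) (d := d) (Or.inl rfl)
    rw [Submodule.disjoint_def]
    intro a ha ha'
    have h1 : θ a = LinearMap.id a :=
      eqOn_piece (fun w hw => by rw [hθ, if_pos hw, LinearMap.id_apply]) ha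
    have h2 : (⨆ e, ⨆ (_ : e ≠ d), piece N e) ≤ LinearMap.ker θ := by
      refine iSup₂_le fun e he a ha => ?_
      rw [LinearMap.mem_ker]
      exact eqOn_piece (f := θ) (g := 0) (fun w hw => by
        rw [hθ, if_neg (hw ▸ he), LinearMap.zero_apply]) ha
    exact h1.symm.trans (h2 ha')
  · rw [eq_top_iff, ← span_wordProd, Submodule.span_le]
    rintro _ ⟨w, rfl⟩
    exact Submodule.mem_iSup_of_mem (deg w) (wordProd_mem_piece rfl)

lemma bideg_le_deg {w : List Gen} {g : Gen} (h : g ∈ w) : g.bideg ≤ deg w := by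
  obtain ⟨u, v, rfl⟩ := List.append_of_mem h
  rw [deg_append, show deg (g :: v) = g.bideg + deg v by simp [deg]]
  exact le_add_left le_self_add

lemma length_le_deg (w : List Gen) : w.length ≤ (deg w).1 := by
  induction w with
  | nil => simp
  | cons g w ih =>
    have h : 1 ≤ g.bideg.1 := by cases g <;> simp only [Gen.bideg] <;> omega
    have h' : (deg (g :: w)).1 = g.bideg.1 + (deg w).1 := by simp [deg]
    rw [List.length_cons]
    omega

lemma finite_deg_eq (d : ℕ × ℕ) : {w : List Gen | deg w = d}.Finite := by
  refine (Set.Finite.image (List.map fun k : Fin d.1 => ofLetter k)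
    (List.finite_length_le (Fin d.1) d.1)).subset ?_
  rintro w rfl
  have hr : w ∈ Set.range (List.map fun k : Fin (deg w).1 => ofLetter k) := by
    rw [Set.range_list_map]
    intro g hg
    have h1 : letter g < g.bideg.1 := by
      cases g <;> simp only [letter, Gen.bideg] <;> omega
    exact ⟨⟨letter g, h1.trans_le (bideg_le_deg hg).1⟩, ofLetter_letter g⟩
  obtain ⟨l, hl⟩ := hr
  refine ⟨l, ?_, hl⟩
  have hlen : l.length = w.length := by simpa using congrArg List.length hl
  exact hlen.trans_le (length_le_deg w)

instance finite_piece (N : ℕ∞) (d : ℕ × ℕ) : Module.Finite ℚ (piece N d) := by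
  refine Module.Finite.iff_fg.2 (Submodule.fg_span
    (((finite_deg_eq d).image (wordProd N)).subset ?_))
  rintro _ ⟨w, hw, rfl⟩
  exact ⟨w, hw, rfl⟩

lemma finrank_piece_le {N N' : ℕ∞} {d : ℕ × ℕ} (hN : (d.2 : ℕ∞) < N) (hN' : (d.2 : ℕ∞) < N') :
    Module.finrank ℚ (piece N d) ≤ Module.finrank ℚ (piece N' d) := by
  obtain ⟨θ, hθ⟩ := exists_transfer (d := d) (Or.inr ⟨hN, hN'⟩)
  obtain ⟨η, hη⟩ := exists_transfer (d := d) (Or.inr ⟨hN', hN⟩)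
  have hmap : ∀ a ∈ piece N d, θ a ∈ piece N' d := by
    intro a ha
    refine (Submodule.span_le.2 ?_ : piece N d ≤ (piece N' d).comap θ) ha
    rintro _ ⟨w, hw, rfl⟩
    rw [SetLike.mem_coe, Submodule.mem_comap, hθ, if_pos (show deg w = d from hw)]
    exact wordProd_mem_piece hw
  refine LinearMap.finrank_le_finrank_of_injective (f := θ.restrict hmap) fun a b hab => ?_
  have hinv : ∀ a ∈ piece N d, η (θ a) = a := fun a ha =>
    eqOn_piece (f := η ∘ₗ θ) (g := LinearMap.id) (fun w hw => by
      rw [LinearMap.comp_apply, hθ, if_pos hw, hη, if_pos hw, LinearMap.id_apply]) ha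
  rw [Subtype.ext_iff, ← hinv a a.2, ← hinv b b.2]
  exact congrArg η (congrArg Subtype.val hab)

lemma finrank_piece_eq {N : ℕ∞} {d : ℕ × ℕ} (hN : (d.2 : ℕ∞) < N) :
    Module.finrank ℚ (piece N d) = Module.finrank ℚ (piece ⊤ d) :=
  le_antisymm (finrank_piece_le hN (ENat.natCast_lt_top _))
    (finrank_piece_le (ENat.natCast_lt_top _) hN)

/-- A one of the sequence is at a position at most the degree in `t` of its word. -/
lemma le_deg_of_mem {S : Finset ℕ} (hS : Admissible S) {k : ℕ} (hk : k ∈ S) :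
    k ≤ (deg (seqWord S)).2 := by
  have key : ∀ n ∈ (seqWord S).map letter, n ≤ (deg (seqWord S)).2 := by
    intro n hn
    obtain ⟨g, hg, rfl⟩ := List.mem_map.1 hn
    refine le_trans ?_ (bideg_le_deg hg).2
    cases g <;> simp only [letter, Gen.bideg] <;> omega
  obtain h | h | ⟨h0, h⟩ := (mem_iff_letters hS k).1 hk <;> have := key _ h <;> omega

/-- The admissible sequences of a given bidegree. -/
def seqsOfDeg (d : ℕ × ℕ) : Finset (Finset ℕ) :=
  (Finset.range (d.2 + 1)).powerset.filter fun S => Admissible S ∧ deg (seqWord S) = d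

lemma mem_seqsOfDeg {d : ℕ × ℕ} {S : Finset ℕ} :
    S ∈ seqsOfDeg d ↔ Admissible S ∧ deg (seqWord S) = d := by
  rw [seqsOfDeg, Finset.mem_filter, Finset.mem_powerset, and_iff_right_iff_imp]
  rintro ⟨hS, rfl⟩ k hk
  have := le_deg_of_mem hS hk
  rw [Finset.mem_range]
  omega

lemma finrank_piece_top (d : ℕ × ℕ) :
    Module.finrank ℚ (piece ⊤ d) = (seqsOfDeg d).card := by
  let i : seqsOfDeg d → {S : Finset ℕ // Admissible S} :=
    fun S => ⟨S.1, (mem_seqsOfDeg.1 S.2).1⟩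
  have hi : Function.Injective i := fun S T h => Subtype.ext (Subtype.mk.inj h)
  have hli : LinearIndependent ℚ (fun S : seqsOfDeg d => seqMonomial S.1) :=
    linearIndependent_seqMonomial.comp i hi
  have hspan : Submodule.span ℚ (Set.range fun S : seqsOfDeg d => seqMonomial S.1) =
      piece ⊤ d := by
    refine le_antisymm (Submodule.span_le.2 ?_) fun a ha => ?_
    · rintro _ ⟨S, rfl⟩
      exact wordProd_mem_piece (mem_seqsOfDeg.1 S.2).2
    · obtain ⟨θ, hθ⟩ := exists_transfer (N := ⊤) (N' := ⊤) (d := d) (Or.inl rfl)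
      have h1 : θ a = LinearMap.id a :=
        eqOn_piece (fun w hw => by rw [hθ, if_pos hw, LinearMap.id_apply]) ha
      rw [LinearMap.id_apply] at h1
      have h2 : a ∈ Submodule.span ℚ (Set.range
          fun S : {S : Finset ℕ // Admissible S} => seqMonomial S.1) := by
        rw [span_seqMonomial]
        trivial
      rw [← h1]
      refine (Submodule.span_le.2 ?_ : _ ≤ (Submodule.span ℚ (Set.range
        fun S : seqsOfDeg d => seqMonomial S.1)).comap θ) h2
      rintro _ ⟨S, rfl⟩
      rw [SetLike.mem_coe, Submodule.mem_comap]
      have h3 := hθ (seqWord S.1)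
      rw [show wordProd ⊤ (seqWord S.1) = seqMonomial S.1 from rfl] at h3
      rw [show θ (seqMonomial S.1) = _ from h3]
      split_ifs with hd
      · exact Submodule.subset_span ⟨⟨S.1, mem_seqsOfDeg.2 ⟨S.2, hd⟩⟩, rfl⟩
      · exact Submodule.zero_mem _
  rw [← hspan, finrank_span_eq_card hli, Fintype.card_coe]

/-! ### The recursion for the state sums -/

/-- The weight of a sequence, or zero if the sequence is not admissible. -/
noncomputable def admWeight (S : Finset ℕ) : QT := if Admissible S then weight S else 0

lemma stateSum_eq (n : ℕ) : stateSum n = ∑ S ∈ (Finset.range n).powerset, admWeight S := by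
  rw [stateSum, Finset.sum_filter]
  rfl

section Union

variable {T B : Finset ℕ} {k : ℕ}

lemma admissible_union (hT : ∀ i ∈ T, i < k) (hB : ∀ i ∈ B, k < i) :
    Admissible (T ∪ B) ↔ Admissible T ∧ Admissible B := by
  have hT' : ∀ i, k ≤ i → i ∉ T := fun i h h' => absurd (hT i h') (not_lt.2 h)
  have hB' : ∀ i, i ≤ k → i ∉ B := fun i h h' => absurd (hB i h') (not_lt.2 h)
  have hstep : ∀ i, i ∈ T ∪ B → i + 1 ∈ T ∪ B →
      (i ∈ T ∧ i + 1 ∈ T) ∨ (i ∈ B ∧ i + 1 ∈ B) := by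
    intro i h1 h2
    rw [Finset.mem_union] at h1 h2
    rcases lt_trichotomy i k with h | h | h
    · have := hB' i h.le
      have := hB' (i + 1) h
      tauto
    · have := hB' i h.le
      have := hT' i h.ge
      tauto
    · have := hT' i h.le
      have := hT' (i + 1) (by omega)
      tauto
  have hdisj : ∀ i, i ∈ T → i ∉ B := fun i h => hB' i (hT i h).le
  constructor
  · intro h
    refine ⟨⟨fun i h0 h1 => h.1 i (Finset.mem_union_left _ h0)
      ⟨Finset.mem_union_left _ h1.1, Finset.mem_union_left _ h1.2.1,
        Finset.mem_union_left _ h1.2.2⟩, fun i h0 h1 h2 => h.2 i (Finset.mem_union_left _ h0)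
        (Finset.mem_union_left _ h1) (Finset.mem_union_left _ h2)⟩, ⟨fun i h0 h1 =>
      h.1 i (Finset.mem_union_right _ h0)
      ⟨Finset.mem_union_right _ h1.1, Finset.mem_union_right _ h1.2.1,
        Finset.mem_union_right _ h1.2.2⟩, fun i h0 h1 h2 => h.2 i (Finset.mem_union_right _ h0)
        (Finset.mem_union_right _ h1) (Finset.mem_union_right _ h2)⟩⟩
  · rintro ⟨hA, hA'⟩
    constructor
    · rintro i h0 ⟨h1, h2, h3⟩
      have g0 := hstep i h0 h1
      have g1 := hstep (i + 1) h1 h2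
      have g2 := hstep (i + 2) h2 h3
      have d1 := hdisj (i + 1)
      have d2 := hdisj (i + 2)
      have a1 := hA.1 i
      have a2 := hA'.1 i
      tauto
    · intro i h0 h1 h2
      have g0 := hstep i h0 h1
      have g1 := hstep (i + 1) h1 h2
      have d1 := hdisj (i + 1)
      have a1 := hA.2 i
      have a2 := hA'.2 i
      tauto

/-- Sequences separated by a zero have multiplicative weight. -/
lemma weight_union (hT : ∀ i ∈ T, i < k) (hB : ∀ i ∈ B, k < i) :
    weight (T ∪ B) = weight T * weight B := by
  have hT' : ∀ i, k ≤ i → i ∉ T := fun i h h' => absurd (hT i h') (not_lt.2 h)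
  have hB' : ∀ i, i ≤ k → i ∉ B := fun i h h' => absurd (hB i h') (not_lt.2 h)
  have hstarts : blockStarts (T ∪ B) = blockStarts T ∪ blockStarts B := by
    ext i
    simp only [Finset.mem_union, mem_blockStarts]
    have h1 := hT i
    have h2 := hB i
    have h3 := hT' (i - 1)
    have h4 := hB' (i - 1)
    rcases lt_trichotomy i k with h | h | h
    · have := h4 (by omega)
      have := hB' i h.le
      tauto
    · have := hB' i h.le
      have := hT' i h.ge
      tauto
    · have := h3 (by omega)
      have := hT' i h.le
      tauto
  have hdisj : Disjoint (blockStarts T) (blockStarts B) := by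
    rw [Finset.disjoint_left]
    intro i hi hi'
    rw [mem_blockStarts] at hi hi'
    exact hB' i (hT i hi.1).le hi'.1
  rw [weight, hstarts, Finset.prod_union hdisj, weight, weight]
  congr 1
  · refine Finset.prod_congr rfl fun i hi => ?_
    have hi := hT i (mem_blockStarts.1 hi).1
    have h1 : i + 1 ∈ T ∪ B ↔ i + 1 ∈ T := by
      rw [Finset.mem_union, or_iff_left (hB' _ (by omega))]
    unfold blockWeight
    by_cases h : i + 1 ∈ T
    · have h2 : i + 2 ∈ T ∪ B ↔ i + 2 ∈ T := by
        rw [Finset.mem_union, or_iff_left (hB' _ (by have := hT _ h; omega))]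
      simp only [h1, h2]
    · simp only [h1, h, not_false_eq_true, if_true]
  · refine Finset.prod_congr rfl fun i hi => ?_
    have hi := hB i (mem_blockStarts.1 hi).1
    have h1 : i + 1 ∈ T ∪ B ↔ i + 1 ∈ B := by
      rw [Finset.mem_union, or_iff_right (hT' _ (by omega))]
    have h2 : i + 2 ∈ T ∪ B ↔ i + 2 ∈ B := by
      rw [Finset.mem_union, or_iff_right (hT' _ (by omega))]
    simp only [blockWeight, h1, h2]

lemma admWeight_union (hT : ∀ i ∈ T, i < k) (hB : ∀ i ∈ B, k < i) :
    admWeight (T ∪ B) = admWeight T * admWeight B := by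
  simp only [admWeight, admissible_union hT hB, weight_union hT hB]
  by_cases h1 : Admissible T <;> by_cases h2 : Admissible B <;> simp [h1, h2]

end Union

lemma admWeight_empty : admWeight ∅ = 1 := by
  rw [admWeight, if_pos (by decide), weight]
  exact Finset.prod_empty

lemma admWeight_singleton (k : ℕ) : admWeight {k} = q ^ (2 * k + 2) * t ^ (2 * k) := by
  have h1 : Admissible {k} := by simp [Admissible]
  have h2 : blockStarts {k} = {k} := by
    ext i
    rw [mem_blockStarts]
    simp only [Finset.mem_singleton]
    omega
  rw [admWeight, if_pos h1, weight, h2, Finset.prod_singleton, blockWeight, if_pos (by simp)]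

lemma admWeight_pair (k : ℕ) : admWeight {k, k + 1} = q ^ (2 * k + 8) * t ^ (2 * k + 3) := by
  have h1 : Admissible {k, k + 1} := by
    constructor <;> intro i <;> simp only [Finset.mem_insert, Finset.mem_singleton] <;> omega
  have h2 : blockStarts {k, k + 1} = {k} := by
    ext i
    rw [mem_blockStarts]
    simp only [Finset.mem_insert, Finset.mem_singleton]
    omega
  rw [admWeight, if_pos h1, weight, h2, Finset.prod_singleton, blockWeight, if_neg (by simp),
    if_pos (by simp)]

lemma stateSum_succ (n : ℕ) : stateSum (n + 1) =
    stateSum n + ∑ S ∈ (Finset.range n).powerset, admWeight (insert n S) := by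
  rw [stateSum_eq, stateSum_eq, Finset.range_add_one, Finset.sum_powerset_insert (by simp)]

lemma sum_insert_eq (n : ℕ) : ∑ S ∈ (Finset.range n).powerset, admWeight (insert (n + 1) S) =
    stateSum n * (q ^ (2 * n + 4) * t ^ (2 * n + 2)) := by
  rw [stateSum_eq, Finset.sum_mul]
  refine Finset.sum_congr rfl fun S hS => ?_
  rw [Finset.insert_eq, Finset.union_comm, admWeight_union (k := n), admWeight_singleton]
  · ring
  · exact fun i hi => Finset.mem_range.1 (Finset.mem_powerset.1 hS hi)
  · simp

lemma sum_insert_insert_eq (n : ℕ) :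
    ∑ S ∈ (Finset.range n).powerset, admWeight (insert (n + 2) (insert (n + 1) S)) =
      stateSum n * (q ^ (2 * n + 10) * t ^ (2 * n + 5)) := by
  rw [stateSum_eq, Finset.sum_mul]
  refine Finset.sum_congr rfl fun S hS => ?_
  rw [show insert (n + 2) (insert (n + 1) S) = S ∪ {n + 1, n + 1 + 1} by ext; simp; tauto,
    admWeight_union (k := n), admWeight_pair]
  · ring
  · exact fun i hi => Finset.mem_range.1 (Finset.mem_powerset.1 hS hi)
  · simp

/-- The recursion obtained by splitting off the last block. -/
lemma stateSum_add_four (n : ℕ) : stateSum (n + 4) = stateSum (n + 3) +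
    stateSum (n + 2) * (q ^ (2 * n + 8) * t ^ (2 * n + 6)) +
      stateSum (n + 1) * (q ^ (2 * n + 12) * t ^ (2 * n + 7)) := by
  have h3 : ∑ S ∈ (Finset.range (n + 1)).powerset,
      admWeight (insert (n + 3) (insert (n + 2) (insert (n + 1) S))) = 0 := by
    refine Finset.sum_eq_zero fun S _ => if_neg fun h => ?_
    have := h.2 (n + 1) (by simp) (by simp) (by simp)
    omega
  rw [stateSum_succ, Finset.range_add_one (n := n + 2), Finset.sum_powerset_insert (by simp),
    sum_insert_eq, Finset.range_add_one (n := n + 1), Finset.sum_powerset_insert (by simp),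
    sum_insert_insert_eq, h3, add_zero]
  ring

lemma stateSum_zero : stateSum 0 = 1 := by
  rw [stateSum_eq, Finset.range_zero, Finset.powerset_empty, Finset.sum_singleton,
    admWeight_empty]

lemma stateSum_one : stateSum 1 = 1 + q ^ 2 := by
  rw [stateSum_succ, stateSum_zero, Finset.range_zero, Finset.powerset_empty,
    Finset.sum_singleton, insert_empty_eq, admWeight_singleton]
  simp

lemma stateSum_two : stateSum 2 = 1 + q ^ 2 + q ^ 4 * t ^ 2 + q ^ 8 * t ^ 3 := by
  rw [stateSum_succ, stateSum_one, Finset.range_one, ← insert_empty_eq,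
    Finset.sum_powerset_insert (by simp), Finset.powerset_empty, Finset.sum_singleton,
    Finset.sum_singleton, insert_empty_eq, insert_empty_eq, admWeight_singleton,
    Finset.pair_comm, admWeight_pair 0]
  ring

lemma admWeight_triple : admWeight {0, 1, 2} = q ^ 12 * t ^ 5 := by
  rw [admWeight, if_pos (by decide), weight, show blockStarts {0, 1, 2} = {0} by decide,
    Finset.prod_singleton]
  simp [blockWeight]

lemma stateSum_three : stateSum 3 = 1 + q ^ 2 + q ^ 4 * t ^ 2 + q ^ 8 * t ^ 3 + q ^ 6 * t ^ 4 +
    q ^ 8 * t ^ 4 + q ^ 10 * t ^ 5 + q ^ 12 * t ^ 5 := by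
  rw [stateSum_succ, stateSum_two, Finset.range_add_one (n := 1),
    Finset.sum_powerset_insert (by simp), sum_insert_eq, stateSum_one, Finset.range_one,
    ← insert_empty_eq, Finset.sum_powerset_insert (by simp), Finset.powerset_empty,
    Finset.sum_singleton, Finset.sum_singleton,
    show insert 2 (insert 1 (∅ : Finset ℕ)) = {1, 1 + 1} by decide, admWeight_pair,
    show insert 2 (insert 1 (insert 0 (∅ : Finset ℕ))) = {0, 1, 2} by decide, admWeight_triple]
  ring

theorem K_eq_stateSum : ∀ n, K n = stateSum n
  | 0 => stateSum_zero.symm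
  | 1 => stateSum_one.symm
  | 2 => stateSum_two.symm
  | 3 => stateSum_three.symm
  | n + 4 => by
    rw [K, K_eq_stateSum (n + 3), K_eq_stateSum (n + 2), K_eq_stateSum (n + 1),
      stateSum_add_four, show 2 * (n + 4) - 2 = 2 * n + 6 by omega,
      show 2 * (n + 4) - 1 = 2 * n + 7 by omega]
    ring

/-! ### The limits -/

lemma coeff_weight (S : Finset ℕ) (d : Fin 2 →₀ ℕ) :
    MvPowerSeries.coeff d (weight S) = if deg (seqWord S) = (d 0, d 1) then 1 else 0 := by
  have h : weight S = MvPowerSeries.monomial (Finsupp.single 0 (deg (seqWord S)).1 +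
      Finsupp.single 1 (deg (seqWord S)).2) 1 := by
    rw [weight_eq, q, t, MvPowerSeries.X_pow_eq, MvPowerSeries.X_pow_eq,
      MvPowerSeries.monomial_mul_monomial, one_mul]
  rw [h, MvPowerSeries.coeff_monomial]
  congr 1
  rw [eq_iff_iff, Finsupp.ext_iff, Fin.forall_fin_two, Prod.ext_iff]
  simp [eq_comm]

lemma coeff_hilbertSeries (N : ℕ∞) (d : Fin 2 →₀ ℕ) :
    MvPowerSeries.coeff d (hilbertSeries N) = Module.finrank ℚ (piece N (d 0, d 1)) := rfl

lemma coeff_stateSum {n : ℕ} {d : Fin 2 →₀ ℕ} (h : d 1 < n) :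
    MvPowerSeries.coeff d (stateSum n) = MvPowerSeries.coeff d (hilbertSeries ⊤) := by
  rw [coeff_hilbertSeries, finrank_piece_top, stateSum, map_sum]
  simp only [coeff_weight]
  rw [← Finset.sum_filter, Finset.filter_filter, Finset.sum_const, nsmul_one]
  congr 2
  ext S
  rw [mem_seqsOfDeg, Finset.mem_filter, Finset.mem_powerset, and_iff_right_iff_imp]
  rintro ⟨hS, hd⟩ k hk
  have := le_deg_of_mem hS hk
  rw [hd] at this
  exact Finset.mem_range.2 (this.trans_lt h)

lemma tendsto_of_coeff {f : ℕ → QT} {g : QT} (h : ∀ d : Fin 2 →₀ ℕ, ∀ n, d 1 < n →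
    MvPowerSeries.coeff d (f n) = MvPowerSeries.coeff d g) : Tendsto f atTop (𝓝 g) := by
  rw [MvPowerSeries.WithPiTopology.tendsto_iff_coeff_tendsto]
  intro d
  refine tendsto_const_nhds.congr' ?_
  filter_upwards [eventually_gt_atTop (d 1)] with n hn
  exact (h d n hn).symm

theorem tendsto_K : Tendsto K atTop (𝓝 (hilbertSeries ⊤)) :=
  tendsto_of_coeff fun d n h => by rw [K_eq_stateSum, coeff_stateSum h]

theorem tendsto_hilbertSeries :
    Tendsto (fun n : ℕ => hilbertSeries (n : ℕ∞)) atTop (𝓝 (hilbertSeries ⊤)) :=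
  tendsto_of_coeff fun d n h => by
    rw [coeff_hilbertSeries, coeff_hilbertSeries, finrank_piece_eq]
    exact_mod_cast h

end StableKh

theorem mainTheorem3 :
    -- the algebras are bigraded, with finite-dimensional components
    (∀ N : ℕ∞, DirectSum.IsInternal (StableKh.piece N)) ∧
    (∀ (N : ℕ∞) (d : ℕ × ℕ), Module.Finite ℚ (StableKh.piece N d)) ∧
    -- the recursion computes the state sums of the combinatorial model
    (∀ n : ℕ, StableKh.K n = StableKh.stateSum n) ∧
    -- the limit of the `K n` exists and is the Hilbert series of the infinite algebra
    Tendsto StableKh.K atTop (𝓝 (StableKh.hilbertSeries ⊤)) ∧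
    -- the Hilbert series of the algebras on finitely many generators have the same limit
    Tendsto (fun n : ℕ => StableKh.hilbertSeries (n : ℕ∞)) atTop
      (𝓝 (StableKh.hilbertSeries ⊤)) ∧
    -- the monomial matched to an admissible sequence has the weight of the sequence as bidegree
    (∀ S : Finset ℕ, StableKh.Admissible S → ∃ d : ℕ × ℕ,
      StableKh.weight S = StableKh.q ^ d.1 * StableKh.t ^ d.2 ∧
        StableKh.seqMonomial S ∈ StableKh.piece ⊤ d) ∧
    -- the matched monomials form a basis of the infinite algebra
    LinearIndependent ℚ (fun S : {S : Finset ℕ // StableKh.Admissible S} =>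
      StableKh.seqMonomial S.1) ∧
    Submodule.span ℚ (Set.range fun S : {S : Finset ℕ // StableKh.Admissible S} =>
      StableKh.seqMonomial S.1) = ⊤ :=
  ⟨StableKh.isInternal_piece, StableKh.finite_piece, StableKh.K_eq_stateSum, StableKh.tendsto_K,
    StableKh.tendsto_hilbertSeries,
    fun S _ => ⟨StableKh.deg (StableKh.seqWord S), StableKh.weight_eq S,
      StableKh.wordProd_mem_piece rfl⟩,
    StableKh.linearIndependent_seqMonomial, StableKh.span_seqMonomial⟩
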